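/- Single-time correlations in the thermal state of the N-QBM model. Let $\hbar,\beta>0$. Consider finitely many system oscillators with position and momentum operators $\mathbf X,\mathbf P$ and finitely many reservoir oscillators with position and momentum operators $\mathbf x,\mathbf p$, acting on the $L^2$ space of all coordinates, with Hamiltonian $$H_C=\tfrac12\mathbf P^{T}M^{-1}\mathbf P+\tfrac12\mathbf X^{T}C\,\mathbf X+\tfrac12\mathbf p^{T}m^{-1}\mathbf p+\tfrac12(\mathbf x-c^{-1}g\mathbf X)^{T}c\,(\mathbf x-c^{-1}g\mathbf X),$$ where $M,C$ and $m,c$ are real symmetric positive definite matrices and $g$ is an arbitrary real (rectangular) matrix. Put $\nu_r=2\pi r/(\hbar\beta)$, $\omega=(m^{-1/2}c\,m^{-1/2})^{1/2}$, $$\gamma(t)=g^{T}m^{-1/2}\frac{\cos(\omega t)}{2\omega^{2}}m^{-1/2}g,\qquad f(t)=m^{-1/2}\frac{\sin(\omega t)}{\omega}m^{-1/2},$$ let $\hat\gamma(z)=\int_0^\infty e^{-zt}\gamma(t)\,dt$ and $\hat f(z)=\int_0^\infty e^{-zt}f(t)\,dt$ for $z>0$, and let $\hat G(z)=[z^{2}M+2z\hat\gamma(z)+C]^{-1}$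 for $z>0$, $\hat G(0)=C^{-1}$. Then the thermal state $e^{-\beta H_C}/Z_C$ with $Z_C=\mathrm{Tr}\,e^{-\beta H_C}$, and that of the free reservoir, $H_E=\tfrac12\mathbf p^{T}m^{-1}\mathbf p+\tfrac12\mathbf x^{T}c\,\mathbf x$, exist (there are complete orthonormal systems of energy eigenfunctions, and the partition functions are finite). Write $\langle\cdot\rangle_C$ and $\langle\cdot\rangle_E$ for the expectations in these states, where $\langle\mathbf A\mathbf B^{T}\rangle$ is the matrix of expectations of the symmetrized products $\tfrac12(A_iB_j+B_jA_i)$. All the traces and series below converge absolutely. The position–momentum correlations $\langle\mathbf X\mathbf P^{T}\rangle_C$, $\langle\mathbf X\mathbf p^{T}\rangle_C$, $\langle\mathbf x\mathbf P^{T}\rangle_C$, $\langle\mathbf x\mathbf p^{T}\rangle_C$ vanish, and $$\langle\mathbf X\mathbf X^{T}\rangle_C=\frac1\beta\hat G(0)+\frac2\beta\sum_{r\ge1}\hat G(\nu_r),$$ $$\langle\mathbf P\mathbf P^{T}\rangle_C=\frac1\beta\big(M-\nu_0^2M\hat G(\nu_0)M\big)+\frac2\beta\sum_{r\ge1}\big(M-\nu_r^2M\hat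 G(\nu_r)M\big),$$ $$\langle\mathbf X\mathbf x^{T}\rangle_C=\langle\mathbf X\mathbf X^{T}\rangle_C\,g^{T}c^{-1}-\frac2\beta\sum_{r\ge1}\nu_r^2\,\hat G(\nu_r)\,g^{T}\hat f(\nu_r)\,m\,c^{-1},$$ the last sum term being $-\frac4\beta\sum_{r\ge1}\nu_r\hat G(\nu_r)\hat\gamma(\nu_r)g^{-1}$ whenever $g$ has a right inverse $g^{-1}$ (any $g^{-1}$ with $g\,g^{-1}=1$), $$\langle\mathbf P\mathbf p^{T}\rangle_C=M\langle\mathbf X\mathbf x^{T}\rangle_C\,c-M\langle\mathbf X\mathbf X^{T}\rangle_C\,g^{T},$$ $$\langle\mathbf p\mathbf p^{T}\rangle_C=\langle\mathbf p\mathbf p^{T}\rangle_E-\frac2\beta\sum_{r\ge1}\nu_r^2\,m\hat f(\nu_r)g\hat G(\nu_r)g^{T}\hat f(\nu_r)m,$$ $$\langle\mathbf x\mathbf x^{T}\rangle_C=\langle\mathbf x\mathbf x^{T}\rangle_E+c^{-1}g\langle\mathbf X\mathbf X^{T}\rangle_Cg^{T}c^{-1}-\frac2\beta\sum_{r\ge1}\nu_r^2\,c^{-1}m\hat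 f(\nu_r)g\hat G(\nu_r)g^{T}\hat f(\nu_r)$$ $$\qquad-\frac2\beta\sum_{r\ge1}\nu_r^2\,\hat f(\nu_r)g\hat G(\nu_r)g^{T}\hat f(\nu_r)m\,c^{-1}-\frac2\beta\sum_{r\ge1}\nu_r^4\,c^{-1}m\hat f(\nu_r)g\hat G(\nu_r)g^{T}\hat f(\nu_r)m\,c^{-1}.$$ Moreover, regard $Z_C$ as a function of the independent matrices $C,M^{-1},c,m^{-1},g$, the Hamiltonian being written with potential $\tfrac12\mathbf X^{T}C\mathbf X+\tfrac12\mathbf x^{T}c\,\mathbf x-\mathbf x^{T}g\mathbf X+\tfrac12\mathbf X^{T}g^{T}c^{-1}g\mathbf X$, and for a matrix variable $A$ let $\partial/\partial A$ be the matrix of partial derivatives in the entries of $A$, all entries being varied independently. These derivatives of $\log Z_C$ exist, and $$\langle\mathbf X\mathbf X^{T}\rangle_C=-\frac2\beta\frac{\partial\log Z_C}{\partial C},\quad\langle\mathbf P\mathbf P^{T}\rangle_C=-\frac2\beta\frac{\partial\log Z_C}{\partial M^{-1}},\quad\langle\mathbf X\mathbf x^{T}\rangle_C=\frac1\beta\frac{\partial\log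 Z_C}{\partial g^{T}}+\langle\mathbf X\mathbf X^{T}\rangle_Cg^{T}c^{-1},$$ $$\langle\mathbf x\mathbf x^{T}\rangle_C=-\frac2\beta\frac{\partial\log Z_C}{\partial c}+c^{-1}g\langle\mathbf X\mathbf X^{T}\rangle_Cg^{T}c^{-1},\quad\langle\mathbf p\mathbf p^{T}\rangle_C=-\frac2\beta\frac{\partial\log Z_C}{\partial m^{-1}}.$$ -/

import Mathlib

open MeasureTheory Matrix
open scoped SchwartzMap LineDeriv ComplexInnerProductSpace

noncomputable section

namespace QBM

section Oscillators

/-! ### Thermal states of finitely many coupled oscillators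

`ι` indexes the degrees of freedom, the Hilbert space is `L²(ℝ^ι; ℂ)`, and operators are given on
the Schwartz functions, a common invariant core for positions, momenta and the Hamiltonian. -/

variable {ι : Type*} [Fintype ι]

/-- Schwartz wave functions of the coordinates `q = (q_i)_{i ∈ ι}`. -/
abbrev Wave (ι : Type*) [Fintype ι] := 𝓢(EuclideanSpace ℝ ι, ℂ)

/-- Operators on Schwartz wave functions. -/
abbrev Op (ι : Type*) [Fintype ι] := Wave ι →L[ℂ] Wave ι

/-- The position operator `q_i`: multiplication by the `i`-th coordinate. -/
def posOp (i : ι) : Op ι :=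
  SchwartzMap.smulLeftCLM ℂ (fun x : EuclideanSpace ℝ ι => ((x i : ℝ) : ℂ))

/-- The momentum operator `p_i = -iħ ∂/∂q_i`. -/
def momOp [DecidableEq ι] (ħ : ℝ) (i : ι) : Op ι :=
  (-(Complex.I * (ħ : ℂ))) •
    LineDeriv.lineDerivOpCLM ℂ (Wave ι) (EuclideanSpace.single i (1 : ℝ))

theorem posOp_apply (i : ι) (ψ : Wave ι) (x : EuclideanSpace ℝ ι) :
    posOp i ψ x = (x i : ℂ) * ψ x := by
  have h : Function.HasTemperateGrowth (fun x : EuclideanSpace ℝ ι => ((x i : ℝ) : ℂ)) :=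
    (Complex.ofRealCLM.comp (EuclideanSpace.proj i : EuclideanSpace ℝ ι →L[ℝ] ℝ)).hasTemperateGrowth
  simp [posOp, SchwartzMap.smulLeftCLM_apply_apply h]

theorem momOp_apply [DecidableEq ι] (ħ : ℝ) (i : ι) (ψ : Wave ι) (x : EuclideanSpace ℝ ι) :
    momOp ħ i ψ x =
      -(Complex.I * ħ) * lineDeriv ℝ (ψ : EuclideanSpace ℝ ι → ℂ) x (EuclideanSpace.single i 1) := by
  simp [momOp, SchwartzMap.lineDerivOp_apply]

/-- The quadratic Hamiltonian `H = ½ ∑ K_ij p_i p_j + ½ ∑ V_ij q_i q_j`, where `K` is the inverse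
of the mass matrix and `V` is the matrix of spring constants. -/
def hamiltonian [DecidableEq ι] (ħ : ℝ) (K V : Matrix ι ι ℝ) : Op ι :=
  ((1 / 2 : ℝ) : ℂ) • ∑ i, ∑ j, ((K i j : ℝ) : ℂ) • (momOp ħ i ∘L momOp ħ j) +
  ((1 / 2 : ℝ) : ℂ) • ∑ i, ∑ j, ((V i j : ℝ) : ℂ) • (posOp i ∘L posOp j)

/-- The class in `L²(ℝ^ι; ℂ)` of a Schwartz wave function. -/
def toL2 (ψ : Wave ι) : Lp ℂ 2 (volume : Measure (EuclideanSpace ℝ ι)) := ψ.toLp 2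

/-- A complete orthonormal system of `L²(ℝ^ι; ℂ)` consisting of eigenfunctions of the
Hamiltonian. -/
structure EnergyEigenbasis [DecidableEq ι] (ħ : ℝ) (K V : Matrix ι ι ℝ) where
  index : Type
  vec : index → Wave ι
  energy : index → ℝ
  eigen : ∀ k, hamiltonian ħ K V (vec k) = ((energy k : ℝ) : ℂ) • vec k
  orthonormal : Orthonormal ℂ (fun k => toL2 (vec k))
  complete : ⊤ ≤ (Submodule.span ℂ (Set.range fun k => toL2 (vec k))).topologicalClosure

/-- The partition function `Z = Tr e^{-βH}`, the trace being taken in an energy eigenbasis. -/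
def partitionFunction [DecidableEq ι] (ħ β : ℝ) (K V : Matrix ι ι ℝ) : ℝ :=
  open Classical in
  if h : Nonempty (EnergyEigenbasis ħ K V) then
    ∑' k : h.some.index, Real.exp (-β * h.some.energy k)
  else 0

/-- The thermal state `e^{-βH} / Z` exists: `H` has an energy eigenbasis and `e^{-βH}` has the
finite trace `Z`, whichever energy eigenbasis is used to compute it. -/
def HasThermalState [DecidableEq ι] (ħ β : ℝ) (K V : Matrix ι ι ℝ) : Prop :=
  Nonempty (EnergyEigenbasis ħ K V) ∧ 0 < partitionFunction ħ β K V ∧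
  ∀ B : EnergyEigenbasis ħ K V,
    HasSum (fun k => Real.exp (-β * B.energy k)) (partitionFunction ħ β K V)

/-- The observable `A` has the expectation value `⟨A⟩ = Tr(A e^{-βH}) / Z = a` in the thermal state:
the trace converges absolutely, with value `a`, in every energy eigenbasis. -/
def HasThermalExpectation [DecidableEq ι] (ħ β : ℝ) (K V : Matrix ι ι ℝ) (A : Op ι) (a : ℂ) :
    Prop :=
  HasThermalState ħ β K V ∧
  ∀ B : EnergyEigenbasis ħ K V,
    HasSum (fun k => ((Real.exp (-β * B.energy k) / partitionFunction ħ β K V : ℝ) : ℂ) *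
      ⟪toL2 (B.vec k), toL2 (A (B.vec k))⟫) a

/-- Expectation values are unique. -/
theorem HasThermalExpectation.unique [DecidableEq ι] {ħ β : ℝ} {K V : Matrix ι ι ℝ} {A : Op ι}
    {a b : ℂ} (ha : HasThermalExpectation ħ β K V A a) (hb : HasThermalExpectation ħ β K V A b) :
    a = b :=
  (ha.2 ha.1.1.some).unique (hb.2 ha.1.1.some)

/-- `S` is the matrix `⟨A Bᵀ⟩` of single-time correlations in the thermal state of two finite
families of observables: `S i j` is the expectation of the symmetrized product
`½ (A_i B_j + B_j A_i)`, which is `A_i B_j` if the two operators commute. -/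
def IsCorrelation [DecidableEq ι] {a b : Type*} (ħ β : ℝ) (K V : Matrix ι ι ℝ)
    (A : a → Op ι) (B : b → Op ι) (S : Matrix a b ℝ) : Prop :=
  ∀ i j, HasThermalExpectation ħ β K V
    (((1 / 2 : ℝ) : ℂ) • (A i ∘L B j + B j ∘L A i)) ((S i j : ℝ) : ℂ)

end Oscillators

section Model

/-! ### The model: system oscillators (indexed by `σ`) coupled to a reservoir (indexed by `ε`) -/

variable {σ ε : Type*} [Fintype σ] [DecidableEq σ] [Fintype ε] [DecidableEq ε]

/-- The inverse mass matrix of system and reservoir, in terms of `M⁻¹` and `m⁻¹`. -/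
def closedInvMass (Minv : Matrix σ σ ℝ) (minv : Matrix ε ε ℝ) : Matrix (σ ⊕ ε) (σ ⊕ ε) ℝ :=
  fromBlocks Minv 0 0 minv

/-- The spring constants of system and reservoir, including the bilinear coupling `xᵀ g X` and the
renormalization `½ Xᵀ gᵀ c⁻¹ g X`. -/
def closedSpring (C : Matrix σ σ ℝ) (c : Matrix ε ε ℝ) (g : Matrix ε σ ℝ) :
    Matrix (σ ⊕ ε) (σ ⊕ ε) ℝ :=
  fromBlocks (C + gᵀ * c⁻¹ * g) (-gᵀ) (-g) c

/-- The potential energy is `½ Xᵀ C X + ½ (x - c⁻¹ g X)ᵀ c (x - c⁻¹ g X)`. -/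
theorem closedSpring_quadraticForm (C : Matrix σ σ ℝ) {c : Matrix ε ε ℝ} (hc : c.PosDef)
    (g : Matrix ε σ ℝ) (X : σ → ℝ) (x : ε → ℝ) :
    Sum.elim X x ⬝ᵥ (closedSpring C c g *ᵥ Sum.elim X x) =
      X ⬝ᵥ (C *ᵥ X) +
        (x - c⁻¹ *ᵥ (g *ᵥ X)) ⬝ᵥ (c *ᵥ (x - c⁻¹ *ᵥ (g *ᵥ X))) := by
  have hu : IsUnit c.det := (Matrix.isUnit_iff_isUnit_det c).1 hc.isUnit
  have hT : cᵀ = c := by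
    have := hc.isHermitian
    rwa [Matrix.IsHermitian, Matrix.conjTranspose_eq_transpose_of_trivial] at this
  have h1 : c *ᵥ (c⁻¹ *ᵥ (g *ᵥ X)) = g *ᵥ X := by
    rw [Matrix.mulVec_mulVec, Matrix.mul_nonsing_inv c hu, Matrix.one_mulVec]
  have h2 : (c⁻¹ *ᵥ (g *ᵥ X)) ⬝ᵥ (c *ᵥ x) = (g *ᵥ X) ⬝ᵥ x := by
    rw [Matrix.dotProduct_mulVec, ← Matrix.mulVec_transpose, hT, h1]
  have h3 : X ⬝ᵥ (gᵀ *ᵥ x) = (g *ᵥ X) ⬝ᵥ x := by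
    rw [Matrix.dotProduct_mulVec, Matrix.vecMul_transpose]
  have h4 : X ⬝ᵥ ((gᵀ * c⁻¹ * g) *ᵥ X) = (c⁻¹ *ᵥ (g *ᵥ X)) ⬝ᵥ (g *ᵥ X) := by
    rw [← Matrix.mulVec_mulVec, ← Matrix.mulVec_mulVec, Matrix.dotProduct_mulVec,
      Matrix.vecMul_transpose, dotProduct_comm]
  rw [closedSpring, Matrix.fromBlocks_mulVec, sumElim_dotProduct_sumElim]
  simp only [Sum.elim_comp_inl, Sum.elim_comp_inr, Matrix.mulVec_sub, dotProduct_add,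
    dotProduct_sub, sub_dotProduct, h1, h2, h4, Matrix.add_mulVec, Matrix.neg_mulVec,
    dotProduct_neg, h3, dotProduct_comm x (g *ᵥ X)]
  ring

/-- `Z_C`, as a function of the independent matrices `C`, `M⁻¹`, `c`, `m⁻¹` and `g`. -/
def closedZ (ħ β : ℝ) (C Minv : Matrix σ σ ℝ) (c minv : Matrix ε ε ℝ) (g : Matrix ε σ ℝ) : ℝ :=
  partitionFunction ħ β (closedInvMass Minv minv) (closedSpring C c g)

/-- `⟨A Bᵀ⟩_C = S` in the thermal state of the closed system (system and reservoir). -/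
def IsClosedCorrelation {a b : Type*} (ħ β : ℝ) (M C : Matrix σ σ ℝ) (m c : Matrix ε ε ℝ)
    (g : Matrix ε σ ℝ) (A : a → Op (σ ⊕ ε)) (B : b → Op (σ ⊕ ε)) (S : Matrix a b ℝ) : Prop :=
  IsCorrelation ħ β (closedInvMass M⁻¹ m⁻¹) (closedSpring C c g) A B S

/-- System positions `X`. -/
def sysX (A : σ) : Op (σ ⊕ ε) := posOp (Sum.inl A)

/-- System momenta `P`. -/
def sysP (ħ : ℝ) (A : σ) : Op (σ ⊕ ε) := momOp ħ (Sum.inl A)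

/-- Reservoir positions `x`. -/
def envX (a : ε) : Op (σ ⊕ ε) := posOp (Sum.inr a)

/-- Reservoir momenta `p`. -/
def envP (ħ : ℝ) (a : ε) : Op (σ ⊕ ε) := momOp ħ (Sum.inr a)

/-- `⟨A Bᵀ⟩_E = S` in the thermal state of the free reservoir, `H_E = ½ pᵀ m⁻¹ p + ½ xᵀ c x`. -/
def IsFreeCorrelation {a b : Type*} (ħ β : ℝ) (m c : Matrix ε ε ℝ)
    (A : a → Op ε) (B : b → Op ε) (S : Matrix a b ℝ) : Prop :=
  IsCorrelation ħ β m⁻¹ c A B S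

/-- The Matsubara frequencies `ν_r = 2πr / (ħβ)`. -/
def matsubara (ħ β : ℝ) (r : ℕ) : ℝ := 2 * Real.pi * r / (ħ * β)

/-- The entrywise Laplace transform of a matrix-valued function, at a real argument. -/
def laplace {a b : Type*} (F : ℝ → Matrix a b ℝ) (z : ℝ) : Matrix a b ℝ :=
  Matrix.of fun i j => ∫ t in Set.Ioi (0 : ℝ), Real.exp (-z * t) * F t i j

/-- `m^{-1/2}`. -/
def invSqrt (m : Matrix ε ε ℝ) : Matrix ε ε ℝ := cfc (fun x : ℝ => (√x)⁻¹) m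

/-- The reservoir frequency matrix: `ω² = m^{-1/2} c m^{-1/2}`. -/
def freq (m c : Matrix ε ε ℝ) : Matrix ε ε ℝ := cfc Real.sqrt (invSqrt m * c * invSqrt m)

/-- The damping kernel `γ(t) = gᵀ m^{-1/2} (cos(ωt) / (2ω²)) m^{-1/2} g`. -/
def damping (m c : Matrix ε ε ℝ) (g : Matrix ε σ ℝ) (t : ℝ) : Matrix σ σ ℝ :=
  gᵀ * invSqrt m * cfc (fun w : ℝ => Real.cos (w * t) / (2 * w ^ 2)) (freq m c) * invSqrt m * g

/-- The free reservoir propagator `f(t) = m^{-1/2} (sin(ωt) / ω) m^{-1/2}`. -/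
def freeProp (m c : Matrix ε ε ℝ) (t : ℝ) : Matrix ε ε ℝ :=
  invSqrt m * cfc (fun w : ℝ => Real.sin (w * t) / w) (freq m c) * invSqrt m

/-- `γ̂`. -/
def dampingHat (m c : Matrix ε ε ℝ) (g : Matrix ε σ ℝ) (z : ℝ) : Matrix σ σ ℝ :=
  laplace (damping m c g) z

/-- `f̂`. -/
def freePropHat (m c : Matrix ε ε ℝ) (z : ℝ) : Matrix ε ε ℝ := laplace (freeProp m c) z

/-- The Laplace-domain propagator `Ĝ(z) = (z² M + 2 z γ̂(z) + C)⁻¹`; the damping term is absent at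
`z = 0`, so `Ĝ(0) = C⁻¹`. -/
def propHat (M C : Matrix σ σ ℝ) (m c : Matrix ε ε ℝ) (g : Matrix ε σ ℝ) (z : ℝ) : Matrix σ σ ℝ :=
  (z ^ 2 • M + (2 * z) • dampingHat m c g z + C)⁻¹

end Model

end QBM

end

open QBM

/-! A quadratic Hamiltonian with positive definite matrices `K` (inverse masses) and `V` (springs)
splits into independent oscillators. Writing `K = S Sᵀ` and `V = Tᵀ ω² T` with `T = S⁻¹`, the normal
coordinates `T q` and momenta `Sᵀ p` are canonical, and ladder operators acting on a Gaussian vacuum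
produce orthonormal number states of energy `∑ ħ ω_k (α_k + 1/2)`. They are complete: a function
orthogonal to all of them has vanishing moments against a Gaussian, hence a vanishing Fourier
transform. Boltzmann sums over number states are products of geometric series, and a double-series
argument transfers thermal traces to every other energy eigenbasis.

This gives `⟨q qᵀ⟩ = S diag(ħ coth(βħω/2) / 2ω) Sᵀ`, and similarly for momenta. The partial
fractions of the hyperbolic cotangent turn it into the Matsubara sum of the resolvents `(ν_r² K⁻¹ +
V)⁻¹` (`position_correlation_eq`, `momentum_correlation_eq`).

For system plus reservoir the resolvent is inverted by blocks (`closed_resolvent`). The Laplace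
transforms are explicit, `f̂(z) = (z² m + c)⁻¹` and `2z γ̂(z) = gᵀ (c⁻¹ - f̂(z)) g`, so that the
Schur complement of the reservoir block is exactly `Ĝ(z)⁻¹`. All stated formulas then follow from
`z² f̂ m = 1 - f̂ c` and its variants (`closed_correlation_formulas`).

For the derivatives, Euler's product for the hyperbolic sine makes `log Z` a series of `log det (1 +
ν_r⁻² K V)`, up to a multiple of `log det (K V)` and a constant. Jacobi's formula differentiates it
term by term, and the terms reassemble into traces of the correlation matrices. Single-entry
variations destroy symmetry, but only symmetric parts enter the Hamiltonian, because positions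
commute among themselves and so do momenta. -/

noncomputable section

namespace QBM

/-! ### Symmetry and commutation relations of positions and momenta -/

section L2

variable {ι : Type*} [Fintype ι]

/-- `toL2` as a linear map. -/
def toL2Lin : Wave ι →ₗ[ℂ] Lp ℂ 2 (volume : Measure (EuclideanSpace ℝ ι)) :=
  (SchwartzMap.toLpCLM ℂ ℂ 2 volume).toLinearMap

theorem toL2Lin_apply (ψ : Wave ι) : toL2Lin ψ = toL2 ψ := rfl

theorem inner_toL2 (φ ψ : Wave ι) :
    ⟪toL2 φ, toL2 ψ⟫ = ∫ x, (starRingEnd ℂ) (φ x) * ψ x := by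
  simp [toL2, SchwartzMap.inner_toL2_toL2_eq, mul_comm]

theorem inner_posOp_left (i : ι) (φ ψ : Wave ι) :
    ⟪toL2 (posOp i φ), toL2 ψ⟫ = ⟪toL2 φ, toL2 (posOp i ψ)⟫ := by
  rw [inner_toL2, inner_toL2]
  congr 1
  ext x
  simp only [posOp_apply, map_mul, Complex.conj_ofReal]
  ring

variable [DecidableEq ι]

theorem momOp_apply_fderiv (ħ : ℝ) (i : ι) (ψ : Wave ι) (x : EuclideanSpace ℝ ι) :
    momOp ħ i ψ x = -(Complex.I * ħ) * fderiv ℝ ψ x (EuclideanSpace.single i 1) := by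
  rw [momOp_apply, ψ.differentiableAt.lineDeriv_eq_fderiv]

/-- Integration by parts; its sign is compensated by the conjugate of the factor `-iħ`. -/
theorem inner_momOp_left (ħ : ℝ) (i : ι) (φ ψ : Wave ι) :
    ⟪toL2 (momOp ħ i φ), toL2 ψ⟫ = ⟪toL2 φ, toL2 (momOp ħ i ψ)⟫ := by
  have h := SchwartzMap.integral_bilinear_lineDerivOp_right_eq_neg_left (μ := volume) φ ψ
    ((ContinuousLinearMap.mul ℝ ℂ).comp (Complex.conjCLE : ℂ →L[ℝ] ℂ))
    (EuclideanSpace.single i (1 : ℝ))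
  simp only [ContinuousLinearMap.comp_apply, ContinuousLinearMap.mul_apply',
    ContinuousLinearEquiv.coe_coe, Complex.conjCLE_apply] at h
  rw [inner_toL2, inner_toL2]
  simp only [momOp_apply_fderiv, map_mul, map_neg, Complex.conj_ofReal, Complex.conj_I]
  simp only [SchwartzMap.lineDerivOp_apply_eq_fderiv] at h
  have h1 : ∀ x, -(-Complex.I * (ħ : ℂ)) * (starRingEnd ℂ)
      (fderiv ℝ φ x (EuclideanSpace.single i 1)) * ψ x = (Complex.I * ħ) * ((starRingEnd ℂ)
      (fderiv ℝ φ x (EuclideanSpace.single i 1)) * ψ x) := fun x => by ring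
  have h2 : ∀ x, (starRingEnd ℂ) (φ x) * (-(Complex.I * (ħ : ℂ)) *
      (fderiv ℝ ψ x (EuclideanSpace.single i 1))) = -(Complex.I * ħ) * ((starRingEnd ℂ)
      (φ x) * fderiv ℝ ψ x (EuclideanSpace.single i 1)) := fun x => by ring
  simp only [h1, h2, integral_const_mul, h]
  ring

omit [DecidableEq ι] in
theorem posOp_comm (i j : ι) : posOp i ∘L posOp j = posOp j ∘L posOp i := by
  ext ψ x
  simp only [ContinuousLinearMap.comp_apply, posOp_apply]
  ring

theorem momOp_comm (ħ : ℝ) (i j : ι) :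
    momOp ħ i ∘L momOp ħ j = momOp ħ j ∘L momOp ħ i := by
  ext ψ x
  have hs : IsSymmSndFDerivAt ℝ ψ x :=
    (ψ.smooth 2).contDiffAt.isSymmSndFDerivAt (by simp)
  have hd : ∀ v w : EuclideanSpace ℝ ι, fderiv ℝ (fun y => fderiv ℝ ψ y v) x w =
      fderiv ℝ (fderiv ℝ ψ) x w v := by
    intro v w
    have : DifferentiableAt ℝ (fderiv ℝ ψ) x :=
      ((ψ.smooth 2).fderiv_right (m := 1) (by norm_num)).differentiable (by simp) x
    rw [fderiv_clm_apply this (differentiableAt_const _)]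
    simp
  have key : ∀ k l : ι, (momOp ħ k ∘L momOp ħ l) ψ x = (-(Complex.I * ħ)) * (-(Complex.I * ħ)) *
      fderiv ℝ (fderiv ℝ ψ) x (EuclideanSpace.single k 1) (EuclideanSpace.single l 1) := by
    intro k l
    rw [ContinuousLinearMap.comp_apply, momOp_apply_fderiv]
    have hf : (momOp ħ l ψ : EuclideanSpace ℝ ι → ℂ) = fun y => (-(Complex.I * ħ)) *
        fderiv ℝ ψ y (EuclideanSpace.single l 1) := funext fun y => momOp_apply_fderiv ħ l ψ y
    rw [hf, ← hd, fderiv_const_mul]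
    · simp only [_root_.smul_apply, smul_eq_mul]
      ring
    · have : DifferentiableAt ℝ (fderiv ℝ ψ) x :=
        ((ψ.smooth 2).fderiv_right (m := 1) (by norm_num)).differentiable (by simp) x
      exact this.clm_apply (differentiableAt_const _)
  rw [key, key, hs.eq]

theorem momOp_posOp (ħ : ℝ) (i j : ι) :
    momOp ħ i ∘L posOp j = posOp j ∘L momOp ħ i +
      (if i = j then -(Complex.I * (ħ : ℂ)) else 0) • ContinuousLinearMap.id ℂ (Wave ι) := by
  ext ψ x
  simp only [ContinuousLinearMap.comp_apply, _root_.add_apply,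
    _root_.smul_apply, ContinuousLinearMap.id_apply,
    smul_eq_mul]
  rw [momOp_apply_fderiv, posOp_apply, momOp_apply_fderiv]
  have hf : (posOp j ψ : EuclideanSpace ℝ ι → ℂ) = fun y => ((y j : ℝ) : ℂ) * ψ y :=
    funext fun y => posOp_apply j ψ y
  have hp : HasFDerivAt (fun y : EuclideanSpace ℝ ι => ((y j : ℝ) : ℂ))
      (Complex.ofRealCLM.comp (EuclideanSpace.proj j : EuclideanSpace ℝ ι →L[ℝ] ℝ)) x :=
    (Complex.ofRealCLM.comp (EuclideanSpace.proj j : EuclideanSpace ℝ ι →L[ℝ] ℝ)).hasFDerivAt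
  rw [hf, (hp.fun_mul (ψ.hasFDerivAt x)).fderiv]
  simp only [_root_.add_apply, _root_.smul_apply, smul_eq_mul,
    ContinuousLinearMap.comp_apply, PiLp.proj_apply, PiLp.single_apply,
    Complex.ofRealCLM_apply]
  by_cases h : i = j
  · subst h; simp; ring
  · have : j ≠ i := fun h' => h h'.symm
    simp [h, this]; ring

end L2

/-! ### Abstract Fock space: number states from ladder operators -/

section Fock

variable {κ W H : Type*} [Fintype κ] [DecidableEq κ] [AddCommGroup W] [Module ℂ W]
  [NormedAddCommGroup H] [InnerProductSpace ℂ H]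

/-- Annihilation and creation operators of finitely many modes, with a normalized vacuum, on a
space of vectors mapped to a Hilbert space by `J`. -/
structure Ladder (κ : Type*) [DecidableEq κ] {W H : Type*} [AddCommGroup W] [Module ℂ W]
    [NormedAddCommGroup H] [InnerProductSpace ℂ H] (J : W →ₗ[ℂ] H) where
  ann : κ → W →ₗ[ℂ] W
  cre : κ → W →ₗ[ℂ] W
  vac : W
  inner_ann : ∀ k φ ψ, ⟪J (ann k φ), J ψ⟫ = ⟪J φ, J (cre k ψ)⟫
  ann_cre : ∀ k l φ, ann k (cre l φ) = cre l (ann k φ) + if k = l then φ else 0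
  cre_comm : ∀ k l φ, cre k (cre l φ) = cre l (cre k φ)
  ann_vac : ∀ k, ann k vac = 0
  norm_vac : ‖J vac‖ = 1

namespace Ladder

variable {J : W →ₗ[ℂ] H} (L : Ladder κ J)

omit [Fintype κ] in
theorem cre_commute (k l : κ) : Commute (L.cre k : Module.End ℂ W) (L.cre l) :=
  LinearMap.ext fun φ => L.cre_comm k l φ

theorem pairwise_commute_cre_pow (α : κ → ℕ) :
    ((Finset.univ : Finset κ) : Set κ).Pairwise
      (Function.onFun Commute fun k => (L.cre k : Module.End ℂ W) ^ α k) :=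
  fun k _ l _ _ => (L.cre_commute k l).pow_pow _ _

/-- The product of the powers `(a_k†)^{α_k}`. -/
def crePow (α : κ → ℕ) : Module.End ℂ W :=
  Finset.univ.noncommProd (fun k => (L.cre k : Module.End ℂ W) ^ α k)
    (L.pairwise_commute_cre_pow α)

theorem cre_mul_crePow (α : κ → ℕ) (k : κ) :
    (L.cre k : Module.End ℂ W) * L.crePow α = L.crePow (α + Pi.single k 1) := by
  unfold crePow
  rw [← Finset.mul_noncommProd_erase Finset.univ (Finset.mem_univ k),
    ← Finset.mul_noncommProd_erase Finset.univ (Finset.mem_univ k), ← mul_assoc]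
  congr 1
  · simp [pow_succ']
  · refine Finset.noncommProd_congr rfl (fun l hl => ?_) _
    simp [(Finset.mem_erase.1 hl).1]

/-- The normalized number states. -/
def state (α : κ → ℕ) : W :=
  (((√(∏ k, ((α k).factorial : ℝ)))⁻¹ : ℝ) : ℂ) • L.crePow α L.vac

theorem state_zero : L.state 0 = L.vac := by
  have : L.crePow (0 : κ → ℕ) = 1 := by
    unfold crePow
    exact (Finset.noncommProd_eq_pow_card _ _ _ 1 fun k _ => by simp).trans (one_pow _)
  simp [state, this]

theorem cre_state (α : κ → ℕ) (k : κ) :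
    L.cre k (L.state α) = ((√(α k + 1 : ℝ) : ℝ) : ℂ) • L.state (α + Pi.single k 1) := by
  have h1 : L.cre k (L.crePow α L.vac) = L.crePow (α + Pi.single k 1) L.vac := by
    rw [← L.cre_mul_crePow]; rfl
  have h2 : (∏ l, (((α + Pi.single k 1 : κ → ℕ) l).factorial : ℝ)) =
      (α k + 1) * ∏ l, ((α l).factorial : ℝ) := by
    rw [← Finset.mul_prod_erase Finset.univ _ (Finset.mem_univ k),
      ← Finset.mul_prod_erase Finset.univ _ (Finset.mem_univ k), ← mul_assoc]
    congr 1
    · simp [Nat.factorial_succ]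
    · refine Finset.prod_congr rfl fun l hl => ?_
      simp [(Finset.mem_erase.1 hl).1]
  rw [state, state, map_smul, h1, h2, smul_smul, ← Complex.ofReal_mul,
    Real.sqrt_mul (by positivity)]
  congr 2
  have : √((α k : ℝ) + 1) ≠ 0 := (Real.sqrt_pos.2 (by positivity)).ne'
  field_simp

omit [Fintype κ] in
theorem add_single_sub (α : κ → ℕ) (k : κ) : α + Pi.single k 1 - Pi.single k 1 = α := by
  ext l; simp

omit [Fintype κ] in
theorem sub_single_add {α : κ → ℕ} {k : κ} (h : α k ≠ 0) :
    α - Pi.single k 1 + Pi.single k 1 = α := by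
  ext l
  by_cases hl : l = k
  · subst hl; simp; omega
  · simp [hl]

/-- Induction on occupation numbers. -/
theorem occupation_induction {p : (κ → ℕ) → Prop} (zero : p 0)
    (add : ∀ α k, p α → p (α + Pi.single k 1)) (α : κ → ℕ) : p α := by
  induction hn : ∑ k, α k generalizing α with
  | zero =>
    have : α = 0 := by
      ext k; simpa using (Finset.sum_eq_zero_iff.1 hn) k (Finset.mem_univ k)
    rwa [this]
  | succ n ih =>
    obtain ⟨k, -, hk⟩ : ∃ k ∈ Finset.univ, α k ≠ 0 := by
      by_contra! h
      rw [Finset.sum_eq_zero h] at hn; omega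
    rw [← sub_single_add hk]
    refine add _ _ (ih _ ?_)
    have : ∑ l, α l = ∑ l, (α - Pi.single k 1 : κ → ℕ) l + ∑ l, (Pi.single k 1 : κ → ℕ) l := by
      rw [← Finset.sum_add_distrib]
      exact Finset.sum_congr rfl fun l _ => (congrFun (sub_single_add hk) l).symm
    rw [Finset.sum_pi_single' ] at this
    simp only [Finset.mem_univ, if_true] at this
    omega

/-- A state with one more quantum is, up to a nonzero factor, a creation operator applied to a lower
state, so the commutation relation and the induction hypothesis give the claim. The truncated
subtraction is harmless: when `α k = 0` the coefficient vanishes. -/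
theorem ann_state (α : κ → ℕ) (k : κ) :
    L.ann k (L.state α) = ((√(α k : ℝ) : ℝ) : ℂ) • L.state (α - Pi.single k 1) := by
  induction α using occupation_induction with
  | zero => simp [state_zero, L.ann_vac]
  | add β l ih =>
    have hl : ((√(β l + 1 : ℝ) : ℝ) : ℂ) ≠ 0 := by
      exact_mod_cast (Real.sqrt_pos.2 (by positivity)).ne'
    have h1 : L.ann k (L.cre l (L.state β)) = ((√(β l + 1 : ℝ) : ℝ) : ℂ) •
        ((√((β + Pi.single l 1 : κ → ℕ) k : ℝ) : ℝ) : ℂ) •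
          L.state (β + Pi.single l 1 - Pi.single k 1) := by
      rw [L.ann_cre, ih, map_smul, L.cre_state]
      by_cases hkl : k = l
      · subst hkl
        rw [add_single_sub]
        have hs : ((√(β k + 1 : ℝ) : ℝ) : ℂ) * ((√(β k + 1 : ℝ) : ℝ) : ℂ) = β k + 1 := by
          rw [← Complex.ofReal_mul, Real.mul_self_sqrt (by positivity)]; simp
        simp only [if_true, Pi.add_apply, Pi.single_eq_same, Nat.cast_add, Nat.cast_one,
          smul_smul, hs, add_smul, one_smul]
        by_cases hb : β k = 0
        · simp [hb]
        · rw [sub_single_add hb]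
          congr 2
          have : (((β - Pi.single k 1 : κ → ℕ) k : ℕ) : ℝ) + 1 = β k := by
            have := congrFun (sub_single_add hb) k
            simp only [Pi.add_apply, Pi.single_eq_same] at this
            exact_mod_cast this
          rw [this, ← Complex.ofReal_mul, Real.mul_self_sqrt (by positivity)]; simp
      · by_cases hb : β k = 0
        · simp [hkl, hb]
        · have he : β - Pi.single k 1 + Pi.single l 1 = β + Pi.single l 1 - Pi.single k 1 := by
            ext j
            by_cases hj : j = k
            · subst hj; simp [hkl]
            · simp [hj]
          have hlk : l ≠ k := fun h => hkl h.symm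
          simp [hkl, hlk, he, smul_smul, mul_comm]
    rw [L.cre_state, map_smul] at h1
    exact smul_right_injective W hl h1

/-- Creation and annihilation are adjoint, so a quantum removed on the left is removed on the right
too. The induction ends at the vacuum, which is orthogonal to anything created because it is
annihilated. -/
theorem orthonormal_state : Orthonormal ℂ fun α => J (L.state α) := by
  rw [orthonormal_iff_ite]
  intro α
  induction α using occupation_induction with
  | zero =>
    intro β
    by_cases h : (0 : κ → ℕ) = β
    · subst h
      rw [state_zero, inner_self_eq_norm_sq_to_K, L.norm_vac]; simp
    · obtain ⟨k, hk⟩ : ∃ k, β k ≠ 0 := by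
        by_contra! h'; exact h (funext fun k => (h' k).symm)
      have h1 := L.inner_ann k (L.state 0) (L.state (β - Pi.single k 1))
      rw [state_zero, L.ann_vac, L.cre_state, sub_single_add hk] at h1
      simp only [map_zero, inner_zero_left, map_smul, inner_smul_right] at h1
      have hn : ((√(((β - Pi.single k 1 : κ → ℕ) k : ℕ) + 1 : ℝ) : ℝ) : ℂ) ≠ 0 := by
        exact_mod_cast (Real.sqrt_pos.2 (by positivity)).ne'
      rw [if_neg h, state_zero]
      exact (mul_eq_zero.1 h1.symm).resolve_left hn
  | add γ k ih =>
    intro β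
    have hn : ((√(γ k + 1 : ℝ) : ℝ) : ℂ) ≠ 0 := by
      exact_mod_cast (Real.sqrt_pos.2 (by positivity)).ne'
    have h1 : ⟪J (L.cre k (L.state γ)), J (L.state β)⟫ =
        ⟪J (L.state γ), J (L.ann k (L.state β))⟫ := by
      rw [← inner_conj_symm, ← L.inner_ann, inner_conj_symm]
    rw [L.cre_state, L.ann_state] at h1
    simp only [map_smul, inner_smul_left, inner_smul_right, Complex.conj_ofReal, ih] at h1
    by_cases hb : β k = 0
    · have hne : γ + Pi.single k 1 ≠ β := fun h => by
        have := congrFun h k; simp at this; omega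
      rw [if_neg hne]
      simp only [hb, Nat.cast_zero, Real.sqrt_zero, Complex.ofReal_zero, zero_mul] at h1
      exact (mul_eq_zero.1 h1).resolve_left hn
    · have hiff : γ = β - Pi.single k 1 ↔ γ + Pi.single k 1 = β := by
        constructor
        · rintro rfl; exact sub_single_add hb
        · rintro rfl; exact (add_single_sub _ _).symm
      by_cases he : γ + Pi.single k 1 = β
      · rw [if_pos (hiff.2 he)] at h1
        rw [if_pos he]
        have : β k = γ k + 1 := by rw [← he]; simp
        rw [this] at h1
        push_cast at h1
        exact mul_left_cancel₀ hn h1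
      · rw [if_neg (fun h => he (hiff.1 h)), mul_zero] at h1
        rw [if_neg he]
        exact (mul_eq_zero.1 h1).resolve_left hn

/-- The span of the number states. -/
def stateSpan : Submodule ℂ W := Submodule.span ℂ (Set.range L.state)

theorem state_mem (α : κ → ℕ) : L.state α ∈ L.stateSpan := Submodule.subset_span ⟨α, rfl⟩

theorem vac_mem : L.vac ∈ L.stateSpan := L.state_zero ▸ L.state_mem 0

theorem cre_mem (k : κ) {φ : W} (h : φ ∈ L.stateSpan) : L.cre k φ ∈ L.stateSpan := by
  induction h using Submodule.span_induction with
  | mem x hx =>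
    obtain ⟨α, rfl⟩ := hx
    rw [L.cre_state]
    exact Submodule.smul_mem _ _ (L.state_mem _)
  | zero => simp
  | add x y _ _ hx hy => rw [map_add]; exact Submodule.add_mem _ hx hy
  | smul c x _ hx => rw [map_smul]; exact Submodule.smul_mem _ _ hx

theorem ann_mem (k : κ) {φ : W} (h : φ ∈ L.stateSpan) : L.ann k φ ∈ L.stateSpan := by
  induction h using Submodule.span_induction with
  | mem x hx =>
    obtain ⟨α, rfl⟩ := hx
    rw [L.ann_state]
    exact Submodule.smul_mem _ _ (L.state_mem _)
  | zero => simp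
  | add x y _ _ hx hy => rw [map_add]; exact Submodule.add_mem _ hx hy
  | smul c x _ hx => rw [map_smul]; exact Submodule.smul_mem _ _ hx

theorem cre_ann_state (α : κ → ℕ) (k : κ) :
    L.cre k (L.ann k (L.state α)) = ((α k : ℝ) : ℂ) • L.state α := by
  rw [L.ann_state, map_smul, L.cre_state]
  by_cases h : α k = 0
  · simp [h]
  · rw [sub_single_add h, smul_smul]
    congr 1
    have : (((α - Pi.single k 1 : κ → ℕ) k : ℕ) : ℝ) + 1 = α k := by
      have := congrFun (sub_single_add h) k
      simp only [Pi.add_apply, Pi.single_eq_same] at this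
      exact_mod_cast this
    rw [this, ← Complex.ofReal_mul, Real.mul_self_sqrt (by positivity)]

end Ladder

end Fock

/-! ### The Gaussian as a Schwartz function -/

section Gaussian

/-- The power is bounded by `N! exp (1 + r)`, and `1 + r - r²/2 ≤ 3/2` because `(r - 1)² ≥ 0`. -/
theorem one_add_pow_mul_exp_neg_sq_le (N : ℕ) {r : ℝ} (hr : 0 ≤ r) :
    (1 + r) ^ N * Real.exp (-(r ^ 2 / 2)) ≤ N.factorial * Real.exp (3 / 2) := by
  have h1 : (1 + r) ^ N ≤ N.factorial * Real.exp (1 + r) := by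
    have := Real.pow_div_factorial_le_exp (1 + r) (by positivity) N
    rwa [div_le_iff₀ (by positivity), mul_comm] at this
  calc (1 + r) ^ N * Real.exp (-(r ^ 2 / 2))
      ≤ N.factorial * Real.exp (1 + r) * Real.exp (-(r ^ 2 / 2)) := by gcongr
    _ = N.factorial * Real.exp (1 + r + -(r ^ 2 / 2)) := by
      rw [Real.exp_add (1 + r)]; ring
    _ ≤ _ := by
      gcongr
      nlinarith [sq_nonneg (r - 1)]

variable (E : Type*) [NormedAddCommGroup E] [InnerProductSpace ℝ E]

/-- The Gaussian `exp(-‖x‖² / 2)` as a Schwartz function. -/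
def gaussian : 𝓢(E, ℂ) where
  toFun x := ((Real.exp (-(‖x‖ ^ 2 / 2)) : ℝ) : ℂ)
  smooth' := by
    have h : ContDiff ℝ ⊤ fun x : E => Real.exp (-(‖x‖ ^ 2 / 2)) :=
      ((contDiff_norm_sq ℝ).div_const 2).neg.exp
    exact (Complex.ofRealCLM.contDiff.comp h).of_le le_top
  decay' k n := by
    have hT : Function.HasTemperateGrowth fun x : E => -(‖x‖ ^ 2 / 2) := by
      have h := (Function.HasTemperateGrowth.const (E := E) (-(1 / 2 : ℝ))).mul
        (Function.hasTemperateGrowth_norm_sq (H := E))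
      convert! h using 2
      simp; ring
    obtain ⟨N, C, hC, hb⟩ := hT.norm_iteratedFDeriv_le_uniform n
    refine ⟨n.factorial * (1 + C) ^ n * ((k + N * n).factorial * Real.exp (3 / 2)), fun x => ?_⟩
    have h0 : ‖iteratedFDeriv ℝ n (fun x : E => ((Real.exp (-(‖x‖ ^ 2 / 2)) : ℝ) : ℂ)) x‖ =
        ‖iteratedFDeriv ℝ n (fun x : E => Real.exp (-(‖x‖ ^ 2 / 2))) x‖ :=
      Complex.ofRealLI.norm_iteratedFDeriv_comp_left (f := fun x : E => Real.exp (-(‖x‖ ^ 2 / 2)))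
        (n := ⊤) (((contDiff_norm_sq ℝ).div_const 2).neg.exp.contDiffAt) (by simp)
    have hx : 0 ≤ ‖x‖ := norm_nonneg x
    -- The chain-rule estimate wants the `i`-th derivative of the exponent bounded by `D ^ i`.
    -- Taking `1 + C` instead of `C` makes `D ≥ 1`, so a bound by `D` suffices for `i ≥ 1`.
    have hD : 1 ≤ (1 + C) * (1 + ‖x‖) ^ N :=
      one_le_mul_of_one_le_of_one_le (by linarith) (one_le_pow₀ (by linarith))
    have h1 := norm_iteratedFDeriv_comp_le (𝕜 := ℝ) (g := Real.exp)
      (f := fun x : E => -(‖x‖ ^ 2 / 2)) (n := n) (N := ⊤) Real.contDiff_exp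
      ((contDiff_norm_sq ℝ).div_const 2).neg (by simp) x
      (C := Real.exp (-(‖x‖ ^ 2 / 2))) (D := (1 + C) * (1 + ‖x‖) ^ N)
      (fun i _ => by
        rw [norm_iteratedFDeriv_eq_norm_iteratedDeriv, iteratedDeriv_eq_iterate,
          Real.iter_deriv_exp, Real.norm_eq_abs, abs_of_pos (Real.exp_pos _)])
      (fun i hi hin => by
        refine (hb i hin x).trans ?_
        calc C * (1 + ‖x‖) ^ N ≤ (1 + C) * (1 + ‖x‖) ^ N := by gcongr; linarith
          _ ≤ _ := le_self_pow₀ hD (by omega))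
    rw [h0]
    calc ‖x‖ ^ k * ‖iteratedFDeriv ℝ n (fun x : E => Real.exp (-(‖x‖ ^ 2 / 2))) x‖
        ≤ (1 + ‖x‖) ^ k * (n.factorial * Real.exp (-(‖x‖ ^ 2 / 2)) *
            ((1 + C) * (1 + ‖x‖) ^ N) ^ n) := by
          gcongr
          · linarith
          · exact h1
      _ = n.factorial * (1 + C) ^ n * ((1 + ‖x‖) ^ (k + N * n) * Real.exp (-(‖x‖ ^ 2 / 2))) := by
          rw [mul_pow, pow_add, pow_mul]; ring
      _ ≤ _ := by
          exact mul_le_mul_of_nonneg_left (one_add_pow_mul_exp_neg_sq_le _ hx) (by positivity)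

end Gaussian

/-! ### Normal modes: simultaneous diagonalization of masses and springs -/

section NormalModes

/-- Normal modes of the quadratic Hamiltonian with inverse mass matrix `K` and spring constants
`V`: in the coordinates `y = T q`, `π = Sᵀ p` it is `½ ∑ (π_k² + ω_k² y_k²)`. -/
structure NormalModes (κ : Type*) {ι : Type*} [Fintype ι] [DecidableEq ι] [Fintype κ]
    [DecidableEq κ] (K V : Matrix ι ι ℝ) where
  S : Matrix ι κ ℝ
  T : Matrix κ ι ℝ
  ω : κ → ℝ
  ω_pos : ∀ k, 0 < ω k
  T_mul_S : T * S = 1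
  S_mul_T : S * T = 1
  eq_invMass : K = S * Sᵀ
  eq_spring : V = Tᵀ * diagonal (fun k => ω k ^ 2) * T

variable {κ ι : Type*} [Fintype ι] [DecidableEq ι] [Fintype κ] [DecidableEq κ]
  {K V : Matrix ι ι ℝ}

omit [Fintype κ] [DecidableEq κ] in
theorem exists_orthogonal_diagonalization {A : Matrix ι ι ℝ} (hA : A.PosDef) :
    ∃ (U : Matrix ι ι ℝ) (d : ι → ℝ), (∀ i, 0 < d i) ∧ Uᵀ * U = 1 ∧ U * Uᵀ = 1 ∧
      A = U * diagonal d * Uᵀ := by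
  have h1 := Unitary.coe_star_mul_self hA.1.eigenvectorUnitary
  rw [star_eq_conjTranspose, conjTranspose_eq_transpose_of_trivial] at h1
  refine ⟨hA.1.eigenvectorUnitary, hA.1.eigenvalues, hA.eigenvalues_pos, h1,
    mul_eq_one_comm.1 h1, ?_⟩
  have := hA.1.spectral_theorem
  rwa [Unitary.conjStarAlgAut_apply, star_eq_conjTranspose,
    conjTranspose_eq_transpose_of_trivial] at this

omit [Fintype κ] [DecidableEq κ] in
theorem exists_factorization {A : Matrix ι ι ℝ} (hA : A.PosDef) :
    ∃ B B' : Matrix ι ι ℝ, B' * B = 1 ∧ B * B' = 1 ∧ A = B * Bᵀ := by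
  obtain ⟨U, d, hd, h1, h2, rfl⟩ := exists_orthogonal_diagonalization hA
  have hs : ∀ i, √(d i) ≠ 0 := fun i => (Real.sqrt_pos.2 (hd i)).ne'
  have hB : U * diagonal (fun i => √(d i)) * (diagonal (fun i => (√(d i))⁻¹) * Uᵀ) = 1 := by
    rw [Matrix.mul_assoc, ← Matrix.mul_assoc (diagonal _), diagonal_mul_diagonal]
    simp [hs, h2]
  refine ⟨U * diagonal (fun i => √(d i)), diagonal (fun i => (√(d i))⁻¹) * Uᵀ,
    mul_eq_one_comm.1 hB, hB, ?_⟩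
  rw [transpose_mul, diagonal_transpose, Matrix.mul_assoc U, Matrix.mul_assoc U,
    ← Matrix.mul_assoc (diagonal _) (diagonal _) Uᵀ, diagonal_mul_diagonal]
  simp only [Real.mul_self_sqrt (hd _).le]

/-- With `K = B Bᵀ` and `Bᵀ V B = U d Uᵀ`, take `S = B U`, `T = Uᵀ B⁻¹` and `ω = √d`. The
equivalence `e` merely relabels the modes, so that they can be indexed by `Fin n`. -/
theorem nonempty_normalModes (e : κ ≃ ι) (hK : K.PosDef) (hV : V.PosDef) :
    Nonempty (NormalModes κ K V) := by
  obtain ⟨B, B', h1, h2, hKB⟩ := exists_factorization hK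
  have hinj : Function.Injective B.mulVec := fun x y hxy => by
    have := congrArg (B' *ᵥ ·) hxy
    simpa [h1] using this
  have hW : (Bᵀ * V * B).PosDef := by
    have := hV.conjTranspose_mul_mul_same hinj
    rwa [conjTranspose_eq_transpose_of_trivial] at this
  obtain ⟨U, d, hd, h3, h4, hU⟩ := exists_orthogonal_diagonalization hW
  have hT : B'ᵀ * Bᵀ = 1 := by rw [← transpose_mul, h2, transpose_one]
  refine ⟨⟨(B * U).submatrix id e, (Uᵀ * B').submatrix e id, fun k => √(d (e k)),
    fun k => Real.sqrt_pos.2 (hd _), ?_, ?_, ?_, ?_⟩⟩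
  · rw [submatrix_mul _ _ _ id _ Function.bijective_id |>.symm]
    have : Uᵀ * B' * (B * U) = 1 := by
      rw [Matrix.mul_assoc, ← Matrix.mul_assoc B', h1, Matrix.one_mul, h3]
    rw [this, submatrix_one_equiv]
  · rw [submatrix_mul _ _ _ e _ e.bijective |>.symm]
    have : B * U * (Uᵀ * B') = 1 := by
      rw [Matrix.mul_assoc, ← Matrix.mul_assoc U, h4, Matrix.one_mul, h2]
    rw [this, submatrix_id_id]
  · rw [transpose_submatrix, submatrix_mul _ _ _ e _ e.bijective |>.symm]
    rw [hKB, transpose_mul, Matrix.mul_assoc, ← Matrix.mul_assoc U, h4, Matrix.one_mul,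
      submatrix_id_id]
  · have hD : diagonal (fun k => √(d (e k)) ^ 2) = (diagonal d).submatrix e e := by
      rw [submatrix_diagonal_equiv]
      congr 1
      ext k
      simp [Real.sq_sqrt (hd _).le]
    rw [hD, transpose_submatrix, submatrix_mul _ _ _ e _ e.bijective |>.symm,
      submatrix_mul _ _ _ e _ e.bijective |>.symm, submatrix_id_id, transpose_mul,
      transpose_transpose, Matrix.mul_assoc B'ᵀ, Matrix.mul_assoc B'ᵀ, ← Matrix.mul_assoc _ Uᵀ, ← hU]
    rw [Matrix.mul_assoc (Bᵀ * V), h2, Matrix.mul_one, ← Matrix.mul_assoc, hT, Matrix.one_mul]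

namespace NormalModes

variable (N : NormalModes κ K V) (ħ : ℝ)

/-- The normal coordinates. -/
def coord (k : κ) : Op ι := ∑ i, ((N.T k i : ℝ) : ℂ) • posOp i

/-- The normal momenta. -/
def mom (k : κ) : Op ι := ∑ i, ((N.S i k : ℝ) : ℂ) • momOp ħ i

theorem coord_apply (k : κ) (φ : Wave ι) : N.coord k φ = ∑ i, ((N.T k i : ℝ) : ℂ) • posOp i φ := by
  simp [coord]

theorem mom_apply (k : κ) (φ : Wave ι) :
    N.mom ħ k φ = ∑ i, ((N.S i k : ℝ) : ℂ) • momOp ħ i φ := by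
  simp [mom]

theorem coord_comm (k l : κ) (φ : Wave ι) : N.coord k (N.coord l φ) = N.coord l (N.coord k φ) := by
  simp only [coord_apply, map_sum, map_smul, Finset.smul_sum]
  rw [Finset.sum_comm]
  refine Finset.sum_congr rfl fun i _ => Finset.sum_congr rfl fun j _ => ?_
  rw [smul_comm, ← ContinuousLinearMap.comp_apply, posOp_comm, ContinuousLinearMap.comp_apply]

theorem mom_comm (k l : κ) (φ : Wave ι) : N.mom ħ k (N.mom ħ l φ) = N.mom ħ l (N.mom ħ k φ) := by
  simp only [mom_apply, map_sum, map_smul, Finset.smul_sum]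
  rw [Finset.sum_comm]
  refine Finset.sum_congr rfl fun i _ => Finset.sum_congr rfl fun j _ => ?_
  rw [smul_comm, ← ContinuousLinearMap.comp_apply, momOp_comm, ContinuousLinearMap.comp_apply]

/-- The change of variables is canonical because coordinates transform by `T` and momenta by the
transpose of its inverse. -/
theorem mom_coord (k l : κ) (φ : Wave ι) :
    N.mom ħ k (N.coord l φ) = N.coord l (N.mom ħ k φ) -
      (if k = l then Complex.I * (ħ : ℂ) else 0) • φ := by
  have h : ∀ i j, momOp ħ i (posOp j φ) = posOp j (momOp ħ i φ) +
      (if i = j then -(Complex.I * (ħ : ℂ)) else 0) • φ := fun i j =>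
    DFunLike.congr_fun (momOp_posOp ħ i j) φ
  simp only [coord_apply, mom_apply, map_sum, map_smul, h, smul_add, Finset.sum_add_distrib,
    Finset.smul_sum, smul_smul, sub_eq_add_neg]
  congr 1
  · rw [Finset.sum_comm]
    exact Finset.sum_congr rfl fun i _ => Finset.sum_congr rfl fun j _ => by rw [mul_comm]
  · have h1 : ∑ i, N.T l i * N.S i k = if k = l then 1 else 0 := by
      have := congrFun (congrFun N.T_mul_S l) k
      rw [mul_apply] at this
      rw [this, one_apply]
      simp [eq_comm]
    have h2 : (∑ i, ((N.T l i : ℝ) : ℂ) * ((N.S i k : ℝ) : ℂ)) = if k = l then 1 else 0 := by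
      have := congrArg (fun r : ℝ => (r : ℂ)) h1
      push_cast at this
      rw [this]; split_ifs <;> simp
    have h3 : ∀ j, (∑ i, (((N.T l j : ℝ) : ℂ) * (((N.S i k : ℝ) : ℂ) *
        if i = j then -(Complex.I * (ħ : ℂ)) else 0)) • φ) =
        ((-(Complex.I * ħ)) * (((N.T l j : ℝ) : ℂ) * ((N.S j k : ℝ) : ℂ))) • φ := by
      intro j
      rw [Finset.sum_eq_single j]
      · simp; ring_nf
      · intro i _ hij; simp [hij]
      · simp
    rw [Finset.sum_congr rfl fun j _ => h3 j, ← Finset.sum_smul, ← Finset.mul_sum, h2, ← neg_smul]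
    congr 1
    split_ifs <;> simp

theorem posOp_eq (i : ι) (φ : Wave ι) : posOp i φ = ∑ k, ((N.S i k : ℝ) : ℂ) • N.coord k φ := by
  have h1 : ∀ j, (∑ k, ((N.S i k : ℝ) : ℂ) * ((N.T k j : ℝ) : ℂ)) = if i = j then 1 else 0 := by
    intro j
    have := congrFun (congrFun N.S_mul_T i) j
    rw [mul_apply, one_apply] at this
    have := congrArg (fun r : ℝ => (r : ℂ)) this
    push_cast at this
    rw [this]; split_ifs <;> simp
  simp only [coord_apply, Finset.smul_sum, smul_smul]
  rw [Finset.sum_comm]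
  simp [← Finset.sum_smul, h1]

theorem momOp_eq (i : ι) (φ : Wave ι) :
    momOp ħ i φ = ∑ k, ((N.T k i : ℝ) : ℂ) • N.mom ħ k φ := by
  have h1 : ∀ j, (∑ k, ((N.T k i : ℝ) : ℂ) * ((N.S j k : ℝ) : ℂ)) = if i = j then 1 else 0 := by
    intro j
    have := congrFun (congrFun N.S_mul_T j) i
    rw [mul_apply, one_apply] at this
    have := congrArg (fun r : ℝ => (r : ℂ)) this
    push_cast at this
    rw [Finset.sum_congr rfl fun k _ => mul_comm _ _, this]
    simp only [eq_comm (a := j)]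
    split_ifs <;> simp
  simp only [mom_apply, Finset.smul_sum, smul_smul]
  rw [Finset.sum_comm]
  simp [← Finset.sum_smul, h1]

theorem hamiltonian_eq (φ : Wave ι) : hamiltonian ħ K V φ =
    ∑ k, ((1 / 2 : ℝ) : ℂ) • (N.mom ħ k (N.mom ħ k φ) +
      ((N.ω k ^ 2 : ℝ) : ℂ) • N.coord k (N.coord k φ)) := by
  have hc : ∀ F : ι → ι → κ → Wave ι, ∑ i, ∑ j, ∑ k, F i j k = ∑ k, ∑ j, ∑ i, F i j k := by
    intro F
    rw [Finset.sum_comm, Finset.sum_congr rfl fun i _ => Finset.sum_comm, Finset.sum_comm]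
  have h1 : ∑ i, ∑ j, ((K i j : ℝ) : ℂ) • momOp ħ i (momOp ħ j φ) =
      ∑ k, N.mom ħ k (N.mom ħ k φ) := by
    have hK : ∀ i j, K i j = ∑ k, N.S j k * N.S i k := fun i j => by
      rw [congrFun (congrFun N.eq_invMass i) j, mul_apply]
      exact Finset.sum_congr rfl fun k _ => mul_comm _ _
    simp only [mom_apply, map_sum, map_smul, Finset.smul_sum, smul_smul, hK, Complex.ofReal_sum,
      Finset.sum_smul, Complex.ofReal_mul]
    exact hc _
  have h2 : ∑ i, ∑ j, ((V i j : ℝ) : ℂ) • posOp i (posOp j φ) =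
      ∑ k, ((N.ω k ^ 2 : ℝ) : ℂ) • N.coord k (N.coord k φ) := by
    have hV : ∀ i j, V i j = ∑ k, N.ω k ^ 2 * (N.T k j * N.T k i) := fun i j => by
      rw [congrFun (congrFun N.eq_spring i) j, mul_apply]
      simp only [mul_diagonal, transpose_apply]
      exact Finset.sum_congr rfl fun k _ => by ring
    simp only [coord_apply, map_sum, map_smul, Finset.smul_sum, smul_smul, hV, Complex.ofReal_sum,
      Finset.sum_smul, Complex.ofReal_mul]
    exact hc _
  have h3 : hamiltonian ħ K V φ =
      ((1 / 2 : ℝ) : ℂ) • ∑ i, ∑ j, ((K i j : ℝ) : ℂ) • momOp ħ i (momOp ħ j φ) +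
      ((1 / 2 : ℝ) : ℂ) • ∑ i, ∑ j, ((V i j : ℝ) : ℂ) • posOp i (posOp j φ) := by
    simp only [hamiltonian, _root_.add_apply, _root_.smul_apply, _root_.sum_apply,
      ContinuousLinearMap.comp_apply]
  rw [h3, h1, h2, ← smul_add, ← Finset.sum_add_distrib, Finset.smul_sum]

theorem inner_coord_left (k : κ) (φ ψ : Wave ι) :
    ⟪toL2Lin (N.coord k φ), toL2Lin ψ⟫ = ⟪toL2Lin φ, toL2Lin (N.coord k ψ)⟫ := by
  simp only [coord_apply, map_sum, map_smul, sum_inner, inner_sum, inner_smul_left,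
    inner_smul_right, Complex.conj_ofReal, toL2Lin_apply, inner_posOp_left]

theorem inner_mom_left (k : κ) (φ ψ : Wave ι) :
    ⟪toL2Lin (N.mom ħ k φ), toL2Lin ψ⟫ = ⟪toL2Lin φ, toL2Lin (N.mom ħ k ψ)⟫ := by
  simp only [mom_apply, map_sum, map_smul, sum_inner, inner_sum, inner_smul_left,
    inner_smul_right, Complex.conj_ofReal, toL2Lin_apply, inner_momOp_left]

end NormalModes

end NormalModes

/-! ### Ground state, ladder operators and energy levels of the normal modes -/

namespace NormalModes

variable {κ ι : Type*} [Fintype ι] [DecidableEq ι] [Fintype κ] [DecidableEq κ]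
  {K V : Matrix ι ι ℝ} (N : NormalModes κ K V) {ħ : ℝ} (hħ : 0 < ħ)

/-- The change of coordinates in which the ground state is the standard Gaussian. -/
def scaling : EuclideanSpace ℝ ι ≃L[ℝ] EuclideanSpace ℝ κ :=
  (LinearEquiv.ofLinearMap (toLpLin 2 2 (diagonal (fun k => √(N.ω k / ħ)) * N.T))
    (toLpLin 2 2 (N.S * diagonal (fun k => (√(N.ω k / ħ))⁻¹)))
    (by
      have hs : ∀ k, √(N.ω k / ħ) ≠ 0 := fun k => (Real.sqrt_pos.2 (div_pos (N.ω_pos k) hħ)).ne'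
      rw [← toLpLin_mul, Matrix.mul_assoc, ← Matrix.mul_assoc N.T, N.T_mul_S, Matrix.one_mul,
        diagonal_mul_diagonal]
      simp only [mul_inv_cancel₀ (hs _), diagonal_one, toLpLin_one])
    (by
      have hs : ∀ k, √(N.ω k / ħ) ≠ 0 := fun k => (Real.sqrt_pos.2 (div_pos (N.ω_pos k) hħ)).ne'
      rw [← toLpLin_mul, Matrix.mul_assoc, ← Matrix.mul_assoc (diagonal _), diagonal_mul_diagonal]
      simp only [inv_mul_cancel₀ (hs _), diagonal_one, Matrix.one_mul, N.S_mul_T,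
        toLpLin_one])).toContinuousLinearEquiv

theorem scaling_apply (x : EuclideanSpace ℝ ι) (k : κ) :
    N.scaling hħ x k = √(N.ω k / ħ) * ∑ i, N.T k i * x i := by
  have : N.scaling hħ x = toLpLin 2 2 (diagonal (fun k => √(N.ω k / ħ)) * N.T) x := rfl
  rw [this, toLpLin_apply]
  simp [mulVec, dotProduct, Finset.mul_sum, mul_assoc]

/-- The unnormalized ground state. -/
def groundState : Wave ι :=
  SchwartzMap.compCLMOfContinuousLinearEquiv ℂ (N.scaling hħ) (gaussian (EuclideanSpace ℝ κ))

theorem groundState_apply (x : EuclideanSpace ℝ ι) :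
    N.groundState hħ x = ((Real.exp (-(‖N.scaling hħ x‖ ^ 2 / 2)) : ℝ) : ℂ) := rfl

theorem toL2_groundState_ne_zero : toL2 (N.groundState hħ) ≠ 0 := by
  intro h
  have h0 : N.groundState hħ = 0 :=
    SchwartzMap.injective_toLp (E := EuclideanSpace ℝ ι) (F := ℂ) 2 volume
      (h.trans (map_zero toL2Lin).symm)
  have h1 := N.groundState_apply hħ 0
  rw [h0] at h1
  simp at h1

theorem fderiv_groundState (x v : EuclideanSpace ℝ ι) :
    fderiv ℝ (N.groundState hħ) x v =
      -((inner ℝ (N.scaling hħ x) (N.scaling hħ v) : ℝ) : ℂ) * N.groundState hħ x := by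
  have h1 : HasFDerivAt (fun x => ‖N.scaling hħ x‖ ^ 2)
      (2 • (innerSL ℝ (N.scaling hħ x)).comp (N.scaling hħ : _ →L[ℝ] EuclideanSpace ℝ κ)) x :=
    ((N.scaling hħ).hasFDerivAt).norm_sq
  have h2 := Complex.ofRealCLM.hasFDerivAt.comp x (h1.mul_const (-(1 / 2 : ℝ))).exp
  have h3 : (N.groundState hħ : EuclideanSpace ℝ ι → ℂ) =
      fun x => ((Real.exp (‖N.scaling hħ x‖ ^ 2 * -(1 / 2)) : ℝ) : ℂ) := by
    ext x
    rw [groundState_apply]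
    ring_nf
  rw [h3]
  refine (congrArg (fun A : EuclideanSpace ℝ ι →L[ℝ] ℂ => A v) h2.fderiv).trans ?_
  simp
  ring

/-- This first-order equation characterizes the Gaussian and says that the annihilation operators
kill it. -/
theorem mom_groundState (k : κ) :
    N.mom ħ k (N.groundState hħ) = (Complex.I * (N.ω k : ℂ)) • N.coord k (N.groundState hħ) := by
  ext x
  have hs : √(N.ω k / ħ) * √(N.ω k / ħ) = N.ω k / ħ :=
    Real.mul_self_sqrt (div_pos (N.ω_pos k) hħ).le
  have h1 : N.mom ħ k (N.groundState hħ) x = -(Complex.I * ħ) *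
      fderiv ℝ (N.groundState hħ) x (∑ i, N.S i k • EuclideanSpace.single i (1 : ℝ)) := by
    rw [mom_apply, _root_.sum_apply, map_sum, Finset.mul_sum]
    refine Finset.sum_congr rfl fun i _ => ?_
    rw [_root_.smul_apply, momOp_apply_fderiv, map_smul]
    simp
    ring
  have h2 : N.coord k (N.groundState hħ) x =
      ((∑ i, N.T k i * x i : ℝ) : ℂ) * N.groundState hħ x := by
    rw [coord_apply, _root_.sum_apply, Complex.ofReal_sum, Finset.sum_mul]
    refine Finset.sum_congr rfl fun i _ => ?_
    rw [_root_.smul_apply, posOp_apply]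
    simp
    ring
  -- The normal momentum `k` differentiates along the `k`-th column of `S`, which the scaling maps
  -- to a multiple of the `k`-th unit vector since `T S = 1`.
  have h3 : N.scaling hħ (∑ i, N.S i k • EuclideanSpace.single i (1 : ℝ)) =
      EuclideanSpace.single k (√(N.ω k / ħ)) := by
    ext l
    rw [scaling_apply]
    have : ∀ i, (∑ j, N.S j k • EuclideanSpace.single j (1 : ℝ)) i = N.S i k := by
      intro i; simp [Finset.sum_apply, Pi.single_apply]
    simp only [this]
    have h4 := congrFun (congrFun N.T_mul_S l) k
    rw [mul_apply, one_apply] at h4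
    rw [h4]
    by_cases h : l = k
    · subst h; simp
    · simp [h]
  rw [h1, fderiv_groundState, h3, _root_.smul_apply, h2, EuclideanSpace.inner_single_right,
    scaling_apply]
  have hħ' : (ħ : ℂ) ≠ 0 := by exact_mod_cast hħ.ne'
  have hs' := congrArg (fun r : ℝ => (r : ℂ)) hs
  simp only [Complex.ofReal_mul, Complex.ofReal_div] at hs'
  simp only [conj_trivial, Complex.ofReal_mul, smul_eq_mul]
  rw [eq_div_iff hħ'] at hs'
  linear_combination (Complex.I * ((∑ i, N.T k i * x i : ℝ) : ℂ) * N.groundState hħ x) * hs'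

/-- Annihilation operators of the normal modes. -/
def annOp (ħ : ℝ) (k : κ) : Op ι :=
  ((√(N.ω k / (2 * ħ)) : ℝ) : ℂ) • N.coord k +
    (Complex.I * ((√(2 * ħ * N.ω k))⁻¹ : ℝ)) • N.mom ħ k

/-- Creation operators of the normal modes. -/
def creOp (ħ : ℝ) (k : κ) : Op ι :=
  ((√(N.ω k / (2 * ħ)) : ℝ) : ℂ) • N.coord k -
    (Complex.I * ((√(2 * ħ * N.ω k))⁻¹ : ℝ)) • N.mom ħ k

theorem annOp_apply (k : κ) (φ : Wave ι) : N.annOp ħ k φ =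
    ((√(N.ω k / (2 * ħ)) : ℝ) : ℂ) • N.coord k φ +
    (Complex.I * ((√(2 * ħ * N.ω k))⁻¹ : ℝ)) • N.mom ħ k φ := rfl

theorem creOp_apply (k : κ) (φ : Wave ι) : N.creOp ħ k φ =
    ((√(N.ω k / (2 * ħ)) : ℝ) : ℂ) • N.coord k φ -
    (Complex.I * ((√(2 * ħ * N.ω k))⁻¹ : ℝ)) • N.mom ħ k φ := rfl

include hħ in
theorem coeff_eq (k : κ) : √(N.ω k / (2 * ħ)) = N.ω k * (√(2 * ħ * N.ω k))⁻¹ := by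
  have := N.ω_pos k
  rw [show N.ω k / (2 * ħ) = N.ω k ^ 2 / (2 * ħ * N.ω k) by field_simp, Real.sqrt_div (by positivity),
    Real.sqrt_sq this.le, div_eq_mul_inv]

include hħ in
theorem coeff_mul (k : κ) :
    (N.ω k : ℂ) * (((√(2 * ħ * N.ω k))⁻¹ : ℝ) : ℂ) * (((√(2 * ħ * N.ω k))⁻¹ : ℝ) : ℂ) * (2 * ħ) =
      1 := by
  have := N.ω_pos k
  have h : N.ω k * (√(2 * ħ * N.ω k))⁻¹ * (√(2 * ħ * N.ω k))⁻¹ * (2 * ħ) = 1 := by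
    rw [mul_assoc (N.ω k), ← mul_inv, Real.mul_self_sqrt (by positivity)]
    field_simp
  exact_mod_cast h

/-- The ladder operators of the normal modes. -/
def ladder : Ladder κ (toL2Lin (ι := ι)) where
  ann k := (N.annOp ħ k).toLinearMap
  cre k := (N.creOp ħ k).toLinearMap
  vac := (((‖toL2 (N.groundState hħ)‖)⁻¹ : ℝ) : ℂ) • N.groundState hħ
  inner_ann k φ ψ := by
    simp only [ContinuousLinearMap.coe_coe, annOp_apply, creOp_apply, map_add, map_sub, map_smul,
      inner_add_left, inner_sub_right, inner_smul_left, inner_smul_right, inner_coord_left,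
      inner_mom_left, map_mul, Complex.conj_ofReal, Complex.conj_I]
    ring
  ann_cre k l φ := by
    simp only [ContinuousLinearMap.coe_coe, annOp_apply, creOp_apply, map_add, map_sub, map_smul,
      smul_sub, smul_add, mom_coord, N.coord_comm k l, N.mom_comm ħ k l]
    by_cases h : k = l
    · subst h
      simp only [if_true, N.coeff_eq hħ]
      have h1 := N.coeff_mul hħ k
      push_cast at h1 ⊢
      linear_combination (norm := module) (-Complex.I ^ 2 * h1 - Complex.I_sq) • φ
    · have h' : ¬ l = k := fun h' => h h'.symm
      simp only [h, h', if_false]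
      module
  cre_comm k l φ := by
    simp only [ContinuousLinearMap.coe_coe, creOp_apply, map_sub, map_smul,
      smul_sub, mom_coord, N.coord_comm k l, N.mom_comm ħ k l]
    by_cases h : k = l
    · subst h; rfl
    · have h' : ¬ l = k := fun h' => h h'.symm
      simp only [h, h', if_false]
      module
  ann_vac k := by
    simp only [ContinuousLinearMap.coe_coe, annOp_apply, map_smul, mom_groundState, N.coeff_eq hħ]
    push_cast
    linear_combination (norm := module) ((N.ω k : ℂ) * ((√(2 * ħ * N.ω k) : ℝ) : ℂ)⁻¹ *
      ((‖toL2 (N.groundState hħ)‖ : ℝ) : ℂ)⁻¹ * Complex.I_sq) • N.coord k (N.groundState hħ)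
  norm_vac := by
    have := N.toL2_groundState_ne_zero hħ
    rw [map_smul, norm_smul, toL2Lin_apply, Complex.norm_real, norm_inv, norm_norm,
      inv_mul_cancel₀ (norm_ne_zero_iff.2 this)]

/-- The energy levels. -/
def level (ħ : ℝ) (α : κ → ℕ) : ℝ := ∑ k, ħ * N.ω k * (α k + 1 / 2)

/-- Each mode contributes `ħ ω_k (a_k† a_k + 1/2)`, the half coming from the commutator of
coordinate and momentum. -/
theorem hamiltonian_state (α : κ → ℕ) :
    hamiltonian ħ K V ((N.ladder hħ).state α) =
      ((N.level ħ α : ℝ) : ℂ) • (N.ladder hħ).state α := by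
  have h1 : ∀ k, ((1 / 2 : ℝ) : ℂ) • (N.mom ħ k (N.mom ħ k ((N.ladder hħ).state α)) +
      ((N.ω k ^ 2 : ℝ) : ℂ) • N.coord k (N.coord k ((N.ladder hħ).state α))) =
      (ħ * N.ω k : ℂ) • ((N.ladder hħ).cre k ((N.ladder hħ).ann k ((N.ladder hħ).state α)) +
        (1 / 2 : ℂ) • (N.ladder hħ).state α) := by
    intro k
    have hc : ∀ φ, (N.ladder hħ).cre k φ = N.creOp ħ k φ := fun _ => rfl
    have ha : ∀ φ, (N.ladder hħ).ann k φ = N.annOp ħ k φ := fun _ => rfl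
    generalize (N.ladder hħ).state α = φ
    simp only [hc, ha, annOp_apply, creOp_apply, map_add, map_smul, smul_add, mom_coord,
      N.coeff_eq hħ, if_true]
    have h1 := N.coeff_mul hħ k
    push_cast at h1 ⊢
    linear_combination (norm := module)
      (1 / 2 * Complex.I ^ 2 * h1 + 1 / 2 * Complex.I_sq) • N.mom ħ k (N.mom ħ k φ) +
      (-1 / 2 * (N.ω k : ℂ) ^ 2 * h1) • N.coord k (N.coord k φ) +
      (-ħ * N.ω k * (1 / 2 * Complex.I ^ 2 * h1 + 1 / 2 * Complex.I_sq)) • φ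
  rw [N.hamiltonian_eq, Finset.sum_congr rfl fun k _ => h1 k, level, Complex.ofReal_sum,
    Finset.sum_smul]
  refine Finset.sum_congr rfl fun k _ => ?_
  rw [Ladder.cre_ann_state, ← add_smul, smul_smul]
  push_cast
  rfl

theorem coord_eq (k : κ) (φ : Wave ι) : N.coord k φ =
    ((√(ħ / (2 * N.ω k)) : ℝ) : ℂ) • ((N.ladder hħ).ann k φ + (N.ladder hħ).cre k φ) := by
  have hc : (N.ladder hħ).cre k φ = N.creOp ħ k φ := rfl
  have ha : (N.ladder hħ).ann k φ = N.annOp ħ k φ := rfl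
  have := N.ω_pos k
  have h1 : √(ħ / (2 * N.ω k)) * (2 * √(N.ω k / (2 * ħ))) = 1 := by
    rw [mul_left_comm, ← Real.sqrt_mul (by positivity), show ħ / (2 * N.ω k) * (N.ω k / (2 * ħ)) = (1 / 2) ^ 2 by
      field_simp, Real.sqrt_sq (by norm_num)]
    norm_num
  have h1' := congrArg (fun r : ℝ => (r : ℂ)) h1
  push_cast at h1'
  rw [hc, ha, annOp_apply, creOp_apply]
  linear_combination (norm := module) (-h1') • N.coord k φ

theorem mom_eq (k : κ) (φ : Wave ι) : N.mom ħ k φ =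
    (-Complex.I * ((√(ħ * N.ω k / 2) : ℝ) : ℂ)) •
      ((N.ladder hħ).ann k φ - (N.ladder hħ).cre k φ) := by
  have hc : (N.ladder hħ).cre k φ = N.creOp ħ k φ := rfl
  have ha : (N.ladder hħ).ann k φ = N.annOp ħ k φ := rfl
  have := N.ω_pos k
  have h1 : √(ħ * N.ω k / 2) * (2 * (√(2 * ħ * N.ω k))⁻¹) = 1 := by
    rw [mul_left_comm, ← Real.sqrt_inv, ← Real.sqrt_mul (by positivity),
      show ħ * N.ω k / 2 * (2 * ħ * N.ω k)⁻¹ = (1 / 2) ^ 2 by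
      field_simp, Real.sqrt_sq (by norm_num)]
    norm_num
  have h1' := congrArg (fun r : ℝ => (r : ℂ)) h1
  push_cast at h1'
  rw [hc, ha, annOp_apply, creOp_apply]
  push_cast
  linear_combination (norm := module) (Complex.I ^ 2 * h1' + Complex.I_sq) • N.mom ħ k φ

end NormalModes

/-! ### A function with exponential decay is determined by its moments -/

section Moments

open scoped FourierTransform

variable {E : Type*} [NormedAddCommGroup E] [InnerProductSpace ℝ E] [FiniteDimensional ℝ E]
  [MeasurableSpace E] [BorelSpace E]

/-- Every test function is the Fourier transform of a Schwartz function. Moving the transform onto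
`G` makes its integral against any test function vanish. -/
theorem ae_eq_zero_of_fourier_eq_zero {G : E → ℂ} (hG : Integrable G) (h : ∀ v, 𝓕 G v = 0) :
    ∀ᵐ x, G x = 0 := by
  refine ae_eq_zero_of_integral_contDiff_smul_eq_zero hG.locallyIntegrable fun χ hχ hc => ?_
  have hc' : HasCompactSupport fun x => (χ x : ℂ) := hc.comp_left Complex.ofReal_zero
  have hχ' : ContDiff ℝ (⊤ : ℕ∞) fun x => (χ x : ℂ) := Complex.ofRealCLM.contDiff.comp hχ
  let φ : 𝓢(E, ℂ) := hc'.toSchwartzMap hχ'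
  have h1 := VectorFourier.integral_fourierIntegral_smul_eq_flip (μ := (volume : Measure E))
    (ν := (volume : Measure E)) (L := innerₗ E)
    Real.continuous_fourierChar continuous_inner (𝓕⁻ φ).integrable hG
  have h2 : ∀ ξ, VectorFourier.fourierIntegral Real.fourierChar (volume : Measure E) (innerₗ E)
      (𝓕⁻ φ : 𝓢(E, ℂ)) ξ = χ ξ := by
    intro ξ
    have h3 : 𝓕 (𝓕⁻ φ) = φ := FourierTransform.fourier_fourierInv_eq φ
    have h4 := DFunLike.congr_fun h3 ξ
    rw [SchwartzMap.fourier_coe] at h4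
    exact h4
  have h5 : ∀ x, VectorFourier.fourierIntegral Real.fourierChar (volume : Measure E)
      (innerₗ E).flip G x = 0 := by
    intro x
    rw [flip_innerₗ]
    exact h x
  simp only [h2, h5, smul_zero, integral_zero] at h1
  simpa only [Complex.real_smul, smul_eq_mul] using h1

/-- Exponential integrability allows the power series of the Fourier character to be integrated term
by term, so vanishing moments force a vanishing Fourier transform. -/
theorem ae_eq_zero_of_moments_eq_zero {G : E → ℂ} (hm : AEStronglyMeasurable G)
    (hG : ∀ t : E, Integrable fun x => Real.exp (inner ℝ t x) * ‖G x‖)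
    (h : ∀ (t : E) (n : ℕ), ∫ x, ((inner ℝ t x : ℝ) : ℂ) ^ n * G x = 0) : ∀ᵐ x, G x = 0 := by
  have hG0 : Integrable G := by
    have := hG 0
    simp only [inner_zero_left, Real.exp_zero, one_mul] at this
    exact (integrable_norm_iff hm).1 this
  refine ae_eq_zero_of_fourier_eq_zero hG0 fun v => ?_
  -- With this `t` the Fourier character at `v` is `exp (i ⟨t, x⟩)`.
  obtain ⟨t, ht⟩ : ∃ t : E, t = (-(2 * Real.pi)) • v := ⟨_, rfl⟩
  have hF : ∀ n : ℕ, AEStronglyMeasurable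
      (fun x => (((inner ℝ t x : ℝ) * Complex.I : ℂ) ^ n / n.factorial) * G x) := by
    intro n
    have hc : Continuous fun x : E => (((inner ℝ t x : ℝ) * Complex.I : ℂ) ^ n / n.factorial) := by
      fun_prop
    exact hc.aestronglyMeasurable.mul hm
  have hb : ∀ n : ℕ, ∀ x, ‖(((inner ℝ t x : ℝ) * Complex.I : ℂ) ^ n / n.factorial) * G x‖ ≤
      |inner ℝ t x| ^ n / n.factorial * ‖G x‖ := by
    intro n x
    rw [norm_mul, norm_div, norm_pow, norm_mul, Complex.norm_I, mul_one, Complex.norm_real,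
      Complex.norm_natCast, Real.norm_eq_abs]
  have hs : ∀ x, Summable fun n : ℕ => |inner ℝ t x| ^ n / n.factorial * ‖G x‖ := fun x =>
    (Real.summable_pow_div_factorial _).mul_right _
  -- The dominating sum is `exp |⟨t, x⟩| ‖G x‖`, which is at most the sum of the weighted norms for
  -- `t` and `-t`.
  have hI : Integrable fun x => ∑' n : ℕ, |inner ℝ t x| ^ n / n.factorial * ‖G x‖ := by
    have h1 : ∀ x, ∑' n : ℕ, |inner ℝ t x| ^ n / n.factorial * ‖G x‖ =
        Real.exp |inner ℝ t x| * ‖G x‖ := fun x => by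
      rw [tsum_mul_right, Real.exp_eq_exp_ℝ, NormedSpace.exp_eq_tsum_div]
    simp only [h1]
    have hc : Continuous fun x : E => Real.exp |inner ℝ t x| := by fun_prop
    refine ((hG t).add (hG (-t))).mono' (hc.aestronglyMeasurable.mul hm.norm)
      (Filter.Eventually.of_forall fun x => ?_)
    rw [norm_mul, norm_norm, Real.norm_eq_abs, Real.abs_exp]
    simp only [Pi.add_apply, ← add_mul, inner_neg_left]
    refine mul_le_mul_of_nonneg_right ?_ (norm_nonneg _)
    rcases abs_cases (inner ℝ t x) with h | h
    · rw [h.1]; linarith [Real.exp_pos (-inner ℝ t x)]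
    · rw [h.1]; linarith [Real.exp_pos (inner ℝ t x)]
  have hl : ∀ x, HasSum (fun n : ℕ => (((inner ℝ t x : ℝ) * Complex.I : ℂ) ^ n / n.factorial) * G x)
      (Complex.exp ((inner ℝ t x : ℝ) * Complex.I) * G x) := by
    intro x
    have := NormedSpace.expSeries_div_hasSum_exp ((inner ℝ t x : ℝ) * Complex.I : ℂ)
    rw [← Complex.exp_eq_exp_ℂ] at this
    exact this.mul_right _
  have hsum := hasSum_integral_of_dominated_convergence _ hF
    (fun n => Filter.Eventually.of_forall (hb n)) (Filter.Eventually.of_forall hs) hI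
    (Filter.Eventually.of_forall hl)
  have h0 : ∀ n : ℕ, ∫ x, (((inner ℝ t x : ℝ) * Complex.I : ℂ) ^ n / n.factorial) * G x = 0 := by
    intro n
    have : ∀ x, (((inner ℝ t x : ℝ) * Complex.I : ℂ) ^ n / n.factorial) * G x =
        (Complex.I ^ n / n.factorial) * (((inner ℝ t x : ℝ) : ℂ) ^ n * G x) := fun x => by
      rw [mul_pow]; ring
    simp only [this, integral_const_mul, h, mul_zero]
  simp only [h0] at hsum
  rw [Real.fourier_eq', ← hsum.unique hasSum_zero]
  refine integral_congr_ae (Filter.Eventually.of_forall fun x => ?_)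
  simp only [smul_eq_mul, ht, inner_smul_left, real_inner_comm v x]
  congr 3
  simp

end Moments

/-! ### Completeness of the number states -/

namespace NormalModes

variable {κ ι : Type*} [Fintype ι] [DecidableEq ι] [Fintype κ] [DecidableEq κ]
  {K V : Matrix ι ι ℝ} (N : NormalModes κ K V) {ħ : ℝ} (hħ : 0 < ħ)

theorem posOp_mem_stateSpan (i : ι) {φ : Wave ι} (h : φ ∈ (N.ladder hħ).stateSpan) :
    posOp i φ ∈ (N.ladder hħ).stateSpan := by
  rw [N.posOp_eq]
  refine Submodule.sum_mem _ fun k _ => Submodule.smul_mem _ _ ?_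
  rw [N.coord_eq hħ]
  exact Submodule.smul_mem _ _
    (Submodule.add_mem _ (Ladder.ann_mem _ _ h) (Ladder.cre_mem _ _ h))

theorem groundState_mem_stateSpan : N.groundState hħ ∈ (N.ladder hħ).stateSpan := by
  have h := (N.ladder hħ).vac_mem
  have hv : (N.ladder hħ).vac =
    (((‖toL2 (N.groundState hħ)‖)⁻¹ : ℝ) : ℂ) • N.groundState hħ := rfl
  rw [hv] at h
  refine (Submodule.smul_mem_iff _ ?_).1 h
  have := N.toL2_groundState_ne_zero hħ
  exact_mod_cast inv_ne_zero (norm_ne_zero_iff.2 this)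

theorem exists_moment_mem_stateSpan (t : EuclideanSpace ℝ ι) (n : ℕ) :
    ∃ φ ∈ (N.ladder hħ).stateSpan, ∀ x, φ x = ((inner ℝ t x : ℝ) : ℂ) ^ n * N.groundState hħ x := by
  induction n with
  | zero => exact ⟨_, N.groundState_mem_stateSpan hħ, fun x => by simp⟩
  | succ n ih =>
    obtain ⟨φ, hφ, h⟩ := ih
    refine ⟨∑ i, ((t i : ℝ) : ℂ) • posOp i φ, Submodule.sum_mem _ fun i _ =>
      Submodule.smul_mem _ _ (N.posOp_mem_stateSpan hħ i hφ), fun x => ?_⟩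
    simp only [_root_.sum_apply, _root_.smul_apply, posOp_apply, h, smul_eq_mul]
    have : ((inner ℝ t x : ℝ) : ℂ) = ∑ i, (t i : ℂ) * (x i : ℂ) := by
      simp [PiLp.inner_apply, mul_comm]
    rw [pow_succ', this, Finset.sum_mul, Finset.sum_mul]
    exact Finset.sum_congr rfl fun i _ => by ring

theorem memLp_exp_mul_groundState (t : EuclideanSpace ℝ ι) :
    MemLp (fun x => Real.exp (inner ℝ t x) * Real.exp (-(‖N.scaling hħ x‖ ^ 2 / 2))) 2 volume := by
  have hm : Continuous fun x : EuclideanSpace ℝ ι =>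
      Real.exp (inner ℝ t x) * Real.exp (-(‖N.scaling hħ x‖ ^ 2 / 2)) := by fun_prop
  rw [memLp_two_iff_integrable_sq hm.aestronglyMeasurable]
  obtain ⟨b, hb, hlow⟩ : ∃ b : ℝ, 0 < b ∧ ∀ x, b * ‖x‖ ^ 2 ≤ ‖N.scaling hħ x‖ ^ 2 := by
    set c := ‖((N.scaling hħ).symm : EuclideanSpace ℝ κ →L[ℝ] EuclideanSpace ℝ ι)‖ with hc
    -- Invertibility of the scaling gives the lower bound; `1 + c` is used because the operator norm
    -- `c` is zero when there are no coordinates.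
    refine ⟨((1 + c) ^ 2)⁻¹, by positivity, fun x => ?_⟩
    have h1 : ‖x‖ ≤ (1 + c) * ‖N.scaling hħ x‖ := by
      have := ((N.scaling hħ).symm : EuclideanSpace ℝ κ →L[ℝ] EuclideanSpace ℝ ι).le_opNorm
        (N.scaling hħ x)
      simp only [ContinuousLinearEquiv.coe_coe, ContinuousLinearEquiv.symm_apply_apply] at this
      nlinarith [norm_nonneg (N.scaling hħ x)]
    rw [inv_mul_le_iff₀ (by positivity), ← mul_pow]
    gcongr
  have hI := (GaussianFourier.integrable_cexp_neg_mul_sq_norm_add (V := EuclideanSpace ℝ ι)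
    (b := (b : ℂ)) (by simpa using hb) 2 t).norm
  refine hI.mono' (hm.pow 2).aestronglyMeasurable (Filter.Eventually.of_forall fun x => ?_)
  rw [← Real.exp_add, ← Real.exp_nat_mul, Real.norm_eq_abs, Real.abs_exp, Complex.norm_exp]
  refine Real.exp_le_exp.2 ?_
  have h1 : (-(b : ℂ) * ((‖x‖ : ℝ) : ℂ) ^ 2 + 2 * ((inner ℝ t x : ℝ) : ℂ)).re =
      -b * ‖x‖ ^ 2 + 2 * inner ℝ t x := by
    have : (-(b : ℂ) * ((‖x‖ : ℝ) : ℂ) ^ 2 + 2 * ((inner ℝ t x : ℝ) : ℂ)) =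
      ((-b * ‖x‖ ^ 2 + 2 * inner ℝ t x : ℝ) : ℂ) := by push_cast; ring
    rw [this, Complex.ofReal_re]
  rw [h1]
  push_cast
  linarith [hlow x]

/-- The span of the states contains every polynomial `⟨t, x⟩ ^ n` times the ground state. If `F` is
orthogonal to the span, all moments of ground state times `F` vanish; the product is then zero, and
the ground state has no zeros. -/
theorem topologicalClosure_span_state :
    (Submodule.span ℂ (Set.range fun α => toL2 ((N.ladder hħ).state α))).topologicalClosure = ⊤ := by
  rw [Submodule.topologicalClosure_eq_top_iff, Submodule.eq_bot_iff]
  intro F hF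
  have hF' : ∀ φ ∈ (N.ladder hħ).stateSpan, ⟪toL2 φ, F⟫ = 0 := by
    intro φ hφ
    have h1 : toL2Lin φ ∈ (N.ladder hħ).stateSpan.map toL2Lin := ⟨φ, hφ, rfl⟩
    rw [Ladder.stateSpan, Submodule.map_span, ← Set.range_comp] at h1
    exact Submodule.mem_orthogonal _ _ |>.1 hF _ h1
  have hmoment : ∀ (t : EuclideanSpace ℝ ι) (n : ℕ),
      ∫ x, ((inner ℝ t x : ℝ) : ℂ) ^ n * (N.groundState hħ x * F x) = 0 := by
    intro t n
    obtain ⟨φ, hφ, h⟩ := N.exists_moment_mem_stateSpan hħ t n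
    rw [← hF' φ hφ, L2.inner_def]
    refine integral_congr_ae ?_
    filter_upwards [φ.coeFn_toLp 2 volume] with x hx
    have : (toL2 φ : EuclideanSpace ℝ ι → ℂ) x = φ x := hx
    rw [this, h, RCLike.inner_apply, groundState_apply, map_mul, map_pow, Complex.conj_ofReal,
      Complex.conj_ofReal]
    ring
  have hae := ae_eq_zero_of_moments_eq_zero
    ((N.groundState hħ).continuous.aestronglyMeasurable.mul (Lp.aestronglyMeasurable F))
    (fun t => by
      have h1 := (N.memLp_exp_mul_groundState hħ t).integrable_mul (Lp.memLp F).norm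
      refine h1.congr (Filter.Eventually.of_forall fun x => ?_)
      simp only [Pi.mul_apply, norm_mul, groundState_apply, Complex.norm_real, Real.norm_eq_abs,
        Real.abs_exp]
      ring) hmoment
  rw [Lp.eq_zero_iff_ae_eq_zero]
  filter_upwards [hae] with x hx
  rw [Pi.mul_apply, groundState_apply] at hx
  exact (mul_eq_zero.1 hx).resolve_left (by exact_mod_cast (Real.exp_pos _).ne')

end NormalModes

/-! ### Products of series and the Boltzmann sums of one oscillator -/

section ProductSums

/-- Nonnegativity makes the product of two sums a sum over pairs; induction splits off the first
mode. This is the reason for indexing modes by `Fin n` in the thermal sums. -/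
theorem hasSum_pi_prod {n : ℕ} {f : Fin n → ℕ → ℝ} {s : Fin n → ℝ} (h0 : ∀ k m, 0 ≤ f k m)
    (h : ∀ k, HasSum (f k) (s k)) :
    HasSum (fun α : Fin n → ℕ => ∏ k, f k (α k)) (∏ k, s k) := by
  induction n with
  | zero => simp
  | succ n ih =>
    have h1 : HasSum (fun α : Fin n → ℕ => ∏ k, f (Fin.succ k) (α k)) (∏ k, s (Fin.succ k)) :=
      ih (f := fun k => f (Fin.succ k)) (s := fun k => s (Fin.succ k)) (fun k => h0 k.succ)
        fun k => h k.succ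
    obtain ⟨G, hG⟩ : ∃ G : (Fin n → ℕ) → ℝ, G = fun α => ∏ k, f (Fin.succ k) (α k) := ⟨_, rfl⟩
    rw [← hG] at h1
    have hG0 : 0 ≤ G := by
      rw [hG]
      intro α
      exact Finset.prod_nonneg fun k _ => h0 (Fin.succ k) (α k)
    have hf0 : 0 ≤ f 0 := h0 0
    have h2 := (h 0).mul h1 ((h 0).summable.mul_of_nonneg h1.summable hf0 hG0)
    rw [← (Fin.consEquiv fun _ : Fin (n + 1) => ℕ).hasSum_iff, Fin.prod_univ_succ]
    refine h2.congr_fun fun p => ?_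
    simp [Fin.prod_univ_succ, Fin.consEquiv, hG]

theorem hasSum_boltzmann {x : ℝ} (hx : 0 < x) :
    HasSum (fun n : ℕ => Real.exp (-(x * (n + 1 / 2)))) (2 * Real.sinh (x / 2))⁻¹ := by
  have hr : Real.exp (-x) < 1 := by simpa using hx
  have h := (hasSum_geometric_of_lt_one (Real.exp_pos (-x)).le hr).mul_left (Real.exp (-(x / 2)))
  have hf : ∀ n : ℕ, Real.exp (-(x / 2)) * Real.exp (-x) ^ n = Real.exp (-(x * (n + 1 / 2))) := by
    intro n
    rw [← Real.exp_nat_mul, ← Real.exp_add]; ring_nf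
  simp only [hf] at h
  convert! h using 1
  have h1 : Real.exp (-x) = Real.exp (-(x / 2)) * Real.exp (-(x / 2)) := by
    rw [← Real.exp_add]; ring_nf
  have h2 : Real.exp (x / 2) * Real.exp (-(x / 2)) = 1 := by rw [← Real.exp_add]; simp
  have h3 : 1 - Real.exp (-x) ≠ 0 := by linarith
  rw [← div_eq_mul_inv, eq_div_iff h3, Real.sinh_eq, h1]
  have h4 : 1 - Real.exp (-(x / 2)) * Real.exp (-(x / 2)) =
      Real.exp (-(x / 2)) * (Real.exp (x / 2) - Real.exp (-(x / 2))) := by linear_combination -h2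
  rw [h1, h4] at h3
  have h5 := right_ne_zero_of_mul h3
  rw [h4]
  field_simp

theorem hasSum_occupation_boltzmann {x : ℝ} (hx : 0 < x) :
    HasSum (fun n : ℕ => (n + 1 / 2 : ℝ) * Real.exp (-(x * (n + 1 / 2))))
      ((2 * Real.sinh (x / 2))⁻¹ * (Real.cosh (x / 2) / Real.sinh (x / 2) / 2)) := by
  have hr : Real.exp (-x) < 1 := by simpa using hx
  have hn : ‖Real.exp (-x)‖ < 1 := by rwa [Real.norm_eq_abs, Real.abs_exp]
  have h := ((hasSum_coe_mul_geometric_of_norm_lt_one hn).add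
    ((hasSum_geometric_of_lt_one (Real.exp_pos (-x)).le hr).mul_left (1 / 2))).mul_left
      (Real.exp (-(x / 2)))
  have hf : ∀ n : ℕ, Real.exp (-(x / 2)) * (n * Real.exp (-x) ^ n + 1 / 2 * Real.exp (-x) ^ n) =
      (n + 1 / 2 : ℝ) * Real.exp (-(x * (n + 1 / 2))) := by
    intro n
    have : Real.exp (-(x * (n + 1 / 2))) = Real.exp (-(x / 2)) * Real.exp (-x) ^ n := by
      rw [← Real.exp_nat_mul, ← Real.exp_add]; ring_nf
    rw [this]; ring
  simp only [hf] at h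
  convert! h using 1
  have h1 : Real.exp (-x) = Real.exp (-(x / 2)) * Real.exp (-(x / 2)) := by
    rw [← Real.exp_add]; ring_nf
  have h2 : Real.exp (x / 2) * Real.exp (-(x / 2)) = 1 := by rw [← Real.exp_add]; simp
  have h3 : 1 - Real.exp (-x) ≠ 0 := by linarith
  have h4 : 1 - Real.exp (-(x / 2)) * Real.exp (-(x / 2)) =
      Real.exp (-(x / 2)) * (Real.exp (x / 2) - Real.exp (-(x / 2))) := by linear_combination -h2
  rw [h1, h4] at h3
  have h5 := right_ne_zero_of_mul h3
  rw [Real.sinh_eq, Real.cosh_eq, h1, h4]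
  have h6 := (Real.exp_pos (-(x / 2))).ne'
  field_simp
  ring

theorem summable_sq_mul_boltzmann {x : ℝ} (hx : 0 < x) :
    Summable fun n : ℕ => (n + 2 : ℝ) ^ 2 * Real.exp (-(x * (n + 1 / 2))) := by
  have hr : ‖Real.exp (-x)‖ < 1 := by rw [Real.norm_eq_abs, Real.abs_exp]; simpa using hx
  have h := (((summable_pow_mul_geometric_of_norm_lt_one 2 hr).add
    ((summable_pow_mul_geometric_of_norm_lt_one 1 hr).mul_left 4)).add
    ((summable_pow_mul_geometric_of_norm_lt_one 0 hr).mul_left 4)).mul_left (Real.exp (-(x / 2)))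
  refine h.congr fun n => ?_
  have : Real.exp (-(x * (n + 1 / 2))) = Real.exp (-(x / 2)) * Real.exp (-x) ^ n := by
    rw [← Real.exp_nat_mul, ← Real.exp_add]; ring_nf
  rw [this]; ring

end ProductSums

/-! ### Partition function and occupation numbers of the normal modes -/

namespace NormalModes

variable {ι : Type*} [Fintype ι] [DecidableEq ι] {n : ℕ}
  {K V : Matrix ι ι ℝ} (N : NormalModes (Fin n) K V) {ħ β : ℝ} (hħ : 0 < ħ) (hβ : 0 < β)

/-- The partition function of the normal modes. -/
def modeZ (ħ β : ℝ) : ℝ := ∏ k, (2 * Real.sinh (β * ħ * N.ω k / 2))⁻¹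

/-- `coth (βħω_k / 2)`. -/
def modeCoth (ħ β : ℝ) (k : Fin n) : ℝ :=
  Real.cosh (β * ħ * N.ω k / 2) / Real.sinh (β * ħ * N.ω k / 2)

theorem exp_level (α : Fin n → ℕ) :
    Real.exp (-β * N.level ħ α) = ∏ k, Real.exp (-(β * ħ * N.ω k * (α k + 1 / 2))) := by
  rw [level, ← Real.exp_sum, Finset.mul_sum]
  congr 1
  exact Finset.sum_congr rfl fun k _ => by ring

include hħ hβ in
theorem modeZ_pos : 0 < N.modeZ ħ β :=
  Finset.prod_pos fun k _ => inv_pos.2 (mul_pos two_pos (Real.sinh_pos_iff.2 (by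
    have := N.ω_pos k; positivity)))

include hħ hβ in
theorem hasSum_exp_level : HasSum (fun α => Real.exp (-β * N.level ħ α)) (N.modeZ ħ β) := by
  have hs : ∀ k, HasSum (fun m : ℕ => Real.exp (-(β * ħ * N.ω k * (m + 1 / 2))))
      (2 * Real.sinh (β * ħ * N.ω k / 2))⁻¹ := fun k =>
    hasSum_boltzmann (mul_pos (mul_pos hβ hħ) (N.ω_pos k))
  have h := hasSum_pi_prod (fun k m => (Real.exp_pos (-(β * ħ * N.ω k * (m + 1 / 2)))).le) hs
  exact h.congr_fun fun α => N.exp_level α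

include hħ hβ in
theorem hasSum_occupation (k : Fin n) :
    HasSum (fun α : Fin n → ℕ => (α k + 1 / 2 : ℝ) * Real.exp (-β * N.level ħ α))
      (N.modeZ ħ β * (N.modeCoth ħ β k / 2)) := by
  have hx : ∀ l, 0 < β * ħ * N.ω l := fun l => mul_pos (mul_pos hβ hħ) (N.ω_pos l)
  -- The occupation factor is attached to mode `k` alone, which keeps the summand a product over
  -- modes.
  have hp : ∀ l (m : ℕ), 0 ≤ (if l = k then (m + 1 / 2 : ℝ) else 1) *
      Real.exp (-(β * ħ * N.ω l * (m + 1 / 2))) := fun l m => by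
    refine mul_nonneg ?_ (Real.exp_pos _).le
    split_ifs
    · positivity
    · exact zero_le_one
  have hs : ∀ l, HasSum (fun m : ℕ => (if l = k then (m + 1 / 2 : ℝ) else 1) *
      Real.exp (-(β * ħ * N.ω l * (m + 1 / 2)))) ((2 * Real.sinh (β * ħ * N.ω l / 2))⁻¹ *
      (if l = k then N.modeCoth ħ β k / 2 else 1)) := by
    intro l
    by_cases hl : l = k
    · subst hl
      simpa only [if_true, modeCoth] using hasSum_occupation_boltzmann (hx l)
    · simpa only [hl, if_false, one_mul, mul_one] using hasSum_boltzmann (hx l)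
  have h := hasSum_pi_prod hp hs
  have h1 : ∀ α : Fin n → ℕ, ∏ l, (if l = k then (α l + 1 / 2 : ℝ) else 1) = α k + 1 / 2 :=
    fun α => by rw [Finset.prod_ite_eq' _ k fun l => (α l + 1 / 2 : ℝ)]; simp
  have h2 : ∏ l, (if l = k then N.modeCoth ħ β k / 2 else 1) = N.modeCoth ħ β k / 2 := by simp
  rw [Finset.prod_mul_distrib, h2] at h
  refine h.congr_fun fun α => ?_
  rw [exp_level, Finset.prod_mul_distrib, h1]

-- Quadratic expressions in ladder operators change the norm of a number state by at most a multiple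
-- of `∏ (α_k + 2)`; this is the summability that their thermal traces require.
include hħ hβ in
theorem summable_growth :
    Summable fun α : Fin n → ℕ => Real.exp (-β * N.level ħ α) * (∏ k, (α k + 2 : ℝ)) ^ 2 := by
  have hs : ∀ l, HasSum (fun m : ℕ => (m + 2 : ℝ) ^ 2 * Real.exp (-(β * ħ * N.ω l * (m + 1 / 2))))
      (∑' m : ℕ, (m + 2 : ℝ) ^ 2 * Real.exp (-(β * ħ * N.ω l * (m + 1 / 2)))) := fun l =>
    (summable_sq_mul_boltzmann (mul_pos (mul_pos hβ hħ) (N.ω_pos l))).hasSum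
  have hp : ∀ l (m : ℕ), 0 ≤ (m + 2 : ℝ) ^ 2 * Real.exp (-(β * ħ * N.ω l * (m + 1 / 2))) :=
    fun l m => by positivity
  refine (hasSum_pi_prod hp hs).summable.congr fun α => ?_
  rw [exp_level, Finset.prod_mul_distrib, Finset.prod_pow, mul_comm]

/-- The sum `∑ e^{-βE_α} ⟨h_α, a_α⟩ = T`, where the norms of the `a_α` grow slowly. -/
def HasStateTrace (β : ℝ) (a : (Fin n → ℕ) → Wave ι) (T : ℂ) : Prop :=
  Summable (fun α => Real.exp (-β * N.level ħ α) * ‖toL2 (a α)‖ ^ 2) ∧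
  HasSum (fun α => ((Real.exp (-β * N.level ħ α) : ℝ) : ℂ) *
    ⟪toL2 ((N.ladder hħ).state α), toL2 (a α)⟫) T

variable {N hħ}

theorem HasStateTrace.add {a b : (Fin n → ℕ) → Wave ι} {S T : ℂ}
    (ha : N.HasStateTrace hħ β a S) (hb : N.HasStateTrace hħ β b T) :
    N.HasStateTrace hħ β (fun α => a α + b α) (S + T) := by
  refine ⟨Summable.of_nonneg_of_le (fun α => by positivity) (fun α => ?_)
    ((ha.1.add hb.1).mul_left 2), ?_⟩
  · rw [← mul_add, ← mul_assoc, mul_comm 2, mul_assoc]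
    refine mul_le_mul_of_nonneg_left ?_ (Real.exp_pos _).le
    have h1 : ‖toL2 (a α + b α)‖ ≤ ‖toL2 (a α)‖ + ‖toL2 (b α)‖ := by
      have : toL2 (a α + b α) = toL2 (a α) + toL2 (b α) := map_add toL2Lin _ _
      rw [this]; exact norm_add_le _ _
    have h2 := norm_nonneg (toL2 (a α + b α))
    nlinarith [sq_nonneg (‖toL2 (a α)‖ - ‖toL2 (b α)‖)]
  · refine (ha.2.add hb.2).congr_fun fun α => ?_
    have : toL2 (a α + b α) = toL2 (a α) + toL2 (b α) := map_add toL2Lin _ _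
    rw [this, inner_add_right, mul_add]

end NormalModes

/-! ### Thermal traces of quadratic expressions in ladder operators -/

namespace NormalModes

variable {ι : Type*} [Fintype ι] [DecidableEq ι] {n : ℕ}
  {K V : Matrix ι ι ℝ} {N : NormalModes (Fin n) K V} {ħ β : ℝ} {hħ : 0 < ħ}

theorem HasStateTrace.smul {a : (Fin n → ℕ) → Wave ι} {T : ℂ}
    (ha : N.HasStateTrace hħ β a T) (c : ℂ) :
    N.HasStateTrace hħ β (fun α => c • a α) (c * T) := by
  have h : ∀ α, toL2 (c • a α) = c • toL2 (a α) := fun α => map_smul toL2Lin _ _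
  refine ⟨(ha.1.mul_left (‖c‖ ^ 2)).congr fun α => ?_, (ha.2.mul_left c).congr_fun fun α => ?_⟩
  · rw [h, norm_smul]; ring
  · rw [h, inner_smul_right]; ring

theorem HasStateTrace.zero : N.HasStateTrace hħ β (fun _ => 0) 0 := by
  have h : toL2 (0 : Wave ι) = 0 := map_zero toL2Lin
  refine ⟨by simp [h, summable_zero], by simp [h, hasSum_zero]⟩

theorem HasStateTrace.sum {s : Type*} (t : Finset s) {a : s → (Fin n → ℕ) → Wave ι} {T : s → ℂ}
    (ha : ∀ i, N.HasStateTrace hħ β (a i) (T i)) :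
    N.HasStateTrace hħ β (fun α => ∑ i ∈ t, a i α) (∑ i ∈ t, T i) := by
  classical
  induction t using Finset.induction_on with
  | empty => simpa using HasStateTrace.zero
  | insert i t hi ih =>
    simp only [Finset.sum_insert hi]
    exact (ha i).add ih

theorem add_two_le_prod (α : Fin n → ℕ) (k : Fin n) : (α k + 2 : ℝ) ≤ ∏ l, (α l + 2 : ℝ) := by
  have h : α k + 2 ≤ ∏ l, (α l + 2) :=
    Nat.le_of_dvd (Finset.prod_pos fun _ _ => by omega)
      (Finset.dvd_prod_of_mem (fun l => α l + 2) (Finset.mem_univ k))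
  exact_mod_cast h

/-- A product of two ladder operators sends each number state to a multiple of one number state. By
orthonormality, only the occupations fixed by the shift `s` contribute to the trace. -/
theorem hasStateTrace_of_eq_smul_state (hβ : 0 < β) {a : (Fin n → ℕ) → Wave ι}
    {c : (Fin n → ℕ) → ℝ} {s : (Fin n → ℕ) → Fin n → ℕ} {T : ℝ}
    (ha : ∀ α, a α = ((c α : ℝ) : ℂ) • (N.ladder hħ).state (s α))
    (hc : ∀ α, c α ^ 2 ≤ (∏ k, (α k + 2 : ℝ)) ^ 2)
    (hT : HasSum (fun α => Real.exp (-β * N.level ħ α) * if α = s α then c α else 0) T) :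
    N.HasStateTrace hħ β a T := by
  have hst : ∀ α, toL2 (a α) = ((c α : ℝ) : ℂ) • toL2 ((N.ladder hħ).state (s α)) := fun α => by
    rw [ha]; exact map_smul toL2Lin _ _
  have ho := (N.ladder hħ).orthonormal_state
  refine ⟨Summable.of_nonneg_of_le (fun α => by positivity) (fun α => ?_)
    (N.summable_growth hħ hβ), ?_⟩
  · rw [hst, norm_smul, Complex.norm_real, Real.norm_eq_abs, mul_pow, sq_abs]
    have h1 : ‖toL2 ((N.ladder hħ).state (s α))‖ = 1 := ho.1 (s α)
    rw [h1, one_pow, mul_one]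
    exact mul_le_mul_of_nonneg_left (hc α) (Real.exp_pos _).le
  · refine (Complex.hasSum_ofReal.2 hT).congr_fun fun α => ?_
    have h1 := (orthonormal_iff_ite.1 ho) α (s α)
    simp only [toL2Lin_apply] at h1
    rw [hst, inner_smul_right, h1]
    split_ifs <;> simp

theorem hasSum_zero_of {f : (Fin n → ℕ) → ℝ} (h : ∀ α, f α = 0) : HasSum f 0 :=
  (hasSum_zero (α := ℝ)).congr_fun h

theorem sq_sqrt_mul_sqrt {a b q : ℝ} (ha : 0 ≤ a) (hb : 0 ≤ b) (haq : a ≤ q) (hbq : b ≤ q) :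
    (√a * √b) ^ 2 ≤ q ^ 2 := by
  rw [mul_pow, Real.sq_sqrt ha, Real.sq_sqrt hb, sq]
  exact mul_le_mul haq hbq hb (ha.trans haq)

theorem hasStateTrace_ann_ann (hβ : 0 < β) (k l : Fin n) :
    N.HasStateTrace hħ β
      (fun α => (N.ladder hħ).ann k ((N.ladder hħ).ann l ((N.ladder hħ).state α))) 0 := by
  have h := hasStateTrace_of_eq_smul_state (N := N) (hħ := hħ) hβ (T := 0)
    (a := fun α => (N.ladder hħ).ann k ((N.ladder hħ).ann l ((N.ladder hħ).state α)))
    (c := fun α => √(α l : ℝ) * √((α - Pi.single l 1 : Fin n → ℕ) k : ℝ))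
    (s := fun α => α - Pi.single l 1 - Pi.single k 1)
    (fun α => by
      rw [Ladder.ann_state, map_smul, Ladder.ann_state, smul_smul, Complex.ofReal_mul])
    (fun α => by
      refine sq_sqrt_mul_sqrt (by positivity) (by positivity) ?_ ?_
      · exact le_trans (by linarith) (add_two_le_prod α l)
      · refine le_trans ?_ (add_two_le_prod α k)
        have : (α - Pi.single l 1 : Fin n → ℕ) k ≤ α k := Nat.sub_le _ _
        have : (((α - Pi.single l 1 : Fin n → ℕ) k : ℕ) : ℝ) ≤ α k := by exact_mod_cast this
        linarith)
    -- Truncated subtraction can leave `α` fixed, but only if `α l = 0`, where the coefficient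
    -- vanishes.
    (hasSum_zero_of fun α => by
      split_ifs with h
      · have h1 := congrFun h l
        have : α l = 0 := by
          simp only [Pi.sub_apply, Pi.single_eq_same] at h1
          omega
        simp [this]
      · simp)
  simpa using h

theorem hasStateTrace_cre_cre (hβ : 0 < β) (k l : Fin n) :
    N.HasStateTrace hħ β
      (fun α => (N.ladder hħ).cre k ((N.ladder hħ).cre l ((N.ladder hħ).state α))) 0 := by
  have h := hasStateTrace_of_eq_smul_state (N := N) (hħ := hħ) hβ (T := 0)
    (a := fun α => (N.ladder hħ).cre k ((N.ladder hħ).cre l ((N.ladder hħ).state α)))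
    (c := fun α => √(α l + 1 : ℝ) * √((α + Pi.single l 1 : Fin n → ℕ) k + 1 : ℝ))
    (s := fun α => α + Pi.single l 1 + Pi.single k 1)
    (fun α => by
      rw [Ladder.cre_state, map_smul, Ladder.cre_state, smul_smul, Complex.ofReal_mul])
    (fun α => by
      refine sq_sqrt_mul_sqrt (by positivity) (by positivity) ?_ ?_
      · exact le_trans (by linarith) (add_two_le_prod α l)
      · refine le_trans ?_ (add_two_le_prod α k)
        have : (α + Pi.single l 1 : Fin n → ℕ) k ≤ α k + 1 := by
          rw [Pi.add_apply, Pi.single_apply]; split_ifs <;> omega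
        have : (((α + Pi.single l 1 : Fin n → ℕ) k : ℕ) : ℝ) ≤ α k + 1 := by exact_mod_cast this
        linarith)
    (hasSum_zero_of fun α => by
      split_ifs with h
      · have h1 := congrFun h l
        simp only [Pi.add_apply, Pi.single_eq_same] at h1
        omega
      · simp)
  simpa using h

theorem hasStateTrace_cre_ann (hβ : 0 < β) (k l : Fin n) :
    N.HasStateTrace hħ β
      (fun α => (N.ladder hħ).cre k ((N.ladder hħ).ann l ((N.ladder hħ).state α)))
      ((if k = l then N.modeZ ħ β * (N.modeCoth ħ β k / 2) - N.modeZ ħ β / 2 else 0 : ℝ) : ℂ) := by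
  by_cases hkl : k = l
  · subst hkl
    refine hasStateTrace_of_eq_smul_state hβ (c := fun α => (α k : ℝ)) (s := fun α => α)
      (fun α => (N.ladder hħ).cre_ann_state α k) (fun α => ?_) ?_
    · have := add_two_le_prod α k
      have h0 : (0 : ℝ) ≤ α k := by positivity
      exact pow_le_pow_left₀ h0 (by linarith) 2
    -- The occupation is `(α k + 1/2) - 1/2`, so its trace is the symmetric one minus half the
    -- partition function.
    · simp only [if_true]
      refine ((N.hasSum_occupation hħ hβ k).sub
        ((N.hasSum_exp_level hħ hβ).div_const 2)).congr_fun fun α => ?_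
      ring
  · rw [if_neg hkl]
    refine hasStateTrace_of_eq_smul_state hβ
      (c := fun α => √(α l : ℝ) * √((α - Pi.single l 1 : Fin n → ℕ) k + 1 : ℝ))
      (s := fun α => α - Pi.single l 1 + Pi.single k 1)
      (fun α => by
        rw [Ladder.ann_state, map_smul, Ladder.cre_state, smul_smul, Complex.ofReal_mul])
      (fun α => by
        refine sq_sqrt_mul_sqrt (by positivity) (by positivity) ?_ ?_
        · exact le_trans (by linarith) (add_two_le_prod α l)
        · refine le_trans ?_ (add_two_le_prod α k)
          have : (α - Pi.single l 1 : Fin n → ℕ) k ≤ α k := Nat.sub_le _ _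
          have : (((α - Pi.single l 1 : Fin n → ℕ) k : ℕ) : ℝ) ≤ α k := by exact_mod_cast this
          linarith)
      (hasSum_zero_of fun α => by
        split_ifs with h
        · have h1 := congrFun h k
          simp [hkl] at h1
        · simp)

theorem hasStateTrace_ann_cre (hβ : 0 < β) (k l : Fin n) :
    N.HasStateTrace hħ β
      (fun α => (N.ladder hħ).ann k ((N.ladder hħ).cre l ((N.ladder hħ).state α)))
      ((if k = l then N.modeZ ħ β * (N.modeCoth ħ β k / 2) + N.modeZ ħ β / 2 else 0 : ℝ) : ℂ) := by
  have h1 : N.HasStateTrace hħ β (fun α => (N.ladder hħ).state α) ((N.modeZ ħ β : ℝ) : ℂ) := by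
    refine hasStateTrace_of_eq_smul_state hβ (c := fun α => 1) (s := fun α => α)
      (fun α => by simp) (fun α => ?_) (by simpa using N.hasSum_exp_level hħ hβ)
    have : (1 : ℝ) ≤ ∏ k, (α k + 2 : ℝ) := by
      have : 1 ≤ ∏ l, (α l + 2) := Nat.one_le_iff_ne_zero.2
        (Finset.prod_ne_zero_iff.2 fun _ _ => by omega)
      exact_mod_cast this
    exact pow_le_pow_left₀ zero_le_one this 2
  have h2 := (hasStateTrace_cre_ann (N := N) (hħ := hħ) hβ l k).add
    (h1.smul (if k = l then 1 else 0))
  convert h2 using 1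
  · funext α
    rw [Ladder.ann_cre]
    split_ifs <;> simp
  · by_cases hkl : k = l
    · subst hkl; simp; ring
    · rw [if_neg hkl, if_neg (Ne.symm hkl), if_neg hkl]; simp

/-- The thermal trace of the symmetrized product of two linear combinations of ladder operators. -/
theorem hasStateTrace_symmetrized (hβ : 0 < β) {u v : Op ι} {c d c' d' : Fin n → ℂ}
    (hu : ∀ φ, u φ = ∑ k, (c k • (N.ladder hħ).ann k φ + d k • (N.ladder hħ).cre k φ))
    (hv : ∀ φ, v φ = ∑ k, (c' k • (N.ladder hħ).ann k φ + d' k • (N.ladder hħ).cre k φ)) :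
    N.HasStateTrace hħ β
      (fun α => (((1 / 2 : ℝ) : ℂ) • (u ∘L v + v ∘L u)) ((N.ladder hħ).state α))
      (∑ k, (c k * d' k + d k * c' k) / 2 * N.modeCoth ħ β k * N.modeZ ħ β) := by
  -- Without symmetrization the two orderings carry extra terms `±Z/2`. They come with opposite
  -- signs in `u v` and `v u`, so only the hyperbolic cotangents survive in the average.
  have key : ∀ {u v : Op ι} {c d c' d' : Fin n → ℂ}
      (hu : ∀ φ, u φ = ∑ k, (c k • (N.ladder hħ).ann k φ + d k • (N.ladder hħ).cre k φ))
      (hv : ∀ φ, v φ = ∑ k, (c' k • (N.ladder hħ).ann k φ + d' k • (N.ladder hħ).cre k φ)),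
      N.HasStateTrace hħ β (fun α => u (v ((N.ladder hħ).state α)))
      (∑ k, (c k * d' k * (N.modeZ ħ β * (N.modeCoth ħ β k / 2) + N.modeZ ħ β / 2) +
        d k * c' k * (N.modeZ ħ β * (N.modeCoth ħ β k / 2) - N.modeZ ħ β / 2))) := by
    intro u v c d c' d' hu hv
    have h := HasStateTrace.sum Finset.univ fun k => HasStateTrace.sum Finset.univ fun l =>
      ((((hasStateTrace_ann_ann (N := N) (hħ := hħ) hβ k l).smul (c k * c' l)).add
      ((hasStateTrace_ann_cre (N := N) (hħ := hħ) hβ k l).smul (c k * d' l))).add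
      ((hasStateTrace_cre_ann (N := N) (hħ := hħ) hβ k l).smul (d k * c' l))).add
      ((hasStateTrace_cre_cre (N := N) (hħ := hħ) hβ k l).smul (d k * d' l))
    convert h using 1
    · funext α
      rw [hu, hv]
      refine Finset.sum_congr rfl fun k _ => ?_
      simp only [map_sum, map_add, map_smul, Finset.smul_sum, ← Finset.sum_add_distrib]
      refine Finset.sum_congr rfl fun l _ => ?_
      module
    · refine Finset.sum_congr rfl fun k _ => ?_
      rw [Finset.sum_eq_single k]
      · simp
      · intro l _ hl
        simp [hl.symm]
      · simp
  have h := ((key hu hv).add (key hv hu)).smul ((1 / 2 : ℝ) : ℂ)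
  convert h using 1
  · rfl
  · rw [← Finset.sum_add_distrib, Finset.mul_sum]
    refine Finset.sum_congr rfl fun k _ => ?_
    push_cast
    ring

end NormalModes

/-! ### Independence of the energy eigenbasis and mode form of the correlations -/

namespace NormalModes

variable {ι : Type*} [Fintype ι] [DecidableEq ι] {n : ℕ}
  {K V K' V' : Matrix ι ι ℝ} (N : NormalModes (Fin n) K V) {ħ β : ℝ} (hħ : 0 < ħ) (hβ : 0 < β)

include N in
theorem inner_hamiltonian_left (φ ψ : Wave ι) :
    ⟪toL2 (hamiltonian ħ K V φ), toL2 ψ⟫ = ⟪toL2 φ, toL2 (hamiltonian ħ K V ψ)⟫ := by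
  simp only [← toL2Lin_apply, N.hamiltonian_eq, map_sum, map_add, map_smul, sum_inner, inner_sum,
    inner_add_left, inner_add_right, inner_smul_left, inner_smul_right, Complex.conj_ofReal,
    inner_mom_left, inner_coord_left]

/-- The number states form an energy eigenbasis. -/
def energyEigenbasis (hH : hamiltonian ħ K' V' = hamiltonian ħ K V) :
    EnergyEigenbasis ħ K' V' where
  index := Fin n → ℕ
  vec := (N.ladder hħ).state
  energy := N.level ħ
  eigen α := by rw [hH]; exact N.hamiltonian_state hħ α
  orthonormal := (N.ladder hħ).orthonormal_state
  complete := (N.topologicalClosure_span_state hħ).ge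

/-- Eigenvectors of a symmetric operator with different energies are orthogonal, so wherever the
overlap is nonzero the two Boltzmann factors agree. -/
theorem exp_energy_mul_inner (hH : hamiltonian ħ K' V' = hamiltonian ħ K V)
    (B : EnergyEigenbasis ħ K' V') (α : Fin n → ℕ) (k : B.index) :
    ((Real.exp (-β * N.level ħ α) : ℝ) : ℂ) * ⟪toL2 ((N.ladder hħ).state α), toL2 (B.vec k)⟫ =
      ((Real.exp (-β * B.energy k) : ℝ) : ℂ) *
        ⟪toL2 ((N.ladder hħ).state α), toL2 (B.vec k)⟫ := by
  have h1 := N.inner_hamiltonian_left (ħ := ħ) ((N.ladder hħ).state α) (B.vec k)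
  have hs : ∀ (c : ℂ) φ, toL2 (c • φ : Wave ι) = c • toL2 φ := fun c φ => map_smul toL2Lin _ _
  rw [N.hamiltonian_state hħ, ← hH, B.eigen, hs, hs, inner_smul_left, inner_smul_right,
    Complex.conj_ofReal] at h1
  by_cases h0 : ⟪toL2 ((N.ladder hħ).state α), toL2 (B.vec k)⟫ = 0
  · rw [h0, mul_zero, mul_zero]
  · have h2 := mul_right_cancel₀ h0 h1
    rw [Complex.ofReal_inj.1 h2]

/-- The thermal trace may be computed in any energy eigenbasis. -/
theorem HasStateTrace.hasSum {N : NormalModes (Fin n) K V} {hħ : 0 < ħ}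
    {A : Op ι} {T : ℂ} (hT : N.HasStateTrace hħ β (fun α => A ((N.ladder hħ).state α)) T)
    (hβ : 0 < β) (hA : ∀ φ ψ, ⟪toL2 (A φ), toL2 ψ⟫ = ⟪toL2 φ, toL2 (A ψ)⟫)
    (hH : hamiltonian ħ K' V' = hamiltonian ħ K V) (B : EnergyEigenbasis ħ K' V') :
    HasSum (fun k => ((Real.exp (-β * B.energy k) : ℝ) : ℂ) *
      ⟪toL2 (B.vec k), toL2 (A (B.vec k))⟫) T := by
  let b := HilbertBasis.mk B.orthonormal B.complete
  let b0 := HilbertBasis.mk (N.energyEigenbasis hħ rfl).orthonormal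
    (N.energyEigenbasis hħ rfl).complete
  have hb : ∀ k, b k = toL2 (B.vec k) := fun k => by simp [b]
  have hb0 : ∀ α, b0 α = toL2 ((N.ladder hħ).state α) := fun α => by
    simp only [b0, HilbertBasis.coe_mk]; rfl
  set h : (Fin n → ℕ) → Wave ι := (N.ladder hħ).state with hh
  set w : (Fin n → ℕ) → ℝ := fun α => Real.exp (-β * N.level ħ α) with hw
  have hw0 : ∀ α, 0 < w α := fun α => Real.exp_pos _
  let F : (Fin n → ℕ) × B.index → ℂ := fun p =>
    (w p.1 : ℂ) * (⟪toL2 (h p.1), toL2 (B.vec p.2)⟫ * ⟪toL2 (B.vec p.2), toL2 (A (h p.1))⟫)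
  have hrow : ∀ α, HasSum (fun k => F (α, k)) ((w α : ℂ) * ⟪toL2 (h α), toL2 (A (h α))⟫) := by
    intro α
    have := b.hasSum_inner_mul_inner (toL2 (h α)) (toL2 (A (h α)))
    simp only [hb] at this
    exact this.mul_left _
  have hnormsq : ∀ g : Lp ℂ 2 (volume : Measure (EuclideanSpace ℝ ι)),
      HasSum (fun k => ‖⟪toL2 (B.vec k), g⟫‖ ^ 2) (‖g‖ ^ 2) := by
    intro g
    have h1 := b.hasSum_inner_mul_inner g g
    simp only [hb] at h1
    rw [inner_self_eq_norm_sq_to_K] at h1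
    have h2 : ∀ k, ⟪g, toL2 (B.vec k)⟫ * ⟪toL2 (B.vec k), g⟫ =
        ((‖⟪toL2 (B.vec k), g⟫‖ ^ 2 : ℝ) : ℂ) := fun k => by
      rw [← inner_conj_symm, Complex.conj_mul']
      push_cast; rfl
    simp only [h2] at h1
    have h3 : (((‖g‖ : ℝ) : ℂ)) ^ 2 = ((‖g‖ ^ 2 : ℝ) : ℂ) := by push_cast; rfl
    exact Complex.hasSum_ofReal.1 (h3 ▸ h1)
  -- The double series converges absolutely: each product of overlaps is at most the sum of their
  -- squares, and Parseval bounds the inner sum by `1 + ‖A h_α‖²`. This is where the norm condition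
  -- in `HasStateTrace` enters.
  have hF : Summable F := by
    rw [← summable_norm_iff, summable_prod_of_nonneg fun p => norm_nonneg _]
    refine ⟨fun α => (hrow α).summable.norm, ?_⟩
    have hmaj : Summable fun α => w α * 1 + w α * ‖toL2 (A (h α))‖ ^ 2 := by
      refine Summable.add ?_ hT.1
      simpa only [mul_one] using (N.hasSum_exp_level hħ hβ).summable
    refine Summable.of_nonneg_of_le (fun α => tsum_nonneg fun k => norm_nonneg _) (fun α => ?_) hmaj
    have h1 := ((hnormsq (toL2 (h α))).add (hnormsq (toL2 (A (h α))))).mul_left (w α)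
    have hn : ‖toL2 (h α)‖ = 1 := (N.ladder hħ).orthonormal_state.1 α
    rw [hn, one_pow, mul_add] at h1
    rw [← h1.tsum_eq]
    refine Summable.tsum_le_tsum (fun k => ?_) (hrow α).summable.norm h1.summable
    rw [norm_mul, norm_mul, Complex.norm_real, Real.norm_of_nonneg (hw0 α).le]
    refine mul_le_mul_of_nonneg_left ?_ (hw0 α).le
    rw [← inner_conj_symm, RCLike.norm_conj]
    nlinarith [sq_nonneg (‖⟪toL2 (B.vec k), toL2 (h α)⟫‖ - ‖⟪toL2 (B.vec k), toL2 (A (h α))⟫‖),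
      sq_nonneg (‖⟪toL2 (B.vec k), toL2 (h α)⟫‖), sq_nonneg (‖⟪toL2 (B.vec k), toL2 (A (h α))⟫‖)]
  have hFT : HasSum F T := by
    have h1 := hF.hasSum.prod_fiberwise hrow
    rw [← h1.unique hT.2]
    exact hF.hasSum
  -- In the other order of summation, the energies are exchanged on nonzero overlaps, `A` moves
  -- across by symmetry, and expansion in the number states collapses the sum over `α`.
  have hswap : HasSum (F ∘ (Equiv.prodComm _ _)) T := (Equiv.prodComm B.index _).hasSum_iff.2 hFT
  refine hswap.prod_fiberwise fun k => ?_
  have h1 := (b0.hasSum_inner_mul_inner (toL2 (A (B.vec k))) (toL2 (B.vec k))).mul_left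
    ((Real.exp (-β * B.energy k) : ℝ) : ℂ)
  rw [hA] at h1
  refine h1.congr_fun fun α => ?_
  have h2 := N.exp_energy_mul_inner hħ (β := β) hH B α k
  simp only [hb0, hA, Function.comp, Equiv.prodComm_apply, Prod.swap, F]
  linear_combination ⟪toL2 (B.vec k), toL2 (A (h α))⟫ * h2

include hβ in
theorem hasStateTrace_id :
    N.HasStateTrace hħ β (fun α => (ContinuousLinearMap.id ℂ (Wave ι)) ((N.ladder hħ).state α))
      ((N.modeZ ħ β : ℝ) : ℂ) := by
  refine hasStateTrace_of_eq_smul_state hβ (c := fun α => 1) (s := fun α => α)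
    (fun α => by simp) (fun α => ?_) (by simpa using N.hasSum_exp_level hħ hβ)
  have : (1 : ℝ) ≤ ∏ k, (α k + 2 : ℝ) := by
    have : 1 ≤ ∏ l, (α l + 2) := Nat.one_le_iff_ne_zero.2
      (Finset.prod_ne_zero_iff.2 fun _ _ => by omega)
    exact_mod_cast this
  exact pow_le_pow_left₀ zero_le_one this 2

include hħ hβ in
theorem hasSum_energy (hH : hamiltonian ħ K' V' = hamiltonian ħ K V)
    (B : EnergyEigenbasis ħ K' V') :
    HasSum (fun k => Real.exp (-β * B.energy k)) (N.modeZ ħ β) := by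
  have h := (N.hasStateTrace_id hħ hβ).hasSum hβ (fun φ ψ => rfl) hH B
  refine Complex.hasSum_ofReal.1 (h.congr_fun fun k => ?_)
  have : ‖toL2 (B.vec k)‖ = 1 := B.orthonormal.1 k
  rw [ContinuousLinearMap.id_apply, inner_self_eq_norm_sq_to_K, this]
  simp

-- Only equality of the Hamiltonians as operators is needed, not of the matrices. This makes the
-- partition function available for nonsymmetric `K'` and `V'`, as needed for independent variation
-- of matrix entries.
include hħ hβ in
theorem partitionFunction_eq (hH : hamiltonian ħ K' V' = hamiltonian ħ K V) :
    partitionFunction ħ β K' V' = N.modeZ ħ β := by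
  have h : Nonempty (EnergyEigenbasis ħ K' V') := ⟨N.energyEigenbasis hħ hH⟩
  rw [partitionFunction, dif_pos h]
  exact (N.hasSum_energy hħ hβ hH h.some).tsum_eq

include N hħ hβ in
theorem hasThermalState (hH : hamiltonian ħ K' V' = hamiltonian ħ K V) :
    HasThermalState ħ β K' V' := by
  refine ⟨⟨N.energyEigenbasis hħ hH⟩, ?_, fun B => ?_⟩
  · rw [N.partitionFunction_eq hħ hβ hH]; exact N.modeZ_pos hħ hβ
  · rw [N.partitionFunction_eq hħ hβ hH]; exact N.hasSum_energy hħ hβ hH B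

theorem HasStateTrace.hasThermalExpectation {N : NormalModes (Fin n) K V} {hħ : 0 < ħ}
    {A : Op ι} {a : ℂ}
    (hT : N.HasStateTrace hħ β (fun α => A ((N.ladder hħ).state α)) (a * N.modeZ ħ β))
    (hβ : 0 < β) (hA : ∀ φ ψ, ⟪toL2 (A φ), toL2 ψ⟫ = ⟪toL2 φ, toL2 (A ψ)⟫)
    (hH : hamiltonian ħ K' V' = hamiltonian ħ K V) :
    HasThermalExpectation ħ β K' V' A a := by
  refine ⟨N.hasThermalState hħ hβ hH, fun B => ?_⟩
  have hZ : ((N.modeZ ħ β : ℝ) : ℂ) ≠ 0 := by exact_mod_cast (N.modeZ_pos hħ hβ).ne'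
  have h := (hT.hasSum hβ hA hH B).mul_right ((N.modeZ ħ β : ℝ) : ℂ)⁻¹
  rw [mul_assoc, mul_inv_cancel₀ hZ, mul_one] at h
  refine h.congr_fun fun k => ?_
  rw [N.partitionFunction_eq hħ hβ hH]
  push_cast
  ring

omit [DecidableEq ι] in
theorem inner_symmetrized_left {u v : Op ι}
    (hu : ∀ φ ψ, ⟪toL2 (u φ), toL2 ψ⟫ = ⟪toL2 φ, toL2 (u ψ)⟫)
    (hv : ∀ φ ψ, ⟪toL2 (v φ), toL2 ψ⟫ = ⟪toL2 φ, toL2 (v ψ)⟫) (φ ψ : Wave ι) :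
    ⟪toL2 ((((1 / 2 : ℝ) : ℂ) • (u ∘L v + v ∘L u)) φ), toL2 ψ⟫ =
      ⟪toL2 φ, toL2 ((((1 / 2 : ℝ) : ℂ) • (u ∘L v + v ∘L u)) ψ)⟫ := by
  simp only [← toL2Lin_apply, _root_.smul_apply, _root_.add_apply, ContinuousLinearMap.comp_apply,
    map_smul, map_add, inner_smul_left, inner_smul_right, inner_add_left, inner_add_right,
    Complex.conj_ofReal] at hu hv ⊢
  rw [hu, hv, hv, hu, add_comm]

theorem posOp_eq_ladder (i : ι) (φ : Wave ι) :
    posOp i φ = ∑ k, (((N.S i k * √(ħ / (2 * N.ω k)) : ℝ) : ℂ) • (N.ladder hħ).ann k φ +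
      ((N.S i k * √(ħ / (2 * N.ω k)) : ℝ) : ℂ) • (N.ladder hħ).cre k φ) := by
  rw [N.posOp_eq]
  refine Finset.sum_congr rfl fun k _ => ?_
  rw [N.coord_eq hħ, smul_smul, ← smul_add, Complex.ofReal_mul]

theorem momOp_eq_ladder (i : ι) (φ : Wave ι) :
    momOp ħ i φ = ∑ k, ((-Complex.I * ((N.T k i * √(ħ * N.ω k / 2) : ℝ) : ℂ)) •
      (N.ladder hħ).ann k φ +
      (Complex.I * ((N.T k i * √(ħ * N.ω k / 2) : ℝ) : ℂ)) • (N.ladder hħ).cre k φ) := by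
  rw [N.momOp_eq ħ]
  refine Finset.sum_congr rfl fun k _ => ?_
  rw [N.mom_eq hħ]
  push_cast
  module

include hħ hβ in
theorem isCorrelation_posOp_posOp (hH : hamiltonian ħ K' V' = hamiltonian ħ K V) :
    IsCorrelation ħ β K' V' posOp posOp
      (N.S * diagonal (fun k => ħ / (2 * N.ω k) * N.modeCoth ħ β k) * N.Sᵀ) := by
  intro i j
  refine HasStateTrace.hasThermalExpectation (N := N) (hħ := hħ) ?_ hβ
    (inner_symmetrized_left (inner_posOp_left i) (inner_posOp_left j)) hH
  convert hasStateTrace_symmetrized hβ (N.posOp_eq_ladder hħ i) (N.posOp_eq_ladder hħ j) using 1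
  rw [← Finset.sum_mul, mul_apply]
  push_cast
  congr 1
  refine Finset.sum_congr rfl fun k _ => ?_
  have h : √(ħ / (2 * N.ω k)) * √(ħ / (2 * N.ω k)) = ħ / (2 * N.ω k) :=
    Real.mul_self_sqrt (by have := N.ω_pos k; positivity)
  have h' := congrArg (fun r : ℝ => (r : ℂ)) h
  push_cast at h'
  rw [mul_diagonal, transpose_apply]
  push_cast
  linear_combination (-(N.S i k : ℂ) * N.S j k * N.modeCoth ħ β k) * h'

include hħ hβ in
theorem isCorrelation_momOp_momOp (hH : hamiltonian ħ K' V' = hamiltonian ħ K V) :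
    IsCorrelation ħ β K' V' (momOp ħ) (momOp ħ)
      (N.Tᵀ * diagonal (fun k => ħ * N.ω k / 2 * N.modeCoth ħ β k) * N.T) := by
  intro i j
  refine HasStateTrace.hasThermalExpectation (N := N) (hħ := hħ) ?_ hβ
    (inner_symmetrized_left (inner_momOp_left ħ i) (inner_momOp_left ħ j)) hH
  convert hasStateTrace_symmetrized hβ (N.momOp_eq_ladder hħ i) (N.momOp_eq_ladder hħ j) using 1
  rw [← Finset.sum_mul, mul_apply]
  push_cast
  congr 1
  refine Finset.sum_congr rfl fun k _ => ?_
  have h : √(ħ * N.ω k / 2) * √(ħ * N.ω k / 2) = ħ * N.ω k / 2 :=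
    Real.mul_self_sqrt (by have := N.ω_pos k; positivity)
  have h' := congrArg (fun r : ℝ => (r : ℂ)) h
  push_cast at h'
  rw [mul_diagonal, transpose_apply]
  push_cast
  linear_combination (Complex.I ^ 2 * (N.T k i : ℂ) * N.T k j * N.modeCoth ħ β k) * h' +
    (ħ * N.ω k / 2 * (N.T k i : ℂ) * N.T k j * N.modeCoth ħ β k) * Complex.I_sq

-- The ladder coefficients of a position are equal and those of a momentum are opposite, so each
-- mode cancels in the symmetrized product.
include N hħ hβ in
theorem isCorrelation_posOp_momOp (hH : hamiltonian ħ K' V' = hamiltonian ħ K V) :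
    IsCorrelation ħ β K' V' posOp (momOp ħ) 0 := by
  intro i j
  refine HasStateTrace.hasThermalExpectation (N := N) (hħ := hħ) ?_ hβ
    (inner_symmetrized_left (inner_posOp_left i) (inner_momOp_left ħ j)) hH
  convert hasStateTrace_symmetrized hβ (N.posOp_eq_ladder hħ i) (N.momOp_eq_ladder hħ j) using 1
  rw [← Finset.sum_mul]
  congr 1
  rw [Matrix.zero_apply, Complex.ofReal_zero]
  refine (Finset.sum_eq_zero fun k _ => ?_).symm
  ring

end NormalModes

/-! ### Partial fractions of the hyperbolic cotangent -/

section MittagLeffler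

theorem summable_inv_sq_add_sq {y : ℝ} (hy : 0 < y) :
    Summable fun n : ℕ => 1 / (((n : ℝ) + 1) ^ 2 + y ^ 2) := by
  have h := (summable_nat_add_iff 1).2 (Real.summable_one_div_nat_pow.2 one_lt_two)
  refine Summable.of_nonneg_of_le (fun n => by positivity) (fun n => ?_) h
  push_cast
  exact one_div_le_one_div_of_le (by positivity) (by nlinarith)

/-- The partial fraction expansion of the hyperbolic cotangent. -/
theorem pi_mul_coth_eq {y : ℝ} (hy : 0 < y) :
    Real.pi * (Real.cosh (Real.pi * y) / Real.sinh (Real.pi * y)) =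
      1 / y + 2 * y * ∑' n : ℕ, 1 / (((n : ℝ) + 1) ^ 2 + y ^ 2) := by
  have hx : (y : ℂ) * Complex.I ∈ Complex.integerComplement := by
    rintro ⟨n, hn⟩
    have := congrArg Complex.im hn
    simp at this
    linarith
  -- The cotangent series is evaluated at `iy`, where the terms for `n` and `-n` combine to `-2iy /
  -- (n² + y²)`.
  have h := cot_series_rep hx
  have hsin : Complex.sin (Real.pi * (y * Complex.I)) = Complex.sinh (Real.pi * y) * Complex.I := by
    rw [← mul_assoc, Complex.sin_mul_I]
  have hcos : Complex.cos (Real.pi * (y * Complex.I)) = Complex.cosh (Real.pi * y) := by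
    rw [← mul_assoc, Complex.cos_mul_I]
  rw [Complex.cot, hsin, hcos, tsum_pnat_eq_tsum_succ
    (f := fun n : ℕ => 1 / ((y : ℂ) * Complex.I - n) + 1 / ((y : ℂ) * Complex.I + n))] at h
  have hy' : (y : ℂ) ≠ 0 := by exact_mod_cast hy.ne'
  have ht : ∀ n : ℕ, 1 / ((y : ℂ) * Complex.I - ((n + 1 : ℕ) : ℂ)) +
      1 / ((y : ℂ) * Complex.I + ((n + 1 : ℕ) : ℂ)) =
      (-2 * y * Complex.I) * ((1 / (((n : ℝ) + 1) ^ 2 + y ^ 2) : ℝ) : ℂ) := by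
    intro n
    have h1 : (y : ℂ) * Complex.I - ((n + 1 : ℕ) : ℂ) ≠ 0 := fun h0 => by
      have := congrArg Complex.im h0
      simp at this
      linarith
    have h2 : (y : ℂ) * Complex.I + ((n + 1 : ℕ) : ℂ) ≠ 0 := fun h0 => by
      have := congrArg Complex.im h0
      simp at this
      linarith
    have h3 : (((n : ℝ) : ℂ) + 1) ^ 2 + (y : ℂ) ^ 2 ≠ 0 := by
      have : ((n : ℝ) + 1) ^ 2 + y ^ 2 ≠ 0 := by positivity
      exact_mod_cast this
    push_cast at h1 h2 h3 ⊢
    field_simp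
    linear_combination (2 * (y : ℂ) * Complex.I * y ^ 2) * Complex.I_sq
  simp only [ht, tsum_mul_left, ← Complex.ofReal_tsum] at h
  have hs : Complex.sinh (Real.pi * y) ≠ 0 := by
    have : Real.sinh (Real.pi * y) ≠ 0 := (Real.sinh_pos_iff.2 (by positivity)).ne'
    rw [← Complex.ofReal_mul, ← Complex.ofReal_sinh]
    exact_mod_cast this
  have h2 : (Real.pi : ℂ) * (Complex.cosh (Real.pi * y) / Complex.sinh (Real.pi * y)) =
      1 / y + 2 * y * ((∑' n : ℕ, 1 / (((n : ℝ) + 1) ^ 2 + y ^ 2) : ℝ) : ℂ) := by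
    have h3 : Complex.I * (Real.pi * (Complex.cosh (Real.pi * y) /
        (Complex.sinh (Real.pi * y) * Complex.I))) =
        Real.pi * (Complex.cosh (Real.pi * y) / Complex.sinh (Real.pi * y)) := by
      field_simp
    rw [← h3, h]
    generalize ((∑' n : ℕ, 1 / (((n : ℝ) + 1) ^ 2 + y ^ 2) : ℝ) : ℂ) = s
    field_simp
    linear_combination (-2 * (y : ℂ) ^ 2 * s) * Complex.I_sq
  exact_mod_cast h2

theorem matsubara_succ_sq_add_sq {ħ β : ℝ} (hħ : 0 < ħ) (hβ : 0 < β) (ω : ℝ) (r : ℕ) :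
    matsubara ħ β (r + 1) ^ 2 + ω ^ 2 = (2 * Real.pi / (ħ * β)) ^ 2 *
      (((r : ℝ) + 1) ^ 2 + (β * ħ * ω / (2 * Real.pi)) ^ 2) := by
  have := Real.pi_pos
  unfold matsubara
  push_cast
  field_simp

theorem summable_matsubara {ħ β ω : ℝ} (hħ : 0 < ħ) (hβ : 0 < β) (hω : 0 < ω) :
    Summable fun r : ℕ => (matsubara ħ β (r + 1) ^ 2 + ω ^ 2)⁻¹ := by
  have := Real.pi_pos
  refine ((summable_inv_sq_add_sq (y := β * ħ * ω / (2 * Real.pi)) (by positivity)).mul_left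
    ((2 * Real.pi / (ħ * β)) ^ 2)⁻¹).congr fun r => ?_
  rw [matsubara_succ_sq_add_sq hħ hβ, mul_inv, one_div]

theorem coth_eq_matsubara_sum {ħ β ω : ℝ} (hħ : 0 < ħ) (hβ : 0 < β) (hω : 0 < ω) :
    ħ / (2 * ω) * (Real.cosh (β * ħ * ω / 2) / Real.sinh (β * ħ * ω / 2)) =
      1 / β * (ω ^ 2)⁻¹ + 2 / β * ∑' r : ℕ, (matsubara ħ β (r + 1) ^ 2 + ω ^ 2)⁻¹ := by
  have hπ := Real.pi_pos
  have h := pi_mul_coth_eq (y := β * ħ * ω / (2 * Real.pi)) (by positivity)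
  have h1 : Real.pi * (β * ħ * ω / (2 * Real.pi)) = β * ħ * ω / 2 := by field_simp
  rw [h1] at h
  have h2 : ∑' r : ℕ, (matsubara ħ β (r + 1) ^ 2 + ω ^ 2)⁻¹ = ((2 * Real.pi / (ħ * β)) ^ 2)⁻¹ *
      ∑' n : ℕ, 1 / (((n : ℝ) + 1) ^ 2 + (β * ħ * ω / (2 * Real.pi)) ^ 2) := by
    rw [← tsum_mul_left]
    refine tsum_congr fun r => ?_
    rw [matsubara_succ_sq_add_sq hħ hβ, mul_inv, one_div]
  rw [h2]
  generalize ∑' n : ℕ, 1 / (((n : ℝ) + 1) ^ 2 + (β * ħ * ω / (2 * Real.pi)) ^ 2) = s at h ⊢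
  have h3 : Real.cosh (β * ħ * ω / 2) / Real.sinh (β * ħ * ω / 2) =
    (1 / (β * ħ * ω / (2 * Real.pi)) + 2 * (β * ħ * ω / (2 * Real.pi)) * s) / Real.pi := by
    rw [← h]; field_simp
  rw [h3]
  field_simp

end MittagLeffler

/-! ### From normal modes to Matsubara sums of resolvents -/

namespace NormalModes

section Algebra

variable {κ ι : Type*} [Fintype ι] [DecidableEq ι] [Fintype κ] [DecidableEq κ]
  {K V : Matrix ι ι ℝ} (N : NormalModes κ K V)

include N in
theorem T_transpose_mul_S_transpose : N.Tᵀ * N.Sᵀ = 1 := by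
  rw [← transpose_mul, N.S_mul_T, transpose_one]

theorem S_transpose_mul_T_transpose : N.Sᵀ * N.Tᵀ = 1 := by
  rw [← transpose_mul, N.T_mul_S, transpose_one]

theorem inv_invMass : K⁻¹ = N.Tᵀ * N.T := by
  refine inv_eq_left_inv ((congrArg (N.Tᵀ * N.T * ·) N.eq_invMass).trans ?_)
  calc N.Tᵀ * N.T * (N.S * N.Sᵀ) = N.Tᵀ * (N.T * N.S) * N.Sᵀ := by
        simp only [Matrix.mul_assoc]
    _ = 1 := by rw [N.T_mul_S, Matrix.mul_one, N.T_transpose_mul_S_transpose]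

/-- Both `K⁻¹ = Tᵀ T` and `V = Tᵀ ω² T` are diagonal in the normal modes. -/
theorem resolvent_eq (z : ℝ) :
    (z ^ 2 • K⁻¹ + V)⁻¹ = N.S * diagonal (fun k => (z ^ 2 + N.ω k ^ 2)⁻¹) * N.Sᵀ := by
  refine inv_eq_left_inv ?_
  have h : z ^ 2 • K⁻¹ + V = N.Tᵀ * diagonal (fun k => z ^ 2 + N.ω k ^ 2) * N.T := by
    have : diagonal (fun k => z ^ 2 + N.ω k ^ 2) =
        z ^ 2 • (1 : Matrix κ κ ℝ) + diagonal (fun k => N.ω k ^ 2) := by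
      rw [← diagonal_one, ← diagonal_smul, diagonal_add]
      congr 1; funext k; simp
    rw [N.inv_invMass, this, Matrix.mul_add, Matrix.add_mul, ← N.eq_spring]
    simp
  have hz : ∀ k, z ^ 2 + N.ω k ^ 2 ≠ 0 := fun k => by
    have := N.ω_pos k; positivity
  rw [h, Matrix.mul_assoc, Matrix.mul_assoc N.Tᵀ, ← Matrix.mul_assoc N.Sᵀ,
    N.S_transpose_mul_T_transpose, Matrix.one_mul, Matrix.mul_assoc, ← Matrix.mul_assoc (diagonal _),
    diagonal_mul_diagonal]
  simp only [inv_mul_cancel₀ (hz _), diagonal_one, Matrix.one_mul, N.S_mul_T]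

theorem resolvent_zero : V⁻¹ = N.S * diagonal (fun k => (N.ω k ^ 2)⁻¹) * N.Sᵀ := by
  simpa using N.resolvent_eq 0

/-- In each mode this is `1 - z² / (z² + ω²) = ω² / (z² + ω²)`. The subtraction is what makes the
momentum series converge. -/
theorem momentum_resolvent_eq (z : ℝ) :
    K⁻¹ - z ^ 2 • (K⁻¹ * (z ^ 2 • K⁻¹ + V)⁻¹ * K⁻¹) =
      N.Tᵀ * diagonal (fun k => N.ω k ^ 2 * (z ^ 2 + N.ω k ^ 2)⁻¹) * N.T := by
  have hz : ∀ k, z ^ 2 + N.ω k ^ 2 ≠ 0 := fun k => by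
    have := N.ω_pos k; positivity
  have h1 : K⁻¹ * (N.S * diagonal (fun k => (z ^ 2 + N.ω k ^ 2)⁻¹) * N.Sᵀ) * K⁻¹ =
      N.Tᵀ * diagonal (fun k => (z ^ 2 + N.ω k ^ 2)⁻¹) * N.T := by
    rw [N.inv_invMass]
    calc _ = N.Tᵀ * (N.T * N.S) * diagonal (fun k => (z ^ 2 + N.ω k ^ 2)⁻¹) *
          (N.Sᵀ * N.Tᵀ) * N.T := by simp only [Matrix.mul_assoc]
      _ = _ := by rw [N.T_mul_S, N.S_transpose_mul_T_transpose, Matrix.mul_one, Matrix.mul_one]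
  have h2 : diagonal (fun k => N.ω k ^ 2 * (z ^ 2 + N.ω k ^ 2)⁻¹) =
      1 - z ^ 2 • diagonal (fun k => (z ^ 2 + N.ω k ^ 2)⁻¹) := by
    rw [← diagonal_one, ← diagonal_smul, diagonal_sub]
    congr 1; funext k
    have := hz k
    simp only [Pi.smul_apply, smul_eq_mul]
    field_simp
    ring
  rw [N.resolvent_eq, h1, h2, N.inv_invMass, Matrix.mul_sub, Matrix.sub_mul]
  simp

omit [Fintype ι] [DecidableEq ι] in
theorem mul_diagonal_mul_apply (A : Matrix ι κ ℝ) (B : Matrix κ ι ℝ) (d : κ → ℝ)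
    (i j : ι) : (A * diagonal d * B) i j = ∑ k, A i k * d k * B k j := by
  rw [Matrix.mul_apply]
  exact Finset.sum_congr rfl fun k _ => by rw [mul_diagonal]

omit [Fintype ι] [DecidableEq ι] in
theorem smul_mul_diagonal_mul_add (a b : ℝ) (A : Matrix ι κ ℝ) (B : Matrix κ ι ℝ)
    (d e : κ → ℝ) :
    a • (A * diagonal d * B) + b • (A * diagonal e * B) =
      A * diagonal (fun k => a * d k + b * e k) * B := by
  ext i j
  simp only [Matrix.add_apply, Matrix.smul_apply, mul_diagonal_mul_apply, smul_eq_mul,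
    Finset.mul_sum, ← Finset.sum_add_distrib]
  exact Finset.sum_congr rfl fun k _ => by ring

omit [Fintype ι] [DecidableEq ι] in
theorem hasSum_mul_diagonal_mul {α : Type*} (A : Matrix ι κ ℝ) (B : Matrix κ ι ℝ)
    {d : α → κ → ℝ} {s : κ → ℝ} (h : ∀ k, HasSum (fun r => d r k) (s k)) :
    HasSum (fun r => A * diagonal (d r) * B) (A * diagonal s * B) := by
  refine Pi.hasSum.2 fun i => Pi.hasSum.2 fun j => ?_
  simp only [mul_diagonal_mul_apply]
  exact hasSum_sum fun k _ => ((h k).mul_left (A i k)).mul_right (B k j)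

end Algebra

variable {ι : Type*} [Fintype ι] [DecidableEq ι] {n : ℕ}
  {K V : Matrix ι ι ℝ} (N : NormalModes (Fin n) K V) {ħ β : ℝ} (hħ : 0 < ħ) (hβ : 0 < β)

include N hħ hβ in
theorem summable_resolvent :
    Summable fun r : ℕ => (matsubara ħ β (r + 1) ^ 2 • K⁻¹ + V)⁻¹ := by
  simp only [N.resolvent_eq]
  exact (hasSum_mul_diagonal_mul _ _ fun k =>
    (summable_matsubara hħ hβ (N.ω_pos k)).hasSum).summable

include hħ hβ in
theorem position_correlation_eq :
    N.S * diagonal (fun k => ħ / (2 * N.ω k) * N.modeCoth ħ β k) * N.Sᵀ =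
      (1 / β) • V⁻¹ + (2 / β) • ∑' r : ℕ, (matsubara ħ β (r + 1) ^ 2 • K⁻¹ + V)⁻¹ := by
  have h := (hasSum_mul_diagonal_mul N.S N.Sᵀ fun k =>
    (summable_matsubara hħ hβ (N.ω_pos k)).hasSum).tsum_eq
  simp only [← N.resolvent_eq] at h
  rw [h, N.resolvent_zero, smul_mul_diagonal_mul_add]
  congr 3
  funext k
  exact coth_eq_matsubara_sum hħ hβ (N.ω_pos k)

include N hħ hβ in
theorem summable_momentum_resolvent :
    Summable fun r : ℕ => K⁻¹ - matsubara ħ β (r + 1) ^ 2 •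
      (K⁻¹ * (matsubara ħ β (r + 1) ^ 2 • K⁻¹ + V)⁻¹ * K⁻¹) := by
  simp only [N.momentum_resolvent_eq]
  exact (hasSum_mul_diagonal_mul _ _ fun k =>
    ((summable_matsubara hħ hβ (N.ω_pos k)).hasSum.mul_left (N.ω k ^ 2))).summable

-- The momentum coefficient of a mode is `ω²` times its position coefficient, so the same partial
-- fractions apply; the zero-frequency term becomes `1` in every mode, whence `K⁻¹ / β`.
include hħ hβ in
theorem momentum_correlation_eq :
    N.Tᵀ * diagonal (fun k => ħ * N.ω k / 2 * N.modeCoth ħ β k) * N.T =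
      (1 / β) • K⁻¹ + (2 / β) • ∑' r : ℕ, (K⁻¹ - matsubara ħ β (r + 1) ^ 2 •
        (K⁻¹ * (matsubara ħ β (r + 1) ^ 2 • K⁻¹ + V)⁻¹ * K⁻¹)) := by
  have h := (hasSum_mul_diagonal_mul N.Tᵀ N.T fun k =>
    ((summable_matsubara hħ hβ (N.ω_pos k)).hasSum.mul_left (N.ω k ^ 2))).tsum_eq
  simp only [← N.momentum_resolvent_eq] at h
  have h1 : K⁻¹ = N.Tᵀ * (diagonal (fun _ => (1 : ℝ)) : Matrix (Fin n) (Fin n) ℝ) * N.T := by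
    rw [N.inv_invMass, diagonal_one, Matrix.mul_one]
  rw [h]
  conv_rhs => enter [1]; rw [h1]
  rw [smul_mul_diagonal_mul_add]
  congr 3
  funext k
  have h2 := coth_eq_matsubara_sum hħ hβ (N.ω_pos k)
  have hω := N.ω_pos k
  have h3 : ħ * N.ω k / 2 * N.modeCoth ħ β k = N.ω k ^ 2 * (ħ / (2 * N.ω k) *
      (Real.cosh (β * ħ * N.ω k / 2) / Real.sinh (β * ħ * N.ω k / 2))) := by
    rw [modeCoth]; field_simp
  rw [h3, h2]
  field_simp

end NormalModes

/-! ### Correlation matrices of general coupled oscillators -/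

section Correlations

variable {ι : Type*} [Fintype ι] [DecidableEq ι] {K V : Matrix ι ι ℝ} {ħ β : ℝ}

/-- The position correlations of coupled oscillators, as a sum over Matsubara frequencies. -/
def posCorrelation (ħ β : ℝ) (K V : Matrix ι ι ℝ) : Matrix ι ι ℝ :=
  (1 / β) • V⁻¹ + (2 / β) • ∑' r : ℕ, (matsubara ħ β (r + 1) ^ 2 • K⁻¹ + V)⁻¹

/-- The momentum correlations of coupled oscillators, as a sum over Matsubara frequencies. -/
def momCorrelation (ħ β : ℝ) (K V : Matrix ι ι ℝ) : Matrix ι ι ℝ :=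
  (1 / β) • K⁻¹ + (2 / β) • ∑' r : ℕ, (K⁻¹ - matsubara ħ β (r + 1) ^ 2 •
    (K⁻¹ * (matsubara ħ β (r + 1) ^ 2 • K⁻¹ + V)⁻¹ * K⁻¹))

theorem exists_finNormalModes (hK : K.PosDef) (hV : V.PosDef) :
    Nonempty (NormalModes (Fin (Fintype.card ι)) K V) :=
  nonempty_normalModes (Fintype.equivFin ι).symm hK hV

theorem thermal_correlations (hħ : 0 < ħ) (hβ : 0 < β) (hK : K.PosDef) (hV : V.PosDef) :
    HasThermalState ħ β K V ∧ IsCorrelation ħ β K V posOp posOp (posCorrelation ħ β K V) ∧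
      IsCorrelation ħ β K V (momOp ħ) (momOp ħ) (momCorrelation ħ β K V) ∧
      IsCorrelation ħ β K V posOp (momOp ħ) 0 := by
  obtain ⟨N⟩ := exists_finNormalModes hK hV
  refine ⟨N.hasThermalState hħ hβ rfl, ?_, ?_, N.isCorrelation_posOp_momOp hħ hβ rfl⟩
  · rw [posCorrelation, ← N.position_correlation_eq hħ hβ]
    exact N.isCorrelation_posOp_posOp hħ hβ rfl
  · rw [momCorrelation, ← N.momentum_correlation_eq hħ hβ]
    exact N.isCorrelation_momOp_momOp hħ hβ rfl

end Correlations

/-! ### Laplace transforms of cosine and sine -/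

section LaplaceTransforms

theorem integrable_exp_mul_complex {z : ℝ} (hz : 0 < z) (w : ℝ) :
    IntegrableOn (fun t : ℝ => Complex.exp ((-z + Complex.I * w) * t)) (Set.Ioi 0) :=
  integrableOn_exp_mul_complex_Ioi (by simpa using hz) 0

theorem integral_exp_mul_complex_eq {z : ℝ} (hz : 0 < z) (w : ℝ) :
    ∫ t : ℝ in Set.Ioi (0 : ℝ), Complex.exp ((-z + Complex.I * w) * t) =
      ((z / (z ^ 2 + w ^ 2) : ℝ) : ℂ) + ((w / (z ^ 2 + w ^ 2) : ℝ) : ℂ) * Complex.I := by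
  rw [integral_exp_mul_complex_Ioi (by simpa using hz) 0]
  have h1 : (-z + Complex.I * w : ℂ) ≠ 0 := fun h => by
    have := congrArg Complex.re h
    simp at this
    exact hz.ne' this
  have h2 : (z ^ 2 + w ^ 2 : ℂ) ≠ 0 := by
    have : z ^ 2 + w ^ 2 ≠ 0 := by positivity
    exact_mod_cast this
  push_cast
  field_simp
  simp only [mul_zero, Complex.exp_zero]
  linear_combination (-(w : ℂ) ^ 2) * Complex.I_sq

theorem exp_mul_complex_eq (z w t : ℝ) : Complex.exp ((-z + Complex.I * w) * t) =
    ((Real.exp (-z * t) * Real.cos (w * t) : ℝ) : ℂ) +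
      ((Real.exp (-z * t) * Real.sin (w * t) : ℝ) : ℂ) * Complex.I := by
  have : (-z + Complex.I * w) * t = ((-z * t : ℝ) : ℂ) + ((w * t : ℝ) : ℂ) * Complex.I := by
    push_cast; ring
  rw [this, Complex.exp_add, Complex.exp_mul_I]
  push_cast
  ring

/-- The real part of `∫ exp ((-z + iw) t) dt = (z + iw) / (z² + w²)`; the imaginary part gives the
sine. Integrability is recorded as well, because matrix entries are finite sums of such integrals.
-/
theorem laplace_cos {z : ℝ} (hz : 0 < z) (w : ℝ) :
    IntegrableOn (fun t : ℝ => Real.exp (-z * t) * Real.cos (w * t)) (Set.Ioi 0) ∧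
      ∫ t in Set.Ioi (0 : ℝ), Real.exp (-z * t) * Real.cos (w * t) = z / (z ^ 2 + w ^ 2) := by
  have h := integrable_exp_mul_complex hz w
  have e : ∀ t : ℝ, RCLike.re (Complex.exp ((-z + Complex.I * w) * t)) =
      Real.exp (-z * t) * Real.cos (w * t) := fun t => by
    rw [exp_mul_complex_eq]
    simp [-Complex.ofReal_mul, -Complex.ofReal_exp, -Complex.ofReal_cos, -Complex.ofReal_sin]
  have h1 := h.re
  have h2 := integral_re h
  simp only [e] at h1 h2
  refine ⟨h1, h2.trans ?_⟩
  rw [integral_exp_mul_complex_eq hz]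
  simp [-Complex.ofReal_div]

theorem laplace_sin {z : ℝ} (hz : 0 < z) (w : ℝ) :
    IntegrableOn (fun t : ℝ => Real.exp (-z * t) * Real.sin (w * t)) (Set.Ioi 0) ∧
      ∫ t in Set.Ioi (0 : ℝ), Real.exp (-z * t) * Real.sin (w * t) = w / (z ^ 2 + w ^ 2) := by
  have h := integrable_exp_mul_complex hz w
  have e : ∀ t : ℝ, RCLike.im (Complex.exp ((-z + Complex.I * w) * t)) =
      Real.exp (-z * t) * Real.sin (w * t) := fun t => by
    rw [exp_mul_complex_eq]
    simp [-Complex.ofReal_mul, -Complex.ofReal_exp, -Complex.ofReal_cos, -Complex.ofReal_sin]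
  have h1 := h.im
  have h2 := integral_im h
  simp only [e] at h1 h2
  refine ⟨h1, h2.trans ?_⟩
  rw [integral_exp_mul_complex_eq hz]
  simp [-Complex.ofReal_div]

theorem laplace_mul_diagonal_mul {a b κ : Type*} [Fintype κ] [DecidableEq κ] (A : Matrix a κ ℝ)
    (B : Matrix κ b ℝ) {s : ℝ → κ → ℝ} {z : ℝ} {l : κ → ℝ}
    (h : ∀ k, IntegrableOn (fun t => Real.exp (-z * t) * s t k) (Set.Ioi 0) ∧
      ∫ t in Set.Ioi (0 : ℝ), Real.exp (-z * t) * s t k = l k) :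
    laplace (fun t => A * diagonal (s t) * B) z = A * diagonal l * B := by
  ext i j
  have e : ∀ t, Real.exp (-z * t) * (A * diagonal (s t) * B) i j =
      ∑ k, (A i k * B k j) * (Real.exp (-z * t) * s t k) := fun t => by
    rw [Matrix.mul_apply, Finset.mul_sum]
    exact Finset.sum_congr rfl fun k _ => by rw [mul_diagonal]; ring
  rw [laplace, of_apply]
  simp only [e]
  rw [integral_finsetSum _ fun k _ => (h k).1.const_mul _, Matrix.mul_apply]
  refine Finset.sum_congr rfl fun k _ => ?_
  rw [integral_const_mul, (h k).2, mul_diagonal]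
  ring

end LaplaceTransforms

/-! ### Functional calculus of the reservoir matrices -/

section FunctionalCalculus

variable {ε : Type*} [Fintype ε] [DecidableEq ε]

/-- One diagonalization serves all functions at once. No continuity is required of `f`, since the
spectrum is finite. -/
theorem exists_cfc_eq {A : Matrix ε ε ℝ} (hA : A.PosDef) :
    ∃ (U : Matrix ε ε ℝ) (d : ε → ℝ), (∀ i, 0 < d i) ∧ Uᵀ * U = 1 ∧ U * Uᵀ = 1 ∧
      ∀ f : ℝ → ℝ, cfc f A = U * diagonal (fun i => f (d i)) * Uᵀ := by
  have h1 := Unitary.coe_star_mul_self hA.1.eigenvectorUnitary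
  rw [star_eq_conjTranspose, conjTranspose_eq_transpose_of_trivial] at h1
  refine ⟨hA.1.eigenvectorUnitary, hA.1.eigenvalues, hA.eigenvalues_pos, h1,
    mul_eq_one_comm.1 h1, fun f => ?_⟩
  rw [hA.1.cfc_eq, IsHermitian.cfc, Unitary.conjStarAlgAut_apply, star_eq_conjTranspose,
    conjTranspose_eq_transpose_of_trivial]
  rfl

theorem diagonal_conj_mul {U : Matrix ε ε ℝ} (hU : Uᵀ * U = 1) (d e : ε → ℝ) :
    (U * diagonal d * Uᵀ) * (U * diagonal e * Uᵀ) = U * diagonal (fun i => d i * e i) * Uᵀ := by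
  calc _ = U * diagonal d * (Uᵀ * U) * diagonal e * Uᵀ := by simp only [Matrix.mul_assoc]
    _ = _ := by rw [hU, Matrix.mul_one, Matrix.mul_assoc U, diagonal_mul_diagonal]

theorem transpose_invSqrt {m : Matrix ε ε ℝ} : (invSqrt m)ᵀ = invSqrt m := by
  have : IsSelfAdjoint (invSqrt m) := cfc_predicate _ _
  rwa [IsSelfAdjoint, star_eq_conjTranspose, conjTranspose_eq_transpose_of_trivial] at this

theorem invSqrt_mul_mul_invSqrt {m : Matrix ε ε ℝ} (hm : m.PosDef) :
    invSqrt m * m * invSqrt m = 1 := by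
  obtain ⟨U, d, hd, h1, h2, h3⟩ := exists_cfc_eq hm
  have h4 := h3 id
  rw [cfc_id ℝ m (show IsSelfAdjoint m from hm.1)] at h4
  rw [invSqrt, h3]
  conv_lhs => enter [1, 2]; rw [h4]
  rw [diagonal_conj_mul h1, diagonal_conj_mul h1]
  have : (fun i => (√(d i))⁻¹ * id (d i) * (√(d i))⁻¹) = fun _ => 1 := by
    funext i
    have := Real.mul_self_sqrt (hd i).le
    have h0 := Real.sqrt_pos.2 (hd i)
    simp only [id]
    field_simp
    nlinarith
  rw [this, diagonal_one, Matrix.mul_one, h2]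

theorem invSqrt_mul_invSqrt {m : Matrix ε ε ℝ} (hm : m.PosDef) :
    invSqrt m * invSqrt m = m⁻¹ := by
  have h := invSqrt_mul_mul_invSqrt hm
  have h1 : m * (invSqrt m * invSqrt m) = 1 := by
    have := mul_eq_one_comm.1 (show invSqrt m * (m * invSqrt m) = 1 by rwa [← Matrix.mul_assoc])
    rwa [← Matrix.mul_assoc]
  exact (inv_eq_right_inv h1).symm

theorem posDef_invSqrt_mul_mul_invSqrt {m c : Matrix ε ε ℝ} (hm : m.PosDef) (hc : c.PosDef) :
    (invSqrt m * c * invSqrt m).PosDef := by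
  have h : Function.Injective (invSqrt m).mulVec := by
    refine mulVec_injective_of_isUnit ?_
    have := invSqrt_mul_mul_invSqrt hm
    rw [Matrix.mul_assoc] at this
    exact IsUnit.of_mul_eq_one _ this
  have := hc.conjTranspose_mul_mul_same h
  rwa [conjTranspose_eq_transpose_of_trivial, transpose_invSqrt] at this

/-- The modes are chosen as `S = m^{-1/2} U`, where `U` diagonalizes `m^{-1/2} c m^{-1/2}`. With
this choice every kernel defined through the frequency matrix becomes diagonal in the modes. -/
theorem exists_reservoirModes {m c : Matrix ε ε ℝ} (hm : m.PosDef) (hc : c.PosDef) :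
    ∃ N : NormalModes ε m⁻¹ c, ∀ f : ℝ → ℝ,
      invSqrt m * cfc f (freq m c) * invSqrt m = N.S * diagonal (fun k => f (N.ω k)) * N.Sᵀ := by
  have hB := posDef_invSqrt_mul_mul_invSqrt hm hc
  obtain ⟨U, d, hd, h1, h2, h3⟩ := exists_cfc_eq hB
  have hR := invSqrt_mul_mul_invSqrt hm
  have hRR := invSqrt_mul_invSqrt hm
  have hu : IsUnit m.det := (Matrix.isUnit_iff_isUnit_det m).1 hm.isUnit
  have hmT : mᵀ = m := by
    have := hm.1; rwa [IsHermitian, conjTranspose_eq_transpose_of_trivial] at this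
  refine ⟨⟨invSqrt m * U, Uᵀ * invSqrt m * m, fun k => √(d k), fun k => Real.sqrt_pos.2 (hd k),
    ?_, ?_, ?_, ?_⟩, fun f => ?_⟩
  · calc Uᵀ * invSqrt m * m * (invSqrt m * U) = Uᵀ * (invSqrt m * m * invSqrt m) * U := by
          simp only [Matrix.mul_assoc]
      _ = 1 := by rw [hR, Matrix.mul_one, h1]
  · calc invSqrt m * U * (Uᵀ * invSqrt m * m) = invSqrt m * (U * Uᵀ) * invSqrt m * m := by
          simp only [Matrix.mul_assoc]
      _ = 1 := by rw [h2, Matrix.mul_one, hRR, nonsing_inv_mul _ hu]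
  · rw [transpose_mul, transpose_invSqrt, ← hRR]
    calc _ = invSqrt m * (1 * invSqrt m) := by rw [Matrix.one_mul]
      _ = _ := by rw [← h2]; simp only [Matrix.mul_assoc]
  · have h4 := h3 id
    rw [cfc_id ℝ _ (show IsSelfAdjoint (invSqrt m * c * invSqrt m) from hB.1)] at h4
    have h5 : (fun k => √(d k) ^ 2) = fun k => id (d k) := by
      funext k; exact Real.sq_sqrt (hd k).le
    rw [h5]
    simp only [transpose_mul, transpose_transpose, transpose_invSqrt, hmT]
    calc c = (m * (invSqrt m * invSqrt m)) * c * ((invSqrt m * invSqrt m) * m) := by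
          rw [hRR, mul_nonsing_inv _ hu, nonsing_inv_mul _ hu, Matrix.one_mul, Matrix.mul_one]
      _ = m * invSqrt m * (invSqrt m * c * invSqrt m) * (invSqrt m * m) := by
          simp only [Matrix.mul_assoc]
      _ = _ := by rw [h4]; simp only [Matrix.mul_assoc]
  · have : cfc f (freq m c) = U * diagonal (fun k => f (√(d k))) * Uᵀ := by
      rw [freq, ← cfc_comp f Real.sqrt _
        (show IsSelfAdjoint (invSqrt m * c * invSqrt m) from hB.1)
        ((Matrix.finite_real_spectrum.image _).continuousOn _)
        (Matrix.finite_real_spectrum.continuousOn _), h3]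
      rfl
    change _ = invSqrt m * U * diagonal (fun k => f (√(d k))) * (invSqrt m * U)ᵀ
    rw [this, transpose_mul, transpose_invSqrt]
    simp only [Matrix.mul_assoc]

end FunctionalCalculus

/-! ### The propagators as resolvents -/

section Propagators

variable {σ ε : Type*} [Fintype σ] [DecidableEq σ] [Fintype ε] [DecidableEq ε]
  {m c : Matrix ε ε ℝ}

theorem freePropHat_eq (hm : m.PosDef) (hc : c.PosDef) {z : ℝ} (hz : 0 < z) :
    freePropHat m c z = (z ^ 2 • m + c)⁻¹ := by
  obtain ⟨N, hN⟩ := exists_reservoirModes hm hc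
  have hu : IsUnit m.det := (Matrix.isUnit_iff_isUnit_det m).1 hm.isUnit
  have h := N.resolvent_eq z
  rw [nonsing_inv_nonsing_inv _ hu] at h
  rw [h, freePropHat]
  have e : freeProp m c = fun t => N.S * diagonal (fun k => Real.sin (N.ω k * t) / N.ω k) * N.Sᵀ :=
    funext fun t => hN _
  rw [e]
  refine laplace_mul_diagonal_mul _ _ fun k => ?_
  have h1 := laplace_sin hz (N.ω k)
  have hω := N.ω_pos k
  simp only [mul_div_assoc']
  refine ⟨h1.1.div_const _, ?_⟩
  rw [integral_div, h1.2]
  field_simp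

-- Mode by mode this is the partial fraction `2z · z / ((z² + ω²) 2ω²) = 1/ω² - 1/(z² + ω²)`. The
-- right side combines the renormalization `gᵀ c⁻¹ g` with the reservoir response.
omit [Fintype σ] [DecidableEq σ] in
theorem two_mul_dampingHat_eq (hm : m.PosDef) (hc : c.PosDef) (g : Matrix ε σ ℝ) {z : ℝ}
    (hz : 0 < z) : (2 * z) • dampingHat m c g z = gᵀ * (c⁻¹ - (z ^ 2 • m + c)⁻¹) * g := by
  obtain ⟨N, hN⟩ := exists_reservoirModes hm hc
  have hu : IsUnit m.det := (Matrix.isUnit_iff_isUnit_det m).1 hm.isUnit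
  have h := N.resolvent_eq z
  rw [nonsing_inv_nonsing_inv _ hu] at h
  have e : damping m c g = fun t => (gᵀ * N.S) *
      diagonal (fun k => Real.cos (N.ω k * t) / (2 * N.ω k ^ 2)) * (N.Sᵀ * g) := by
    funext t
    calc damping m c g t = gᵀ * (invSqrt m * cfc (fun w : ℝ => Real.cos (w * t) / (2 * w ^ 2))
          (freq m c) * invSqrt m) * g := by simp only [damping, Matrix.mul_assoc]
      _ = _ := by rw [hN]; simp only [Matrix.mul_assoc]
  have l : laplace (damping m c g) z = (gᵀ * N.S) *
      diagonal (fun k => z / (z ^ 2 + N.ω k ^ 2) / (2 * N.ω k ^ 2)) * (N.Sᵀ * g) := by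
    rw [e]
    refine laplace_mul_diagonal_mul _ _ fun k => ?_
    have h1 := laplace_cos hz (N.ω k)
    simp only [mul_div_assoc']
    exact ⟨h1.1.div_const _, by rw [integral_div, h1.2]⟩
  have d : (2 * z) • diagonal (fun k => z / (z ^ 2 + N.ω k ^ 2) / (2 * N.ω k ^ 2)) =
      diagonal (fun k => (N.ω k ^ 2)⁻¹) - diagonal (fun k => (z ^ 2 + N.ω k ^ 2)⁻¹) := by
    rw [← diagonal_smul, diagonal_sub]
    congr 1; funext k
    have hω := N.ω_pos k
    simp only [Pi.smul_apply, smul_eq_mul]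
    field_simp
    ring
  rw [dampingHat, l, ← Matrix.smul_mul, ← Matrix.mul_smul, d, h, N.resolvent_zero]
  simp only [Matrix.mul_sub, Matrix.sub_mul, Matrix.mul_assoc]

theorem propHat_eq (M C : Matrix σ σ ℝ) (hm : m.PosDef) (hc : c.PosDef) (g : Matrix ε σ ℝ) {z : ℝ}
    (hz : 0 < z) : propHat M C m c g z =
      (z ^ 2 • M + gᵀ * (c⁻¹ - (z ^ 2 • m + c)⁻¹) * g + C)⁻¹ := by
  rw [propHat, two_mul_dampingHat_eq hm hc g hz]

/-- The factor `2z` removes the damping term at zero, whatever value the Laplace integral takes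
there. -/
theorem propHat_zero (M C : Matrix σ σ ℝ) (m c : Matrix ε ε ℝ) (g : Matrix ε σ ℝ) :
    propHat M C m c g 0 = C⁻¹ := by
  simp [propHat]

end Propagators

/-! ### Series of matrices and of their blocks -/

section MatrixSums

variable {α : Type*}

theorem hasSum_matrix_mul_mul {a b c d : Type*} [Fintype b] [Fintype c] (A : Matrix a b ℝ)
    (B : Matrix c d ℝ) {F : α → Matrix b c ℝ} {S : Matrix b c ℝ} (h : HasSum F S) :
    HasSum (fun r => A * F r * B) (A * S * B) :=
  h.map (AddMonoidHom.mk' (fun X : Matrix b c ℝ => A * X * B)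
    fun X Y => by rw [Matrix.mul_add, Matrix.add_mul])
    ((continuous_const.matrix_mul continuous_id).matrix_mul continuous_const)

theorem hasSum_toBlocks {a b c d : Type*} {A : α → Matrix a c ℝ} {B : α → Matrix a d ℝ}
    {C : α → Matrix b c ℝ} {D : α → Matrix b d ℝ} {s : Matrix (a ⊕ b) (c ⊕ d) ℝ}
    (h : HasSum (fun r => fromBlocks (A r) (B r) (C r) (D r)) s) :
    HasSum A s.toBlocks₁₁ ∧ HasSum B s.toBlocks₁₂ ∧ HasSum C s.toBlocks₂₁ ∧
      HasSum D s.toBlocks₂₂ := by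
  refine ⟨?_, ?_, ?_, ?_⟩ <;>
    exact Pi.hasSum.2 fun i => Pi.hasSum.2 fun j => Pi.hasSum.1 (Pi.hasSum.1 h _) _

end MatrixSums

/-! ### Block inversion for system and reservoir -/

section Blocks

variable {σ ε : Type*} [Fintype σ] [DecidableEq σ] [Fintype ε] [DecidableEq ε]
  {M C : Matrix σ σ ℝ} {m c : Matrix ε ε ℝ}

omit [Fintype ε] in
theorem isUnit_det_of_posDef {A : Matrix σ σ ℝ} (hA : A.PosDef) : IsUnit A.det :=
  (Matrix.isUnit_iff_isUnit_det A).1 hA.isUnit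

omit [Fintype σ] [DecidableEq σ] in
theorem transpose_of_posDef {A : Matrix σ σ ℝ} (hA : A.PosDef) : Aᵀ = A := by
  have := hA.1
  rwa [IsHermitian, conjTranspose_eq_transpose_of_trivial] at this

/-- The completed square shows that the potential vanishes only if first `X = 0` and then `x = 0`.
-/
theorem posDef_closedSpring (hC : C.PosDef) (hc : c.PosDef) (g : Matrix ε σ ℝ) :
    (closedSpring C c g).PosDef := by
  refine PosDef.of_dotProduct_mulVec_pos ?_ fun x hx => ?_
  · rw [IsHermitian, conjTranspose_eq_transpose_of_trivial, closedSpring, fromBlocks_transpose,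
      transpose_add, transpose_mul, transpose_mul, transpose_nonsing_inv, transpose_of_posDef hC,
      transpose_of_posDef hc, transpose_transpose, transpose_neg, transpose_neg,
      transpose_transpose, Matrix.mul_assoc]
  · obtain ⟨X, y, rfl⟩ : ∃ X y, x = Sum.elim X y := ⟨_, _, (Sum.elim_comp_inl_inr x).symm⟩
    rw [star_trivial, closedSpring_quadraticForm C hc]
    by_cases hX : X = 0
    · subst hX
      have hy : y ≠ 0 := by
        rintro rfl
        exact hx (by ext i; cases i <;> rfl)
      simpa using hc.dotProduct_mulVec_pos hy
    · have h1 := hC.dotProduct_mulVec_pos hX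
      have h2 := hc.posSemidef.dotProduct_mulVec_nonneg (y - c⁻¹ *ᵥ (g *ᵥ X))
      rw [star_trivial] at h1 h2
      exact add_pos_of_pos_of_nonneg h1 h2

theorem posDef_fromBlocks (hM : M.PosDef) (hm : m.PosDef) :
    (fromBlocks M 0 0 m : Matrix (σ ⊕ ε) (σ ⊕ ε) ℝ).PosDef := by
  have h := posDef_closedSpring hM hm (0 : Matrix ε σ ℝ)
  simpa [closedSpring] using h

theorem posDef_closedInvMass (hM : M.PosDef) (hm : m.PosDef) :
    (closedInvMass M⁻¹ m⁻¹).PosDef :=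
  posDef_fromBlocks hM.inv hm.inv

theorem inv_closedInvMass (hM : M.PosDef) (hm : m.PosDef) :
    (closedInvMass M⁻¹ m⁻¹)⁻¹ = fromBlocks M 0 0 m := by
  refine inv_eq_left_inv ?_
  rw [closedInvMass, fromBlocks_multiply]
  simp [mul_nonsing_inv _ (isUnit_det_of_posDef hM), mul_nonsing_inv _ (isUnit_det_of_posDef hm)]

theorem posDef_sq_smul_add {ι : Type*} [Fintype ι] [DecidableEq ι] {A B : Matrix ι ι ℝ}
    (hA : A.PosDef) (hB : B.PosDef) (z : ℝ) : (z ^ 2 • A + B).PosDef :=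
  PosDef.posSemidef_add (hA.posSemidef.smul (sq_nonneg z)) hB

/-- Block inversion through the Schur complement of the reservoir block `z² m + c`. The
renormalization supplies the `c⁻¹` in the complement, which is the inverse of `G`. Keeping `φ` and
`G` as variables lets the same identity cover `z = 0`, where `φ = c⁻¹`. -/
theorem closed_resolvent (hM : M.PosDef) (hC : C.PosDef) (hm : m.PosDef) (hc : c.PosDef)
    (g : Matrix ε σ ℝ) (z : ℝ) {φ : Matrix ε ε ℝ} {G : Matrix σ σ ℝ}
    (hφ : φ = (z ^ 2 • m + c)⁻¹) (hG : G = (z ^ 2 • M + gᵀ * (c⁻¹ - φ) * g + C)⁻¹) :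
    (z ^ 2 • (closedInvMass M⁻¹ m⁻¹)⁻¹ + closedSpring C c g)⁻¹ =
      fromBlocks G (G * gᵀ * φ) (φ * g * G) (φ + φ * g * G * gᵀ * φ) := by
  have hD := isUnit_det_of_posDef (posDef_sq_smul_add hm hc z)
  have hW := isUnit_det_of_posDef
    (posDef_sq_smul_add (posDef_fromBlocks hM hm) (posDef_closedSpring hC hc g) z)
  have hφD : φ * (z ^ 2 • m + c) = 1 := by rw [hφ, nonsing_inv_mul _ hD]
  have e : z ^ 2 • fromBlocks M 0 0 m + closedSpring C c g =
      fromBlocks ((z ^ 2 • M + gᵀ * (c⁻¹ - φ) * g + C) + gᵀ * φ * g) (-gᵀ) (-g)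
        (z ^ 2 • m + c) := by
    rw [closedSpring, fromBlocks_smul, fromBlocks_add]
    congr 1
    · rw [Matrix.mul_sub, Matrix.sub_mul]; abel
    · simp
    · simp
  -- The full matrix is positive definite, and its determinant is that of the reservoir block times
  -- that of the Schur complement, so the latter is invertible.
  have hS : IsUnit (z ^ 2 • M + gᵀ * (c⁻¹ - φ) * g + C).det := by
    have hi : Invertible (z ^ 2 • m + c) := invertibleOfIsUnitDet _ hD
    rw [e, det_fromBlocks₂₂, invOf_eq_nonsing_inv, ← hφ] at hW
    have := isUnit_of_mul_isUnit_right hW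
    simpa [Matrix.neg_mul, Matrix.mul_neg] using this
  have hGS : G * (z ^ 2 • M + gᵀ * (c⁻¹ - φ) * g + C) = 1 := by rw [hG, nonsing_inv_mul _ hS]
  rw [inv_closedInvMass hM hm, e]
  generalize z ^ 2 • M + gᵀ * (c⁻¹ - φ) * g + C = S at hGS
  generalize z ^ 2 • m + c = D at hφD
  refine inv_eq_left_inv ?_
  rw [fromBlocks_multiply, ← fromBlocks_one]
  congr 1
  · rw [Matrix.mul_add, hGS, Matrix.mul_neg]
    simp only [Matrix.mul_assoc]; abel
  · rw [Matrix.mul_assoc (G * gᵀ), hφD, Matrix.mul_one, Matrix.mul_neg]; abel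
  · rw [Matrix.mul_add, Matrix.mul_assoc (φ * g), hGS, Matrix.mul_neg, Matrix.add_mul,
      Matrix.mul_one]
    simp only [Matrix.mul_assoc]; abel
  · rw [Matrix.add_mul, hφD, Matrix.mul_assoc (φ * g * G * gᵀ), hφD, Matrix.mul_one,
      Matrix.mul_neg]; abel

variable {ħ β : ℝ}

theorem matsubara_succ_pos (hħ : 0 < ħ) (hβ : 0 < β) (r : ℕ) : 0 < matsubara ħ β (r + 1) := by
  rw [matsubara]; have := Real.pi_pos; positivity

theorem closed_resolvent_pos (hM : M.PosDef) (hC : C.PosDef)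
    (hm : m.PosDef) (hc : c.PosDef) (g : Matrix ε σ ℝ) {z : ℝ} (hz : 0 < z) :
    (z ^ 2 • (closedInvMass M⁻¹ m⁻¹)⁻¹ + closedSpring C c g)⁻¹ =
      fromBlocks (propHat M C m c g z) (propHat M C m c g z * gᵀ * freePropHat m c z)
        (freePropHat m c z * g * propHat M C m c g z)
        (freePropHat m c z +
          freePropHat m c z * g * propHat M C m c g z * gᵀ * freePropHat m c z) := by
  refine closed_resolvent hM hC hm hc g z (freePropHat_eq hm hc hz) ?_
  rw [propHat_eq M C hm hc g hz, freePropHat_eq hm hc hz]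

theorem inv_closedSpring (hM : M.PosDef) (hC : C.PosDef) (hm : m.PosDef) (hc : c.PosDef)
    (g : Matrix ε σ ℝ) : (closedSpring C c g)⁻¹ =
      fromBlocks C⁻¹ (C⁻¹ * gᵀ * c⁻¹) (c⁻¹ * g * C⁻¹) (c⁻¹ + c⁻¹ * g * C⁻¹ * gᵀ * c⁻¹) := by
  have := closed_resolvent hM hC hm hc g 0 (φ := c⁻¹) (G := C⁻¹) (by simp) (by simp)
  simpa using this

theorem posCorrelation_closed (hħ : 0 < ħ) (hβ : 0 < β) (hM : M.PosDef) (hC : C.PosDef)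
    (hm : m.PosDef) (hc : c.PosDef) (g : Matrix ε σ ℝ) {G : ℕ → Matrix σ σ ℝ}
    {φ : ℕ → Matrix ε ε ℝ} (hG : ∀ r, G r = propHat M C m c g (matsubara ħ β (r + 1)))
    (hφ : ∀ r, φ r = freePropHat m c (matsubara ħ β (r + 1))) :
    ∃ s₁₁ s₁₂ s₂₁ s₂₂, HasSum G s₁₁ ∧ HasSum (fun r => G r * gᵀ * φ r) s₁₂ ∧
      HasSum (fun r => φ r * g * G r) s₂₁ ∧
      HasSum (fun r => φ r + φ r * g * G r * gᵀ * φ r) s₂₂ ∧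
      posCorrelation ħ β (closedInvMass M⁻¹ m⁻¹) (closedSpring C c g) = fromBlocks
        ((1 / β) • C⁻¹ + (2 / β) • s₁₁) ((1 / β) • (C⁻¹ * gᵀ * c⁻¹) + (2 / β) • s₁₂)
        ((1 / β) • (c⁻¹ * g * C⁻¹) + (2 / β) • s₂₁)
        ((1 / β) • (c⁻¹ + c⁻¹ * g * C⁻¹ * gᵀ * c⁻¹) + (2 / β) • s₂₂) := by
  obtain ⟨N⟩ := exists_finNormalModes (posDef_closedInvMass hM hm) (posDef_closedSpring hC hc g)
  have h := (N.summable_resolvent hħ hβ).hasSum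
  rw [posCorrelation]
  generalize (∑' r : ℕ, (matsubara ħ β (r + 1) ^ 2 • (closedInvMass M⁻¹ m⁻¹)⁻¹ +
    closedSpring C c g)⁻¹) = s at h ⊢
  have h' : HasSum (fun r => fromBlocks (G r) (G r * gᵀ * φ r) (φ r * g * G r)
      (φ r + φ r * g * G r * gᵀ * φ r)) s :=
    h.congr_fun fun r => by
      rw [closed_resolvent_pos hM hC hm hc g (matsubara_succ_pos hħ hβ r), hG, hφ]
  obtain ⟨h1, h2, h3, h4⟩ := hasSum_toBlocks h'
  refine ⟨s.toBlocks₁₁, s.toBlocks₁₂, s.toBlocks₂₁, s.toBlocks₂₂, h1, h2, h3, h4, ?_⟩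
  rw [inv_closedSpring hM hC hm hc g, ← fromBlocks_add, ← fromBlocks_smul, ← fromBlocks_smul,
    fromBlocks_toBlocks]

/-- The mass matrix is block diagonal, so the off-diagonal blocks receive nothing from zero
frequency. The lower left block is left unspecified because it is not used. -/
theorem momCorrelation_closed (hħ : 0 < ħ) (hβ : 0 < β) (hM : M.PosDef) (hC : C.PosDef)
    (hm : m.PosDef) (hc : c.PosDef) (g : Matrix ε σ ℝ) {G : ℕ → Matrix σ σ ℝ}
    {φ : ℕ → Matrix ε ε ℝ} (hG : ∀ r, G r = propHat M C m c g (matsubara ħ β (r + 1)))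
    (hφ : ∀ r, φ r = freePropHat m c (matsubara ħ β (r + 1))) :
    ∃ s₁₁ s₁₂ s₂₁ s₂₂, HasSum (fun r => M - matsubara ħ β (r + 1) ^ 2 • (M * G r * M)) s₁₁ ∧
      HasSum (fun r => - (matsubara ħ β (r + 1) ^ 2 • (M * (G r * gᵀ * φ r) * m))) s₁₂ ∧
      HasSum (fun r => m - matsubara ħ β (r + 1) ^ 2 •
        (m * (φ r + φ r * g * G r * gᵀ * φ r) * m)) s₂₂ ∧
      momCorrelation ħ β (closedInvMass M⁻¹ m⁻¹) (closedSpring C c g) = fromBlocks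
        ((1 / β) • M + (2 / β) • s₁₁) ((2 / β) • s₁₂) s₂₁ ((1 / β) • m + (2 / β) • s₂₂) := by
  obtain ⟨N⟩ := exists_finNormalModes (posDef_closedInvMass hM hm) (posDef_closedSpring hC hc g)
  have h := (N.summable_momentum_resolvent hħ hβ).hasSum
  rw [momCorrelation]
  generalize (∑' r : ℕ, ((closedInvMass M⁻¹ m⁻¹)⁻¹ - matsubara ħ β (r + 1) ^ 2 •
    ((closedInvMass M⁻¹ m⁻¹)⁻¹ * (matsubara ħ β (r + 1) ^ 2 • (closedInvMass M⁻¹ m⁻¹)⁻¹ +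
    closedSpring C c g)⁻¹ * (closedInvMass M⁻¹ m⁻¹)⁻¹))) = s at h ⊢
  have h' : HasSum (fun r => fromBlocks (M - matsubara ħ β (r + 1) ^ 2 • (M * G r * M))
      (-(matsubara ħ β (r + 1) ^ 2 • (M * (G r * gᵀ * φ r) * m)))
      (-(matsubara ħ β (r + 1) ^ 2 • (m * (φ r * g * G r) * M)))
      (m - matsubara ħ β (r + 1) ^ 2 • (m * (φ r + φ r * g * G r * gᵀ * φ r) * m))) s :=
    h.congr_fun fun r => by
      rw [closed_resolvent_pos hM hC hm hc g (matsubara_succ_pos hħ hβ r), ← hG, ← hφ,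
        inv_closedInvMass hM hm, fromBlocks_multiply, fromBlocks_multiply, fromBlocks_smul,
        sub_eq_add_neg (fromBlocks M 0 0 m), fromBlocks_neg, fromBlocks_add]
      simp only [Matrix.mul_zero, Matrix.zero_mul, add_zero, zero_add, ← sub_eq_add_neg, zero_sub]
  obtain ⟨h1, h2, h3, h4⟩ := hasSum_toBlocks h'
  refine ⟨s.toBlocks₁₁, s.toBlocks₁₂, (2 / β) • s.toBlocks₂₁, s.toBlocks₂₂, h1, h2, h4, ?_⟩
  rw [inv_closedInvMass hM hm]
  conv_lhs => rw [← fromBlocks_toBlocks s]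
  rw [fromBlocks_smul, fromBlocks_smul, fromBlocks_add, smul_zero, smul_zero, zero_add, zero_add]

end Blocks

/-! ### The stated correlation formulas -/

section ClosedCorrelations

variable {σ ε : Type*} [Fintype σ] [DecidableEq σ] [Fintype ε] [DecidableEq ε]
  {M C : Matrix σ σ ℝ} {m c : Matrix ε ε ℝ} {ħ β : ℝ}

/-- The defining equation of the resolvent `f̂`. This and its variants trade each `ν_r²` in the
formulas for the difference between static and dynamic response. -/
theorem sq_smul_freePropHat_mul (hm : m.PosDef) (hc : c.PosDef) {z : ℝ} (hz : 0 < z) :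
    z ^ 2 • (freePropHat m c z * m) = 1 - freePropHat m c z * c := by
  have hD := isUnit_det_of_posDef (posDef_sq_smul_add hm hc z)
  have h : freePropHat m c z * (z ^ 2 • m + c) = 1 := by
    rw [freePropHat_eq hm hc hz, nonsing_inv_mul _ hD]
  rw [← h, Matrix.mul_add, Matrix.mul_smul, add_sub_cancel_right]

theorem sq_smul_mul_freePropHat (hm : m.PosDef) (hc : c.PosDef) {z : ℝ} (hz : 0 < z) :
    z ^ 2 • (m * freePropHat m c z) = 1 - c * freePropHat m c z := by
  have hD := isUnit_det_of_posDef (posDef_sq_smul_add hm hc z)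
  have h : (z ^ 2 • m + c) * freePropHat m c z = 1 := by
    rw [freePropHat_eq hm hc hz, mul_nonsing_inv _ hD]
  rw [← h, Matrix.add_mul, Matrix.smul_mul, add_sub_cancel_right]

theorem sq_smul_freePropHat_mul_inv (hm : m.PosDef) (hc : c.PosDef) {z : ℝ} (hz : 0 < z) :
    z ^ 2 • (freePropHat m c z * m * c⁻¹) = c⁻¹ - freePropHat m c z := by
  rw [← Matrix.smul_mul, sq_smul_freePropHat_mul hm hc hz, Matrix.sub_mul, Matrix.one_mul,
    Matrix.mul_assoc, mul_nonsing_inv _ (isUnit_det_of_posDef hc), Matrix.mul_one]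

theorem sq_smul_inv_mul_freePropHat (hm : m.PosDef) (hc : c.PosDef) {z : ℝ} (hz : 0 < z) :
    z ^ 2 • (c⁻¹ * m * freePropHat m c z) = c⁻¹ - freePropHat m c z := by
  rw [Matrix.mul_assoc, ← Matrix.mul_smul, sq_smul_mul_freePropHat hm hc hz, Matrix.mul_sub,
    Matrix.mul_one, ← Matrix.mul_assoc, nonsing_inv_mul _ (isUnit_det_of_posDef hc),
    Matrix.one_mul]

/-- The blocks of the Matsubara sums of the closed system, written with the propagators of the
system and of the reservoir. -/
theorem closed_correlation_formulas (hħ : 0 < ħ) (hβ : 0 < β) (hM : M.PosDef) (hC : C.PosDef)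
    (hm : m.PosDef) (hc : c.PosDef) (g : Matrix ε σ ℝ) {G γ : ℕ → Matrix σ σ ℝ}
    {f : ℕ → Matrix ε ε ℝ} {ν : ℕ → ℝ} (hν : ∀ r, ν r = matsubara ħ β (r + 1))
    (hG : ∀ r, G r = propHat M C m c g (ν r)) (hγ : ∀ r, γ r = dampingHat m c g (ν r))
    (hf : ∀ r, f r = freePropHat m c (ν r)) {Q P : Matrix (σ ⊕ ε) (σ ⊕ ε) ℝ}
    (hQ : Q = posCorrelation ħ β (closedInvMass M⁻¹ m⁻¹) (closedSpring C c g))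
    (hP : P = momCorrelation ħ β (closedInvMass M⁻¹ m⁻¹) (closedSpring C c g)) :
    (Summable G ∧ Q.toBlocks₁₁ = (1 / β) • C⁻¹ + (2 / β) • ∑' r, G r) ∧
    (Summable (fun r => M - ν r ^ 2 • (M * G r * M)) ∧
      P.toBlocks₁₁ = (1 / β) • M + (2 / β) • ∑' r, (M - ν r ^ 2 • (M * G r * M))) ∧
    (Summable (fun r => ν r ^ 2 • (G r * gᵀ * f r * m * c⁻¹)) ∧
      Q.toBlocks₁₂ = Q.toBlocks₁₁ * gᵀ * c⁻¹ -
        (2 / β) • ∑' r, ν r ^ 2 • (G r * gᵀ * f r * m * c⁻¹)) ∧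
    (∀ ginv : Matrix σ ε ℝ, g * ginv = 1 → Summable (fun r => ν r • (G r * γ r * ginv)) ∧
      Q.toBlocks₁₂ = Q.toBlocks₁₁ * gᵀ * c⁻¹ - (4 / β) • ∑' r, ν r • (G r * γ r * ginv)) ∧
    P.toBlocks₁₂ = M * Q.toBlocks₁₂ * c - M * Q.toBlocks₁₁ * gᵀ ∧
    (Summable (fun r => ν r ^ 2 • (m * f r * g * G r * gᵀ * f r * m)) ∧
      P.toBlocks₂₂ = momCorrelation ħ β m⁻¹ c -
        (2 / β) • ∑' r, ν r ^ 2 • (m * f r * g * G r * gᵀ * f r * m)) ∧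
    (Summable (fun r => ν r ^ 2 • (c⁻¹ * m * f r * g * G r * gᵀ * f r)) ∧
      Summable (fun r => ν r ^ 2 • (f r * g * G r * gᵀ * f r * m * c⁻¹)) ∧
      Summable (fun r => ν r ^ 4 • (c⁻¹ * m * f r * g * G r * gᵀ * f r * m * c⁻¹)) ∧
      Q.toBlocks₂₂ = posCorrelation ħ β m⁻¹ c + c⁻¹ * g * Q.toBlocks₁₁ * gᵀ * c⁻¹
        - (2 / β) • ∑' r, ν r ^ 2 • (c⁻¹ * m * f r * g * G r * gᵀ * f r)
        - (2 / β) • ∑' r, ν r ^ 2 • (f r * g * G r * gᵀ * f r * m * c⁻¹)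
        - (2 / β) • ∑' r, ν r ^ 4 • (c⁻¹ * m * f r * g * G r * gᵀ * f r * m * c⁻¹)) := by
  have hpos : ∀ r, 0 < ν r := fun r => by rw [hν]; exact matsubara_succ_pos hħ hβ r
  have hcu := isUnit_det_of_posDef hc
  have hmu := isUnit_det_of_posDef hm
  have u1 : ∀ r, ν r ^ 2 • (f r * m * c⁻¹) = c⁻¹ - f r := fun r => by
    rw [hf]; exact sq_smul_freePropHat_mul_inv hm hc (hpos r)
  have u2 : ∀ r, ν r ^ 2 • (c⁻¹ * m * f r) = c⁻¹ - f r := fun r => by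
    rw [hf]; exact sq_smul_inv_mul_freePropHat hm hc (hpos r)
  have u3 : ∀ r, ν r ^ 2 • (f r * m) = 1 - f r * c := fun r => by
    rw [hf]; exact sq_smul_freePropHat_mul hm hc (hpos r)
  obtain ⟨s₁₁, s₁₂, s₂₁, s₂₂, a1, a2, a3, a4, a5⟩ := posCorrelation_closed hħ hβ hM hC hm hc g (G := G) (φ := f)
    (fun r => by rw [hG, hν]) (fun r => by rw [hf, hν])
  obtain ⟨t₁₁, t₁₂, t₂₁, t₂₂, b1, b2, b4, b5⟩ := momCorrelation_closed hħ hβ hM hC hm hc g (G := G) (φ := f)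
    (fun r => by rw [hG, hν]) (fun r => by rw [hf, hν])
  simp only [← hν] at b1 b2 b4
  obtain ⟨N⟩ := exists_finNormalModes hm.inv hc
  have f1 := (N.summable_resolvent hħ hβ).hasSum
  have f2 := (N.summable_momentum_resolvent hħ hβ).hasSum
  simp only [nonsing_inv_nonsing_inv _ hmu] at f1 f2
  have xE : posCorrelation ħ β m⁻¹ c = (1 / β) • c⁻¹ + (2 / β) • ∑' r : ℕ,
      (matsubara ħ β (r + 1) ^ 2 • m + c)⁻¹ := by
    rw [posCorrelation, nonsing_inv_nonsing_inv _ hmu]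
  have pE : momCorrelation ħ β m⁻¹ c = (1 / β) • m + (2 / β) • ∑' r : ℕ,
      (m - matsubara ħ β (r + 1) ^ 2 • (m * (matsubara ħ β (r + 1) ^ 2 • m + c)⁻¹ * m)) := by
    rw [momCorrelation, nonsing_inv_nonsing_inv _ hmu]
  generalize (∑' r : ℕ, (matsubara ħ β (r + 1) ^ 2 • m + c)⁻¹) = sE at f1 xE
  generalize (∑' r : ℕ, (m - matsubara ħ β (r + 1) ^ 2 •
    (m * (matsubara ħ β (r + 1) ^ 2 • m + c)⁻¹ * m))) = tE at f2 pE
  have f1' : HasSum f sE := f1.congr_fun fun r => by rw [hf, freePropHat_eq hm hc (hpos r), hν]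
  have f2' : HasSum (fun r => m - ν r ^ 2 • (m * f r * m)) tE :=
    f2.congr_fun fun r => by rw [hf, freePropHat_eq hm hc (hpos r), hν]
  have q11 : Q.toBlocks₁₁ = (1 / β) • C⁻¹ + (2 / β) • s₁₁ := by
    rw [hQ, a5, toBlocks_fromBlocks₁₁]
  have q12 : Q.toBlocks₁₂ = (1 / β) • (C⁻¹ * gᵀ * c⁻¹) + (2 / β) • s₁₂ := by
    rw [hQ, a5, toBlocks_fromBlocks₁₂]
  have q22 : Q.toBlocks₂₂ =
      (1 / β) • (c⁻¹ + c⁻¹ * g * C⁻¹ * gᵀ * c⁻¹) + (2 / β) • s₂₂ := by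
    rw [hQ, a5, toBlocks_fromBlocks₂₂]
  have p11 : P.toBlocks₁₁ = (1 / β) • M + (2 / β) • t₁₁ := by
    rw [hP, b5, toBlocks_fromBlocks₁₁]
  have p12 : P.toBlocks₁₂ = (2 / β) • t₁₂ := by
    rw [hP, b5, toBlocks_fromBlocks₁₂]
  have p22 : P.toBlocks₂₂ = (1 / β) • m + (2 / β) • t₂₂ := by
    rw [hP, b5, toBlocks_fromBlocks₂₂]
  -- the coupling term of the system-reservoir correlations
  have c12 : HasSum (fun r => G r * gᵀ * (c⁻¹ - f r)) (s₁₁ * (gᵀ * c⁻¹) - s₁₂) := by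
    have := (hasSum_matrix_mul_mul (1 : Matrix σ σ ℝ) (gᵀ * c⁻¹) a1).sub a2
    rw [Matrix.one_mul] at this
    exact this.congr_fun fun r => by
      simp only [Matrix.mul_sub, Matrix.mul_assoc, Matrix.one_mul]
  have c12' : HasSum (fun r => ν r ^ 2 • (G r * gᵀ * f r * m * c⁻¹)) (s₁₁ * (gᵀ * c⁻¹) - s₁₂) :=
    c12.congr_fun fun r => by
      rw [← u1, Matrix.mul_smul]; simp only [Matrix.mul_assoc]
  have x12 : Q.toBlocks₁₂ = Q.toBlocks₁₁ * gᵀ * c⁻¹ - (2 / β) • (s₁₁ * (gᵀ * c⁻¹) - s₁₂) := by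
    rw [q12, q11]
    simp only [Matrix.add_mul, Matrix.smul_mul, Matrix.mul_assoc, smul_sub]
    abel
  -- The four products of `c⁻¹` or `f̂` on either side of `g Ĝ gᵀ` are summed separately; the
  -- reservoir series are combinations of them.
  have d22 : HasSum (fun r => f r * g * G r * gᵀ * f r) (s₂₂ - sE) :=
    (a4.sub f1').congr_fun fun r => by rw [add_sub_cancel_left]
  have d21 : HasSum (fun r => f r * g * G r * gᵀ * c⁻¹) (s₂₁ * (gᵀ * c⁻¹)) := by
    have := hasSum_matrix_mul_mul (1 : Matrix ε ε ℝ) (gᵀ * c⁻¹) a3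
    rw [Matrix.one_mul] at this
    exact this.congr_fun fun r => by simp only [Matrix.mul_assoc, Matrix.one_mul]
  have d12 : HasSum (fun r => c⁻¹ * g * G r * gᵀ * f r) (c⁻¹ * g * s₁₂) := by
    have := hasSum_matrix_mul_mul (c⁻¹ * g) (1 : Matrix ε ε ℝ) a2
    rw [Matrix.mul_one] at this
    exact this.congr_fun fun r => by simp only [Matrix.mul_assoc, Matrix.mul_one]
  have d11 : HasSum (fun r => c⁻¹ * g * G r * gᵀ * c⁻¹) (c⁻¹ * g * s₁₁ * (gᵀ * c⁻¹)) :=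
    (hasSum_matrix_mul_mul (c⁻¹ * g) (gᵀ * c⁻¹) a1).congr_fun fun r => by
      simp only [Matrix.mul_assoc]
  have e1 : HasSum (fun r => ν r ^ 2 • (c⁻¹ * m * f r * g * G r * gᵀ * f r))
      (c⁻¹ * g * s₁₂ - (s₂₂ - sE)) := (d12.sub d22).congr_fun fun r => by
    have : ν r ^ 2 • (c⁻¹ * m * f r * g * G r * gᵀ * f r) =
        (ν r ^ 2 • (c⁻¹ * m * f r)) * (g * G r * gᵀ * f r) := by
      rw [Matrix.smul_mul]; simp only [Matrix.mul_assoc]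
    rw [this, u2, Matrix.sub_mul]
    simp only [Matrix.mul_assoc]
  have e2 : HasSum (fun r => ν r ^ 2 • (f r * g * G r * gᵀ * f r * m * c⁻¹))
      (s₂₁ * (gᵀ * c⁻¹) - (s₂₂ - sE)) := (d21.sub d22).congr_fun fun r => by
    have : ν r ^ 2 • (f r * g * G r * gᵀ * f r * m * c⁻¹) =
        (f r * g * G r * gᵀ) * (ν r ^ 2 • (f r * m * c⁻¹)) := by
      rw [Matrix.mul_smul]; simp only [Matrix.mul_assoc]
    rw [this, u1, Matrix.mul_sub]
  -- Half of `ν ^ 4` goes to each side, turning both outer factors into `c⁻¹ - f̂`.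
  have e3 : HasSum (fun r => ν r ^ 4 • (c⁻¹ * m * f r * g * G r * gᵀ * f r * m * c⁻¹))
      (c⁻¹ * g * s₁₁ * (gᵀ * c⁻¹) - c⁻¹ * g * s₁₂ - (s₂₁ * (gᵀ * c⁻¹) - (s₂₂ - sE))) :=
    ((d11.sub d12).sub (d21.sub d22)).congr_fun fun r => by
      have : ν r ^ 4 • (c⁻¹ * m * f r * g * G r * gᵀ * f r * m * c⁻¹) =
          (ν r ^ 2 • (c⁻¹ * m * f r)) * (g * G r * gᵀ) * (ν r ^ 2 • (f r * m * c⁻¹)) := by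
        rw [Matrix.smul_mul, Matrix.smul_mul, Matrix.mul_smul, smul_smul, ← pow_add]
        simp only [Matrix.mul_assoc]
      rw [this, u1, u2]
      simp only [Matrix.sub_mul, Matrix.mul_sub, Matrix.mul_assoc]
      abel
  have e4 : HasSum (fun r => ν r ^ 2 • (m * f r * g * G r * gᵀ * f r * m)) (tE - t₂₂) :=
    (f2'.sub b4).congr_fun fun r => by
      have : m * (f r + f r * g * G r * gᵀ * f r) * m =
          m * f r * m + m * f r * g * G r * gᵀ * f r * m := by
        simp only [Matrix.mul_add, Matrix.add_mul, Matrix.mul_assoc]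
      rw [this, smul_add]
      abel
  have e5 : t₁₂ = M * s₁₂ * c - M * s₁₁ * gᵀ := by
    refine b2.unique (((hasSum_matrix_mul_mul M c a2).sub
      (hasSum_matrix_mul_mul M gᵀ a1)).congr_fun fun r => ?_)
    have : ν r ^ 2 • (M * (G r * gᵀ * f r) * m) = M * G r * gᵀ * (ν r ^ 2 • (f r * m)) := by
      rw [Matrix.mul_smul]; simp only [Matrix.mul_assoc]
    rw [this, u3, Matrix.mul_sub, Matrix.mul_one, neg_sub]
    simp only [Matrix.mul_assoc]
  refine ⟨⟨a1.summable, by rw [a1.tsum_eq, q11]⟩, ⟨b1.summable, by rw [b1.tsum_eq, p11]⟩,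
    ⟨c12'.summable, by rw [c12'.tsum_eq, x12]⟩, fun ginv hg => ?_, ?_,
    ⟨e4.summable, ?_⟩, e1.summable, e2.summable, e3.summable, ?_⟩
  -- The right inverse of `g` cancels the last factor of `2ν γ̂ = gᵀ (c⁻¹ - f̂) g`; the factor `2`
  -- there accounts for `4/β` in place of `2/β`.
  · have h : HasSum (fun r => ν r • (G r * γ r * ginv))
        ((1 / 2 : ℝ) • (s₁₁ * (gᵀ * c⁻¹) - s₁₂)) := by
      refine (c12.const_smul (1 / 2 : ℝ)).congr_fun fun r => ?_
      have h1 : (2 * ν r) • γ r = gᵀ * (c⁻¹ - f r) * g := by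
        rw [hγ, hf, two_mul_dampingHat_eq hm hc g (hpos r), freePropHat_eq hm hc (hpos r)]
      have h2 : ν r • (G r * γ r * ginv) = (1 / 2 : ℝ) • (G r * ((2 * ν r) • γ r) * ginv) := by
        rw [Matrix.mul_smul, Matrix.smul_mul, smul_smul]
        congr 1; ring
      rw [h2, h1]
      congr 1
      calc _ = G r * gᵀ * (c⁻¹ - f r) * (g * ginv) := by simp only [Matrix.mul_assoc]
        _ = _ := by rw [hg, Matrix.mul_one]
    refine ⟨h.summable, ?_⟩
    rw [h.tsum_eq, x12, smul_smul]
    congr 2; ring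
  · rw [p12, e5, q11, q12]
    have : M * (C⁻¹ * gᵀ * c⁻¹) * c = M * C⁻¹ * gᵀ := by
      calc _ = M * C⁻¹ * gᵀ * (c⁻¹ * c) := by simp only [Matrix.mul_assoc]
        _ = _ := by rw [nonsing_inv_mul _ hcu, Matrix.mul_one]
    simp only [Matrix.mul_add, Matrix.add_mul, Matrix.smul_mul, Matrix.mul_smul, this, smul_sub]
    abel
  · rw [e4.tsum_eq, p22, pE, smul_sub]
    abel
  · rw [e1.tsum_eq, e2.tsum_eq, e3.tsum_eq, q22, xE, q11]
    simp only [Matrix.mul_add, Matrix.add_mul, Matrix.smul_mul, Matrix.mul_smul, smul_sub,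
      smul_add, Matrix.mul_assoc]
    abel

end ClosedCorrelations

/-! ### Euler's product for the hyperbolic sine -/

section SinhProduct

open Filter Topology

/-- Euler's sine product at `iy`, multiplied by `-i` to return to the reals. -/
theorem tendsto_sinh_prod (y : ℝ) :
    Tendsto (fun n : ℕ => Real.pi * y * ∏ j ∈ Finset.range n, (1 + y ^ 2 / ((j : ℝ) + 1) ^ 2))
      atTop (𝓝 (Real.sinh (Real.pi * y))) := by
  have h := (Complex.tendsto_euler_sin_prod (y * Complex.I)).mul_const (-Complex.I)
  have e1 : Complex.sin (Real.pi * (y * Complex.I)) * -Complex.I =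
      ((Real.sinh (Real.pi * y) : ℝ) : ℂ) := by
    rw [← mul_assoc, Complex.sin_mul_I]
    push_cast
    linear_combination (-Complex.sinh (Real.pi * y)) * Complex.I_sq
  have e2 : ∀ n : ℕ, Real.pi * (y * Complex.I) *
      (∏ j ∈ Finset.range n, (1 - (y * Complex.I) ^ 2 / ((j : ℂ) + 1) ^ 2)) * -Complex.I =
      ((Real.pi * y * ∏ j ∈ Finset.range n, (1 + y ^ 2 / ((j : ℝ) + 1) ^ 2) : ℝ) : ℂ) := by
    intro n
    have : ∀ j : ℕ, (1 - (y * Complex.I) ^ 2 / ((j : ℂ) + 1) ^ 2) =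
        1 + (y : ℂ) ^ 2 / ((j : ℂ) + 1) ^ 2 := fun j => by
      rw [mul_pow, Complex.I_sq]; ring
    simp only [this]
    push_cast
    linear_combination (-(Real.pi * y * ∏ j ∈ Finset.range n,
      (1 + (y : ℂ) ^ 2 / ((j : ℂ) + 1) ^ 2))) * Complex.I_sq
  rw [e1] at h
  simp only [e2] at h
  have := (Complex.continuous_re.tendsto _).comp h
  simpa only [Function.comp_def, Complex.ofReal_re] using this

theorem hasSum_log_sinh {y : ℝ} (hy : 0 < y) :
    HasSum (fun j : ℕ => Real.log (1 + y ^ 2 / ((j : ℝ) + 1) ^ 2))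
      (Real.log (Real.sinh (Real.pi * y)) - Real.log (Real.pi * y)) := by
  have hpos : ∀ j : ℕ, 0 < 1 + y ^ 2 / ((j : ℝ) + 1) ^ 2 := fun j => by positivity
  refine (hasSum_iff_tendsto_nat_of_nonneg (fun j => Real.log_nonneg ?_) _).2 ?_
  · have : 0 ≤ y ^ 2 / ((j : ℝ) + 1) ^ 2 := by positivity
    linarith
  have hpy : 0 < Real.pi * y := mul_pos Real.pi_pos hy
  have h := ((Real.continuousAt_log (Real.sinh_pos_iff.2 hpy).ne').tendsto.comp
    (tendsto_sinh_prod y)).sub_const (Real.log (Real.pi * y))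
  refine h.congr fun n => ?_
  have hp : (∏ j ∈ Finset.range n, (1 + y ^ 2 / ((j : ℝ) + 1) ^ 2)) ≠ 0 :=
    Finset.prod_ne_zero_iff.2 fun j _ => (hpos j).ne'
  simp only [Function.comp_apply]
  rw [Real.log_mul hpy.ne' hp, Real.log_prod fun j _ => (hpos j).ne']
  ring

/-- Euler's product for the partition function of an oscillator. -/
theorem hasSum_log_two_mul_sinh {ħ β ω : ℝ} (hħ : 0 < ħ) (hβ : 0 < β) (hω : 0 < ω) :
    HasSum (fun r : ℕ => Real.log (1 + (matsubara ħ β (r + 1) ^ 2)⁻¹ * ω ^ 2))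
      (Real.log (2 * Real.sinh (β * ħ * ω / 2)) - 1 / 2 * Real.log ((β * ħ * ω) ^ 2)) := by
  have hpi := Real.pi_pos
  have hy : 0 < β * ħ * ω / (2 * Real.pi) := by positivity
  have h := hasSum_log_sinh hy
  have e : Real.pi * (β * ħ * ω / (2 * Real.pi)) = β * ħ * ω / 2 := by field_simp
  rw [e] at h
  have hs : 0 < Real.sinh (β * ħ * ω / 2) := Real.sinh_pos_iff.2 (by positivity)
  -- The logarithm is kept as half that of a square because `ω²`, unlike `ω`, is an eigenvalue of `K
  -- V` and so assembles into a determinant.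
  have e2 : Real.log (2 * Real.sinh (β * ħ * ω / 2)) - 1 / 2 * Real.log ((β * ħ * ω) ^ 2) =
      Real.log (Real.sinh (β * ħ * ω / 2)) - Real.log (β * ħ * ω / 2) := by
    rw [Real.log_mul two_ne_zero hs.ne', Real.log_pow, Real.log_div (by positivity) two_ne_zero]
    push_cast
    ring
  rw [e2]
  refine h.congr_fun fun r => ?_
  congr 2
  rw [matsubara]
  push_cast
  field_simp

end SinhProduct

/-! ### The partition function through determinants -/

section LogPartitionFunction

variable {ι : Type*} [Fintype ι] [DecidableEq ι] {K V : Matrix ι ι ℝ} {ħ β : ℝ}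

namespace NormalModes

variable {κ : Type*} [Fintype κ] [DecidableEq κ] (N : NormalModes κ K V)

theorem mul_eq_conj : K * V = N.S * diagonal (fun k => N.ω k ^ 2) * N.T := by
  refine (congrArg₂ (· * ·) N.eq_invMass N.eq_spring).trans ?_
  calc N.S * N.Sᵀ * (N.Tᵀ * diagonal (fun k => N.ω k ^ 2) * N.T) =
        N.S * (N.Sᵀ * N.Tᵀ) * diagonal (fun k => N.ω k ^ 2) * N.T := by
        simp only [Matrix.mul_assoc]
    _ = _ := by rw [N.S_transpose_mul_T_transpose, Matrix.mul_one]

theorem one_add_smul_mul_eq_conj (τ : ℝ) :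
    1 + τ • (K * V) = N.S * diagonal (fun k => 1 + τ * N.ω k ^ 2) * N.T := by
  have : diagonal (fun k => 1 + τ * N.ω k ^ 2) =
      (1 : Matrix κ κ ℝ) + τ • diagonal (fun k => N.ω k ^ 2) := by
    rw [← diagonal_one, ← diagonal_smul, diagonal_add]
    rfl
  rw [this, N.mul_eq_conj, Matrix.mul_add, Matrix.add_mul, Matrix.mul_one, N.S_mul_T,
    Matrix.mul_smul, Matrix.smul_mul]

theorem det_mul_eq : (K * V).det = ∏ k, N.ω k ^ 2 := by
  rw [N.mul_eq_conj, det_conj_of_mul_eq_one N.S_mul_T N.T_mul_S, det_diagonal]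

theorem det_one_add_smul_mul (τ : ℝ) : (1 + τ • (K * V)).det = ∏ k, (1 + τ * N.ω k ^ 2) := by
  rw [N.one_add_smul_mul_eq_conj, det_conj_of_mul_eq_one N.S_mul_T N.T_mul_S, det_diagonal]

end NormalModes

/-- The logarithm of the partition function in terms of determinants. -/
theorem hasSum_log_det {n : ℕ} (N : NormalModes (Fin n) K V) (hħ : 0 < ħ) (hβ : 0 < β) :
    HasSum (fun r : ℕ => Real.log (1 + (matsubara ħ β (r + 1) ^ 2)⁻¹ • (K * V)).det)
      (-Real.log (N.modeZ ħ β) -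
        1 / 2 * (n * Real.log ((β * ħ) ^ 2) + Real.log (K * V).det)) := by
  have hω := N.ω_pos
  have hs : ∀ k, 0 < 2 * Real.sinh (β * ħ * N.ω k / 2) := fun k => by
    have := hω k
    exact mul_pos two_pos (Real.sinh_pos_iff.2 (by positivity))
  have h := hasSum_sum fun k (_ : k ∈ Finset.univ) => hasSum_log_two_mul_sinh hħ hβ (hω k)
  have e1 : Real.log (N.modeZ ħ β) =
      -∑ k, Real.log (2 * Real.sinh (β * ħ * N.ω k / 2)) := by
    rw [NormalModes.modeZ, Real.log_prod fun k _ => (inv_pos.2 (hs k)).ne',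
      ← Finset.sum_neg_distrib]
    simp only [Real.log_inv]
  have e2 : n * Real.log ((β * ħ) ^ 2) + Real.log (K * V).det =
      ∑ k, Real.log ((β * ħ * N.ω k) ^ 2) := by
    have : ∀ k, Real.log ((β * ħ * N.ω k) ^ 2) =
        Real.log ((β * ħ) ^ 2) + Real.log (N.ω k ^ 2) := fun k => by
      rw [mul_pow, Real.log_mul (by positivity) (pow_ne_zero 2 (hω k).ne')]
    rw [N.det_mul_eq, Real.log_prod fun k _ => pow_ne_zero 2 (hω k).ne']
    simp only [this, Finset.sum_add_distrib, Finset.sum_const, Finset.card_univ, Fintype.card_fin,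
      nsmul_eq_mul]
  rw [e1, e2, neg_neg, Finset.mul_sum, ← Finset.sum_sub_distrib]
  refine h.congr_fun fun r => ?_
  rw [N.det_one_add_smul_mul, Real.log_prod fun k _ => ?_]
  have := hω k
  have hν : 0 ≤ (matsubara ħ β (r + 1) ^ 2)⁻¹ := by positivity
  positivity

end LogPartitionFunction

open Filter Topology

/-! ### Derivatives of determinants and openness of positive definiteness -/

section MatrixCalculus

variable {ι : Type*} [Fintype ι] [DecidableEq ι]

/-- Jacobi's formula. -/
theorem hasDerivAt_det {A : ℝ → Matrix ι ι ℝ} {A' : Matrix ι ι ℝ} {s : ℝ}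
    (h : ∀ i j, HasDerivAt (fun t => A t i j) (A' i j) s) :
    HasDerivAt (fun t => (A t).det) ((A s).adjugate * A').trace s := by
  have h1 : HasDerivAt (fun t => ∑ p : Equiv.Perm ι, ((p.sign : ℤ) : ℝ) * ∏ i, A t (p i) i)
      (∑ p : Equiv.Perm ι, ((p.sign : ℤ) : ℝ) *
        ∑ i, (∏ j ∈ Finset.univ.erase i, A s (p j) j) • A' (p i) i) s :=
    HasDerivAt.fun_sum fun p _ => (HasDerivAt.fun_finsetProd fun i _ => h (p i) i).const_mul _
  have e : ((A s).adjugate * A').trace = ∑ p : Equiv.Perm ι, ((p.sign : ℤ) : ℝ) *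
        ∑ i, (∏ j ∈ Finset.univ.erase i, A s (p j) j) • A' (p i) i := by
    -- Cramer's rule: a diagonal entry of `adj(A) A'` is the determinant of `A` with one column
    -- replaced by that of `A'`, as in the product rule.
    have h2 : ∀ i, ((A s).adjugate * A') i i = ((A s).updateCol i fun j => A' j i).det := by
      intro i
      rw [← cramer_apply, cramer_eq_adjugate_mulVec]
      rfl
    simp only [trace, diag_apply, h2, det_apply', Finset.mul_sum]
    rw [Finset.sum_comm]
    refine Finset.sum_congr rfl fun p _ => Finset.sum_congr rfl fun i _ => ?_
    rw [← Finset.prod_erase_mul _ _ (Finset.mem_univ i), smul_eq_mul]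
    congr 2
    · refine Finset.prod_congr rfl fun j hj => ?_
      rw [updateCol_ne (Finset.ne_of_mem_erase hj)]
    · rw [updateCol_self]
  rw [e]
  exact h1.congr_of_eventuallyEq (Eventually.of_forall fun t => det_apply' _)

theorem hasDerivAt_log_det {A : ℝ → Matrix ι ι ℝ} {A' : Matrix ι ι ℝ} {s : ℝ}
    (h : ∀ i j, HasDerivAt (fun t => A t i j) (A' i j) s) (hA : (A s).det ≠ 0) :
    HasDerivAt (fun t => Real.log (A t).det) ((A s)⁻¹ * A').trace s := by
  have := (hasDerivAt_det h).log hA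
  rwa [div_eq_inv_mul, ← smul_eq_mul, ← trace_smul, ← Matrix.smul_mul, ← Ring.inverse_eq_inv',
    ← inv_def] at this

omit [DecidableEq ι] in
theorem hasDerivAt_matrix_mul {a b : Type*} {A : ℝ → Matrix a ι ℝ} {B : ℝ → Matrix ι b ℝ}
    {A' : Matrix a ι ℝ} {B' : Matrix ι b ℝ} {s : ℝ}
    (hA : ∀ i j, HasDerivAt (fun t => A t i j) (A' i j) s)
    (hB : ∀ i j, HasDerivAt (fun t => B t i j) (B' i j) s) (i : a) (j : b) :
    HasDerivAt (fun t => (A t * B t) i j) ((A' * B s + A s * B') i j) s := by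
  simp only [Matrix.mul_apply, Matrix.add_apply, ← Finset.sum_add_distrib]
  exact HasDerivAt.fun_sum fun k _ => (hA i k).mul (hB k j)

omit [DecidableEq ι] in
/-- Positive definiteness is an open condition on symmetric matrices. -/
theorem eventually_posDef {A : ℝ → Matrix ι ι ℝ} (hA : ContinuousAt A 0)
    (hs : ∀ s, (A s).IsHermitian) (h0 : (A 0).PosDef) : ∀ᶠ s in 𝓝 0, (A s).PosDef := by
  have hK : IsCompact (Metric.sphere (0 : ι → ℝ) 1) := isCompact_sphere 0 1
  -- By compactness of the unit sphere one neighbourhood of `0` works for all unit vectors;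
  -- homogeneity then extends positivity to all nonzero vectors.
  have h : ∀ᶠ s in 𝓝 (0 : ℝ), ∀ x ∈ Metric.sphere (0 : ι → ℝ) 1, 0 < x ⬝ᵥ (A s *ᵥ x) := by
    refine hK.eventually_forall_of_forall_eventually fun x hx => ?_
    have hx0 : x ≠ 0 := by
      rintro rfl
      simp at hx
    have hc : ContinuousAt (fun p : ℝ × (ι → ℝ) => p.2 ⬝ᵥ (A p.1 *ᵥ p.2)) (0, x) := by
      have h1 : ContinuousAt (fun p : ℝ × (ι → ℝ) => A p.1) (0, x) :=
        ContinuousAt.comp (f := Prod.fst) hA continuousAt_fst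
      have h2 : Continuous fun q : Matrix ι ι ℝ × (ι → ℝ) => q.2 ⬝ᵥ (q.1 *ᵥ q.2) :=
        continuous_snd.dotProduct (continuous_fst.matrix_mulVec continuous_snd)
      exact h2.continuousAt.comp (h1.prodMk continuousAt_snd)
    have hp := h0.dotProduct_mulVec_pos hx0
    rw [star_trivial] at hp
    exact hc.eventually (lt_mem_nhds hp)
  filter_upwards [h] with s hs'
  refine PosDef.of_dotProduct_mulVec_pos (hs s) fun x hx => ?_
  have hn : 0 < ‖x‖ := norm_pos_iff.2 hx
  have := hs' (‖x‖⁻¹ • x) (by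
    rw [mem_sphere_zero_iff_norm, norm_smul, norm_inv, norm_norm, inv_mul_cancel₀ hn.ne'])
  rw [mulVec_smul, smul_dotProduct, dotProduct_smul, smul_smul] at this
  rw [star_trivial]
  exact pos_of_mul_pos_right (by simpa using this) (by positivity)

end MatrixCalculus

open Filter Topology

/-! ### Nonsymmetric matrices give the Hamiltonian of their symmetric parts -/

section Symmetrization

variable {ι : Type*} [Fintype ι] [DecidableEq ι]

/-- The symmetric part of a matrix. -/
def symmPart (A : Matrix ι ι ℝ) : Matrix ι ι ℝ := (1 / 2 : ℝ) • (A + Aᵀ)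

omit [Fintype ι] [DecidableEq ι] in
theorem isHermitian_symmPart (A : Matrix ι ι ℝ) : (symmPart A).IsHermitian := by
  rw [IsHermitian, conjTranspose_eq_transpose_of_trivial, symmPart, transpose_smul, transpose_add,
    transpose_transpose, add_comm]

omit [Fintype ι] [DecidableEq ι] in
theorem symmPart_of_transpose_eq {A : Matrix ι ι ℝ} (h : Aᵀ = A) : symmPart A = A := by
  rw [symmPart, h, ← two_smul ℝ A, smul_smul]; norm_num

omit [DecidableEq ι] in
theorem trace_mul_symmPart {Q : Matrix ι ι ℝ} (hQ : Qᵀ = Q) (A : Matrix ι ι ℝ) :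
    (Q * symmPart A).trace = (Q * A).trace := by
  have : (Q * Aᵀ).trace = (Q * A).trace := by
    rw [← trace_transpose, transpose_mul, transpose_transpose, hQ, trace_mul_comm]
  rw [symmPart, Matrix.mul_smul, Matrix.mul_add, trace_smul, trace_add, this, smul_eq_mul]
  ring

omit [DecidableEq ι] in
theorem sum_symmPart_smul {E : Type*} [AddCommGroup E] [Module ℂ E] (A : Matrix ι ι ℝ)
    {O : ι → ι → E} (hO : ∀ i j, O i j = O j i) :
    ∑ i, ∑ j, ((symmPart A i j : ℝ) : ℂ) • O i j = ∑ i, ∑ j, ((A i j : ℝ) : ℂ) • O i j := by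
  have h : ∑ i, ∑ j, ((A j i : ℝ) : ℂ) • O i j = ∑ i, ∑ j, ((A i j : ℝ) : ℂ) • O i j := by
    rw [Finset.sum_comm]
    exact Finset.sum_congr rfl fun i _ => Finset.sum_congr rfl fun j _ => by rw [hO j i]
  have e : ∀ i j, ((symmPart A i j : ℝ) : ℂ) • O i j =
      (1 / 2 : ℂ) • (((A i j : ℝ) : ℂ) • O i j) + (1 / 2 : ℂ) • (((A j i : ℝ) : ℂ) • O i j) := by
    intro i j
    rw [← smul_add, ← add_smul, smul_smul, symmPart, Matrix.smul_apply, Matrix.add_apply,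
      transpose_apply]
    congr 1
    push_cast [smul_eq_mul]
    ring
  simp only [e, Finset.sum_add_distrib, ← Finset.smul_sum, h]
  rw [← add_smul]
  norm_num

/-- Positions commute among themselves, and so do momenta, so antisymmetric parts cancel in the
double sums. -/
theorem hamiltonian_symmPart (ħ : ℝ) (K V : Matrix ι ι ℝ) :
    hamiltonian ħ K V = hamiltonian ħ (symmPart K) (symmPart V) := by
  rw [hamiltonian, hamiltonian, sum_symmPart_smul K fun i j => momOp_comm ħ i j,
    sum_symmPart_smul V fun i j => posOp_comm i j]

end Symmetrization

/-! ### Term-by-term differentiation of the logarithm of the partition function -/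

section Derivative

variable {ι : Type*} [Fintype ι] [DecidableEq ι] {ħ β : ℝ}

theorem summable_inv_matsubara_sq (ħ β : ℝ) :
    Summable fun r : ℕ => (matsubara ħ β (r + 1) ^ 2)⁻¹ := by
  have h := ((summable_nat_add_iff 1).2
    (Real.summable_one_div_nat_pow.2 (le_refl 2))).mul_left ((2 * Real.pi / (ħ * β)) ^ 2)⁻¹
  refine h.congr fun r => ?_
  rw [matsubara, one_div, ← mul_inv, ← mul_pow]
  push_cast
  congr 2
  ring

theorem inv_matsubara_sq_le (hħ : 0 < ħ) (hβ : 0 < β) (r : ℕ) :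
    (matsubara ħ β (r + 1) ^ 2)⁻¹ ≤ (matsubara ħ β 1 ^ 2)⁻¹ := by
  have h1 : 0 < matsubara ħ β 1 := by simpa using matsubara_succ_pos hħ hβ 0
  have h2 : matsubara ħ β 1 ≤ matsubara ħ β (r + 1) := by
    rw [matsubara, matsubara]
    have := Real.pi_pos
    gcongr
    omega
  gcongr

theorem det_one_add_smul_mul_pos {K V : Matrix ι ι ℝ} (hK : K.PosDef) (hV : V.PosDef) {τ : ℝ}
    (hτ : 0 ≤ τ) : 0 < (1 + τ • (K * V)).det := by
  obtain ⟨N⟩ := exists_finNormalModes hK hV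
  rw [N.det_one_add_smul_mul]
  exact Finset.prod_pos fun k _ => by positivity

/-- The logarithmic derivative of `det (1 + τ X s)` in `s`, divided by `τ`. -/
def logDetDeriv (X X' : ℝ → Matrix ι ι ℝ) (s τ : ℝ) : ℝ :=
  (1 + τ • X s).det⁻¹ * ((1 + τ • X s).adjugate * X' s).trace

theorem trace_inv_mul_eq_logDetDeriv (X X' : ℝ → Matrix ι ι ℝ) (s τ : ℝ) :
    ((1 + τ • X s)⁻¹ * (τ • X' s)).trace = τ * logDetDeriv X X' s τ := by
  rw [Matrix.mul_smul, trace_smul, inv_def, Ring.inverse_eq_inv', Matrix.smul_mul, trace_smul,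
    smul_eq_mul, smul_eq_mul, logDetDeriv]

omit [Fintype ι] in
theorem continuousAt_one_add_smul {X : ℝ → Matrix ι ι ℝ} (hX : ContinuousAt X 0) (t : ℝ) :
    ContinuousAt (fun p : ℝ × ℝ => 1 + p.2 • X p.1) (0, t) := by
  have h : ContinuousAt (fun p : ℝ × ℝ => X p.1) (0, t) :=
    ContinuousAt.comp (f := Prod.fst) (x := ((0 : ℝ), t)) hX continuousAt_fst
  exact continuousAt_const.add (continuousAt_snd.smul h)

theorem continuousAt_det_one_add_smul {X : ℝ → Matrix ι ι ℝ} (hX : ContinuousAt X 0) (t : ℝ) :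
    ContinuousAt (fun p : ℝ × ℝ => (1 + p.2 • X p.1).det) (0, t) :=
  ContinuousAt.comp (g := fun A : Matrix ι ι ℝ => A.det)
    (continuous_id.matrix_det.continuousAt) (continuousAt_one_add_smul hX t)

theorem continuousAt_logDetDeriv {X X' : ℝ → Matrix ι ι ℝ} (hX : ContinuousAt X 0)
    (hX' : ContinuousAt X' 0) {t : ℝ} (ht : (1 + t • X 0).det ≠ 0) :
    ContinuousAt (fun p : ℝ × ℝ => logDetDeriv X X' p.1 p.2) (0, t) := by
  have h1 : Continuous fun q : Matrix ι ι ℝ × Matrix ι ι ℝ => (q.1.adjugate * q.2).trace :=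
    (continuous_fst.matrix_adjugate.matrix_mul continuous_snd).matrix_trace
  have h2 : ContinuousAt (fun p : ℝ × ℝ => X' p.1) (0, t) :=
    ContinuousAt.comp (f := Prod.fst) (x := ((0 : ℝ), t)) hX' continuousAt_fst
  have h3 : ContinuousAt (fun p : ℝ × ℝ => (1 + p.2 • X p.1, X' p.1)) (0, t) :=
    (continuousAt_one_add_smul hX t).prodMk h2
  have h4 := ContinuousAt.comp
    (g := fun q : Matrix ι ι ℝ × Matrix ι ι ℝ => (q.1.adjugate * q.2).trace)
    (f := fun p : ℝ × ℝ => (1 + p.2 • X p.1, X' p.1)) h1.continuousAt h3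
  exact ((continuousAt_det_one_add_smul hX t).inv₀ ht).mul h4

/-- With the factor `τ` removed, the logarithmic derivative is continuous down to `τ = 0`.
Compactness of `[0, T]` therefore gives one bound and one neighbourhood of `s = 0` for all Matsubara
frequencies. -/
theorem exists_logDetDeriv_bound {X X' : ℝ → Matrix ι ι ℝ} (hX : ContinuousAt X 0)
    (hX' : ContinuousAt X' 0) (hdet : ∀ τ : ℝ, 0 ≤ τ → 0 < (1 + τ • X 0).det) (T : ℝ) :
    ∃ B : ℝ, ∀ᶠ s in 𝓝 (0 : ℝ), ∀ t ∈ Set.Icc 0 T,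
      0 < (1 + t • X s).det ∧ ‖logDetDeriv X X' s t‖ < B := by
  have hK : IsCompact (Set.Icc 0 T) := isCompact_Icc
  have hFc : ∀ t ∈ Set.Icc 0 T,
      ContinuousAt (fun p : ℝ × ℝ => logDetDeriv X X' p.1 p.2) (0, t) := fun t ht =>
    continuousAt_logDetDeriv hX hX' (hdet t ht.1).ne'
  have hFc' : ContinuousOn (fun t => logDetDeriv X X' 0 t) (Set.Icc 0 T) := fun t ht => by
    have := ContinuousAt.comp (f := fun t : ℝ => ((0 : ℝ), t)) (x := t) (hFc t ht) (by fun_prop)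
    exact this.continuousWithinAt
  obtain ⟨B, hB⟩ := hK.exists_bound_of_continuousOn hFc'
  refine ⟨B + 1, hK.eventually_forall_of_forall_eventually fun t ht => ?_⟩
  have h1 := (continuousAt_det_one_add_smul hX t).eventually (lt_mem_nhds (hdet t ht.1))
  have h2 := (hFc t ht).norm.eventually (gt_mem_nhds ((hB t ht).trans_lt (lt_add_one B)))
  exact h1.and h2

/-- Near `0` the derivative of the `r`-th term is at most `τ r * B`, a summable majorant independent
of `s`. -/
theorem hasDerivAt_tsum_log_det {τ : ℕ → ℝ} {T : ℝ} (hτ : ∀ r, τ r ∈ Set.Icc 0 T)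
    (hτs : Summable τ) {X X' : ℝ → Matrix ι ι ℝ}
    (hX : ∀ᶠ s in 𝓝 0, ∀ i j, HasDerivAt (fun t => X t i j) (X' s i j) s)
    (hX' : ContinuousAt X' 0) (hdet : ∀ τ : ℝ, 0 ≤ τ → 0 < (1 + τ • X 0).det)
    (hsum : Summable fun r => Real.log (1 + τ r • X 0).det) :
    HasDerivAt (fun s => ∑' r, Real.log (1 + τ r • X s).det)
      (∑' r, ((1 + τ r • X 0)⁻¹ * (τ r • X' 0)).trace) 0 := by
  have hXc : ContinuousAt X 0 := continuousAt_pi.2 fun i => continuousAt_pi.2 fun j =>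
    (hX.self_of_nhds i j).continuousAt
  obtain ⟨B, hB⟩ := exists_logDetDeriv_bound hXc hX' hdet T
  obtain ⟨δ, hδ, hball⟩ := Metric.eventually_nhds_iff_ball.1 (hB.and hX)
  have hu : Summable fun r => τ r * B := hτs.mul_right B
  have hd : ∀ r, ∀ s ∈ Metric.ball (0 : ℝ) δ,
      HasDerivAt (fun s => Real.log (1 + τ r • X s).det)
        (((1 + τ r • X s)⁻¹ * (τ r • X' s)).trace) s := fun r s hs => by
    refine hasDerivAt_log_det (A := fun s => 1 + τ r • X s) (fun i j => ?_)
      ((hball s hs).1 _ (hτ r)).1.ne'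
    simp only [Matrix.add_apply, Matrix.smul_apply]
    exact (((hball s hs).2 i j).const_smul (τ r)).const_add _
  have hb : ∀ r, ∀ s ∈ Metric.ball (0 : ℝ) δ,
      ‖((1 + τ r • X s)⁻¹ * (τ r • X' s)).trace‖ ≤ τ r * B := fun r s hs => by
    rw [trace_inv_mul_eq_logDetDeriv, norm_mul, Real.norm_of_nonneg (hτ r).1]
    exact mul_le_mul_of_nonneg_left ((hball s hs).1 _ (hτ r)).2.le (hτ r).1
  exact hasDerivAt_tsum_of_isPreconnected hu Metric.isOpen_ball
    (convex_ball (0 : ℝ) δ).isPreconnected hd hb (Metric.mem_ball_self hδ) hsum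
    (Metric.mem_ball_self hδ)

theorem trace_inv_mul_eq {K V : Matrix ι ι ℝ} (hK : K.PosDef) (hV : V.PosDef)
    (K' V' : Matrix ι ι ℝ) :
    ((K * V)⁻¹ * (K' * V + K * V')).trace = (V⁻¹ * V').trace + (K⁻¹ * K').trace := by
  have hKu := isUnit_det_of_posDef hK
  have hVu := isUnit_det_of_posDef hV
  rw [Matrix.mul_inv_rev, Matrix.mul_add, trace_add, add_comm]
  congr 1
  · rw [Matrix.mul_assoc, ← Matrix.mul_assoc K⁻¹, nonsing_inv_mul _ hKu, Matrix.one_mul]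
  · rw [← Matrix.mul_assoc, trace_mul_comm, ← Matrix.mul_assoc, ← Matrix.mul_assoc,
      mul_nonsing_inv _ hVu, Matrix.one_mul]

/-- With `R = (z² K⁻¹ + V)⁻¹` the left inverse is `z² R K⁻¹`. Varying `V` leaves `R`; varying `K`
leaves, by cyclicity of the trace and `V R = 1 - z² K⁻¹ R`, the momentum resolvent. -/
theorem trace_resolvent_eq {K V : Matrix ι ι ℝ} (hK : K.PosDef) (hV : V.PosDef)
    (K' V' : Matrix ι ι ℝ) {z : ℝ} (hz : 0 < z) :
    ((1 + (z ^ 2)⁻¹ • (K * V))⁻¹ * ((z ^ 2)⁻¹ • (K' * V + K * V'))).trace =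
      ((z ^ 2 • K⁻¹ + V)⁻¹ * V').trace +
        ((K⁻¹ - z ^ 2 • (K⁻¹ * (z ^ 2 • K⁻¹ + V)⁻¹ * K⁻¹)) * K').trace := by
  have hKu := isUnit_det_of_posDef hK
  have hRu := isUnit_det_of_posDef (posDef_sq_smul_add hK.inv hV z)
  set R := (z ^ 2 • K⁻¹ + V)⁻¹ with hR
  have h1 : R * (z ^ 2 • K⁻¹ + V) = 1 := nonsing_inv_mul _ hRu
  have h2 : (z ^ 2 • K⁻¹ + V) * R = 1 := mul_nonsing_inv _ hRu
  have h3 : V * R = 1 - z ^ 2 • (K⁻¹ * R) := by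
    rw [← h2, Matrix.add_mul, Matrix.smul_mul, add_sub_cancel_left]
  have hz2 : (z ^ 2)⁻¹ * z ^ 2 = 1 := inv_mul_cancel₀ (by positivity)
  have h4 : (1 + (z ^ 2)⁻¹ • (K * V))⁻¹ = z ^ 2 • (R * K⁻¹) := by
    refine inv_eq_left_inv ?_
    rw [Matrix.mul_add, Matrix.mul_one, Matrix.smul_mul, Matrix.mul_smul, smul_smul,
      mul_comm (z ^ 2), hz2, one_smul, Matrix.mul_assoc R, ← Matrix.mul_assoc K⁻¹,
      nonsing_inv_mul _ hKu, Matrix.one_mul, ← h1, Matrix.mul_add, Matrix.mul_smul]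
  rw [h4, Matrix.mul_smul, Matrix.smul_mul, smul_smul, hz2, one_smul, Matrix.mul_add, trace_add,
    add_comm]
  congr 1
  · rw [Matrix.mul_assoc, ← Matrix.mul_assoc K⁻¹, nonsing_inv_mul _ hKu, Matrix.one_mul]
  · rw [← Matrix.mul_assoc, trace_mul_comm, ← Matrix.mul_assoc, ← Matrix.mul_assoc, h3,
      Matrix.sub_mul, Matrix.one_mul, Matrix.smul_mul]

omit [DecidableEq ι] in
theorem hasSum_trace_mul {α : Type*} {F : α → Matrix ι ι ℝ} {S : Matrix ι ι ℝ} (h : HasSum F S)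
    (A : Matrix ι ι ℝ) : HasSum (fun r => (F r * A).trace) (S * A).trace :=
  h.map (AddMonoidHom.mk' (fun X : Matrix ι ι ℝ => (X * A).trace)
    fun X Y => by rw [Matrix.add_mul, trace_add])
    ((continuous_id.matrix_mul continuous_const).matrix_trace)

theorem transpose_posCorrelation (hħ : 0 < ħ) (hβ : 0 < β) {K V : Matrix ι ι ℝ} (hK : K.PosDef)
    (hV : V.PosDef) : (posCorrelation ħ β K V)ᵀ = posCorrelation ħ β K V := by
  obtain ⟨N⟩ := exists_finNormalModes hK hV
  rw [posCorrelation, ← N.position_correlation_eq hħ hβ]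
  simp only [transpose_mul, transpose_transpose, diagonal_transpose, Matrix.mul_assoc]

theorem transpose_momCorrelation (hħ : 0 < ħ) (hβ : 0 < β) {K V : Matrix ι ι ℝ} (hK : K.PosDef)
    (hV : V.PosDef) : (momCorrelation ħ β K V)ᵀ = momCorrelation ħ β K V := by
  obtain ⟨N⟩ := exists_finNormalModes hK hV
  rw [momCorrelation, ← N.momentum_correlation_eq hħ hβ]
  simp only [transpose_mul, transpose_transpose, diagonal_transpose, Matrix.mul_assoc]

theorem eventually_hasDerivAt_of_contDiffAt {f : ℝ → ℝ} (hf : ContDiffAt ℝ 1 f 0) :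
    (∀ᶠ s in 𝓝 0, HasDerivAt f (deriv f s) s) ∧ ContinuousAt (deriv f) 0 := by
  refine ⟨(hf.eventually (by simp)).mono fun s hs =>
    (hs.differentiableAt one_ne_zero).hasDerivAt, ?_⟩
  have h := hf.continuousAt_fderiv one_ne_zero
  have h1 : ContinuousAt (fun s => fderiv ℝ f s 1) 0 := h.clm_apply continuousAt_const
  exact h1

/-- First order perturbation theory for the free energy of symmetric coupled oscillators. -/
theorem hasDerivAt_log_partitionFunction_of_symm (hħ : 0 < ħ) (hβ : 0 < β)
    {K V : ℝ → Matrix ι ι ℝ} {K' V' : Matrix ι ι ℝ} (hKs : ∀ s, (K s).IsHermitian)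
    (hVs : ∀ s, (V s).IsHermitian) (hK0 : (K 0).PosDef) (hV0 : (V 0).PosDef)
    (hKc : ∀ i j, ContDiffAt ℝ 1 (fun s => K s i j) 0)
    (hVc : ∀ i j, ContDiffAt ℝ 1 (fun s => V s i j) 0)
    (hK : ∀ i j, HasDerivAt (fun s => K s i j) (K' i j) 0)
    (hV : ∀ i j, HasDerivAt (fun s => V s i j) (V' i j) 0) :
    HasDerivAt (fun s => Real.log (partitionFunction ħ β (K s) (V s)))
      (-(β / 2) * ((posCorrelation ħ β (K 0) (V 0) * V').trace +
        (momCorrelation ħ β (K 0) (V 0) * K').trace)) 0 := by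
  have cK : ContinuousAt K 0 := continuousAt_pi.2 fun i => continuousAt_pi.2 fun j =>
    (hKc i j).continuousAt
  have cV : ContinuousAt V 0 := continuousAt_pi.2 fun i => continuousAt_pi.2 fun j =>
    (hVc i j).continuousAt
  set X : ℝ → Matrix ι ι ℝ := fun s => K s * V s with hXdef
  have hXc : ∀ i j, ContDiffAt ℝ 1 (fun s => X s i j) 0 := fun i j => by
    simp only [hXdef, Matrix.mul_apply]
    exact ContDiffAt.sum fun k _ => (hKc i k).mul (hVc k j)
  let X' : ℝ → Matrix ι ι ℝ := fun s i j => deriv (fun t => X t i j) s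
  have hX0 : X' 0 = K' * V 0 + K 0 * V' := by
    ext i j
    exact (hasDerivAt_matrix_mul hK hV i j).deriv
  have hXd : ∀ᶠ s in 𝓝 0, ∀ i j, HasDerivAt (fun t => X t i j) (X' s i j) s :=
    eventually_all.2 fun i => eventually_all.2 fun j => (eventually_hasDerivAt_of_contDiffAt (hXc i j)).1
  have hX'c : ContinuousAt X' 0 := continuousAt_pi.2 fun i => continuousAt_pi.2 fun j =>
    (eventually_hasDerivAt_of_contDiffAt (hXc i j)).2
  -- The determinant formula is available only where both matrices stay positive definite, which
  -- holds near `0`.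
  have hlog : ∀ᶠ s in 𝓝 0, Real.log (partitionFunction ħ β (K s) (V s)) =
      -(∑' r : ℕ, Real.log (1 + (matsubara ħ β (r + 1) ^ 2)⁻¹ • X s).det) -
        1 / 2 * (Fintype.card ι * Real.log ((β * ħ) ^ 2) + Real.log (X s).det) := by
    filter_upwards [eventually_posDef cK hKs hK0, eventually_posDef cV hVs hV0] with s h1 h2
    obtain ⟨N⟩ := exists_finNormalModes h1 h2
    rw [N.partitionFunction_eq hħ hβ rfl, (hasSum_log_det N hħ hβ).tsum_eq]
    ring
  have hdet : ∀ τ : ℝ, 0 ≤ τ → 0 < (1 + τ • X 0).det := fun τ hτ =>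
    det_one_add_smul_mul_pos hK0 hV0 hτ
  obtain ⟨N⟩ := exists_finNormalModes hK0 hV0
  have hsum := (hasSum_log_det N hħ hβ).summable
  -- The numbers `ν_r⁻²` lie in a compact interval because the first is the largest.
  have hD := hasDerivAt_tsum_log_det (T := (matsubara ħ β 1 ^ 2)⁻¹)
    (fun r => ⟨by positivity, inv_matsubara_sq_le hħ hβ r⟩) (summable_inv_matsubara_sq ħ β)
    hXd hX'c hdet hsum
  have hdet0 : (X 0).det ≠ 0 := by
    rw [hXdef, det_mul]
    exact mul_ne_zero hK0.det_pos.ne' hV0.det_pos.ne'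
  have hD2 := hasDerivAt_log_det hXd.self_of_nhds hdet0
  have hQ := hasSum_trace_mul (N.summable_resolvent hħ hβ).hasSum V'
  have hP := hasSum_trace_mul (N.summable_momentum_resolvent hħ hβ).hasSum K'
  -- The derivatives of the determinants are identified term by term with the Matsubara terms of
  -- both correlation matrices.
  have hS := (hQ.add hP).tsum_eq
  simp only [← trace_resolvent_eq hK0 hV0 K' V' (matsubara_succ_pos hħ hβ _)] at hS
  rw [hX0] at hD hD2
  rw [trace_inv_mul_eq hK0 hV0] at hD2
  have hfin := hD.neg.sub ((hD2.const_add
    (Fintype.card ι * Real.log ((β * ħ) ^ 2))).const_mul (1 / 2))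
  refine (hfin.congr_of_eventuallyEq hlog).congr_deriv ?_
  rw [hS, posCorrelation, momCorrelation]
  simp only [Matrix.add_mul, trace_add, Matrix.smul_mul, trace_smul, smul_eq_mul]
  field_simp
  ring

end Derivative

open Filter Topology

/-! ### First-order perturbation without symmetry -/

section Perturbation

variable {ι : Type*} [Fintype ι] [DecidableEq ι] {ħ β : ℝ}

/-- First order perturbation theory for the free energy of coupled oscillators. Only the symmetric
parts of the perturbed matrices matter. -/
theorem hasDerivAt_log_partitionFunction (hħ : 0 < ħ) (hβ : 0 < β)
    {K V : ℝ → Matrix ι ι ℝ} {K' V' : Matrix ι ι ℝ} (hK0 : (K 0).PosDef) (hV0 : (V 0).PosDef)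
    (hKc : ∀ i j, ContDiffAt ℝ 1 (fun s => K s i j) 0)
    (hVc : ∀ i j, ContDiffAt ℝ 1 (fun s => V s i j) 0)
    (hK : ∀ i j, HasDerivAt (fun s => K s i j) (K' i j) 0)
    (hV : ∀ i j, HasDerivAt (fun s => V s i j) (V' i j) 0) :
    HasDerivAt (fun s => Real.log (partitionFunction ħ β (K s) (V s)))
      (-(β / 2) * ((posCorrelation ħ β (K 0) (V 0) * V').trace +
        (momCorrelation ħ β (K 0) (V 0) * K').trace)) 0 := by
  have hc : ∀ {A : ℝ → Matrix ι ι ℝ}, (∀ i j, ContDiffAt ℝ 1 (fun s => A s i j) 0) →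
      ∀ i j, ContDiffAt ℝ 1 (fun s => symmPart (A s) i j) 0 := fun h i j =>
    contDiffAt_const.mul ((h i j).add (h j i))
  have hd : ∀ {A : ℝ → Matrix ι ι ℝ} {A' : Matrix ι ι ℝ},
      (∀ i j, HasDerivAt (fun s => A s i j) (A' i j) 0) →
      ∀ i j, HasDerivAt (fun s => symmPart (A s) i j) (symmPart A' i j) 0 := fun h i j =>
    ((h i j).add (h j i)).const_mul _
  have hcont : ∀ {A : ℝ → Matrix ι ι ℝ}, (∀ i j, ContDiffAt ℝ 1 (fun s => A s i j) 0) →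
      ContinuousAt (fun s => symmPart (A s)) 0 := fun h =>
    continuousAt_pi.2 fun i => continuousAt_pi.2 fun j => (hc h i j).continuousAt
  have eK := symmPart_of_transpose_eq (transpose_of_posDef hK0)
  have eV := symmPart_of_transpose_eq (transpose_of_posDef hV0)
  have h := hasDerivAt_log_partitionFunction_of_symm hħ hβ (K := fun s => symmPart (K s))
    (V := fun s => symmPart (V s)) (fun s => isHermitian_symmPart _)
    (fun s => isHermitian_symmPart _) (by rwa [eK]) (by rwa [eV]) (hc hKc) (hc hVc) (hd hK) (hd hV)
  rw [eK, eV, trace_mul_symmPart (transpose_posCorrelation hħ hβ hK0 hV0),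
    trace_mul_symmPart (transpose_momCorrelation hħ hβ hK0 hV0)] at h
  -- Symmetrizing leaves the Hamiltonian unchanged, so near `0` the partition function is that of
  -- the symmetric parts; the traces agree because the correlation matrices are symmetric.
  refine h.congr_of_eventuallyEq ?_
  filter_upwards [eventually_posDef (hcont hKc) (fun s => isHermitian_symmPart _) (by rwa [eK]),
    eventually_posDef (hcont hVc) (fun s => isHermitian_symmPart _) (by rwa [eV])] with s h1 h2
  obtain ⟨N⟩ := exists_finNormalModes h1 h2
  rw [N.partitionFunction_eq hħ hβ (hamiltonian_symmPart ħ (K s) (V s)),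
    N.partitionFunction_eq hħ hβ rfl]

/-- This shape covers all five variations: linear ones with `θ = 0`, the coupling with `θ = s²`, and
the reservoir springs with the rational `θ` of the rank-one inverse. The last holds only near `0`,
hence the eventual equality for `V`. -/
theorem hasDerivAt_log_partitionFunction_of_expansion (hħ : 0 < ħ) (hβ : 0 < β)
    {K V : ℝ → Matrix ι ι ℝ} {K₀ V₀ K₁ V₁ V₂ : Matrix ι ι ℝ} {θ : ℝ → ℝ} {t : ℝ}
    (hK₀ : K₀.PosDef) (hV₀ : V₀.PosDef) (hθc : ContDiffAt ℝ 1 θ 0) (hθ0 : θ 0 = 0)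
    (hθ : HasDerivAt θ t 0) (hK : ∀ s, K s = K₀ + s • K₁)
    (hV : ∀ᶠ s in 𝓝 0, V s = V₀ + s • V₁ + θ s • V₂) :
    HasDerivAt (fun s => Real.log (partitionFunction ħ β (K s) (V s)))
      (-(β / 2) * ((posCorrelation ħ β K₀ V₀ * (V₁ + t • V₂)).trace +
        (momCorrelation ħ β K₀ V₀ * K₁).trace)) 0 := by
  have h := hasDerivAt_log_partitionFunction hħ hβ (K := fun s => K₀ + s • K₁)
    (V := fun s => V₀ + s • V₁ + θ s • V₂) (K' := K₁) (V' := V₁ + t • V₂) (by simpa using hK₀)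
    (by simpa [hθ0] using hV₀)
    (fun i j => contDiffAt_const.add (contDiffAt_id.mul contDiffAt_const))
    (fun i j => (contDiffAt_const.add (contDiffAt_id.mul contDiffAt_const)).add
      (hθc.mul contDiffAt_const))
    (fun i j => by
      simpa using! ((hasDerivAt_id (0 : ℝ)).mul_const (K₁ i j)).const_add (K₀ i j))
    (fun i j => by
      simpa using! (((hasDerivAt_id (0 : ℝ)).mul_const (V₁ i j)).const_add (V₀ i j)).add
        (hθ.mul_const (V₂ i j)))
  simp only [zero_smul, add_zero, hθ0] at h
  refine h.congr_of_eventuallyEq ?_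
  filter_upwards [hV] with s hs
  rw [hK, hs]

end Perturbation

/-! ### Partial derivatives with respect to the model matrices -/

section ClosedPerturbation

variable {σ ε : Type*} [Fintype σ] [DecidableEq σ] [Fintype ε] [DecidableEq ε]
  {M C : Matrix σ σ ℝ} {m c : Matrix ε ε ℝ} {ħ β : ℝ}

omit [DecidableEq σ] [DecidableEq ε] in
theorem trace_mul_fromBlocks (Q : Matrix (σ ⊕ ε) (σ ⊕ ε) ℝ) (A : Matrix σ σ ℝ) (B : Matrix σ ε ℝ)
    (C : Matrix ε σ ℝ) (D : Matrix ε ε ℝ) :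
    (Q * fromBlocks A B C D).trace = (Q.toBlocks₁₁ * A).trace + (Q.toBlocks₁₂ * C).trace +
      ((Q.toBlocks₂₁ * B).trace + (Q.toBlocks₂₂ * D).trace) := by
  conv_lhs => rw [← fromBlocks_toBlocks Q]
  rw [fromBlocks_multiply, trace, Fintype.sum_sum_type]
  simp [trace, Finset.sum_add_distrib]

omit [DecidableEq σ] [DecidableEq ε] in
theorem trace_mul_single_one {a b : Type*} [Fintype a] [Fintype b] [DecidableEq a] [DecidableEq b]
    (A : Matrix a b ℝ) (i : b) (j : a) : (A * Matrix.single i j (1 : ℝ)).trace = A j i := by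
  rw [trace_mul_single]; simp

theorem single_eq_smul {a b : Type*} [DecidableEq a] [DecidableEq b] (i : a) (j : b) (s : ℝ) :
    Matrix.single i j s = s • Matrix.single i j (1 : ℝ) := by
  rw [smul_single, smul_eq_mul, mul_one]

/-- The Sherman–Morrison formula for a perturbation in one entry. -/
theorem inv_add_single {c : Matrix ε ε ℝ} (hc : IsUnit c.det) (a b : ε) {s : ℝ}
    (hs : 1 + s * c⁻¹ b a ≠ 0) : (c + Matrix.single a b s)⁻¹ =
      c⁻¹ - (s / (1 + s * c⁻¹ b a)) • (c⁻¹ * Matrix.single a b (1 : ℝ) * c⁻¹) := by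
  refine inv_eq_right_inv ?_
  have h1 : Matrix.single a b (1 : ℝ) * (c⁻¹ * Matrix.single a b (1 : ℝ) * c⁻¹) =
      c⁻¹ b a • (Matrix.single a b (1 : ℝ) * c⁻¹) := by
    rw [← Matrix.mul_assoc, ← Matrix.mul_assoc, single_mul_mul_single, one_mul, mul_one,
      single_eq_smul, Matrix.smul_mul]
  have h2 : c * (c⁻¹ * Matrix.single a b (1 : ℝ) * c⁻¹) = Matrix.single a b (1 : ℝ) * c⁻¹ := by
    rw [← Matrix.mul_assoc, ← Matrix.mul_assoc, mul_nonsing_inv _ hc, Matrix.one_mul]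
  rw [single_eq_smul a b s, Matrix.add_mul, Matrix.mul_sub, Matrix.mul_sub, mul_nonsing_inv _ hc,
    Matrix.mul_smul, Matrix.mul_smul, h2, Matrix.smul_mul, Matrix.smul_mul, h1]
  have h3 : s - s / (1 + s * c⁻¹ b a) - s / (1 + s * c⁻¹ b a) * (s * c⁻¹ b a) = 0 := by
    field_simp; ring
  generalize Matrix.single a b (1 : ℝ) * c⁻¹ = Y at *
  generalize s / (1 + s * c⁻¹ b a) = q at *
  have h4 : (s - q - q * (s * c⁻¹ b a)) • Y = 0 := by rw [h3, zero_smul]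
  linear_combination (norm := module) h4

/-- Varying the entry `(A, B)` picks out the entry `(B, A)` of the correlation matrix in the trace;
symmetry exchanges the indices. -/
theorem hasDerivAt_log_closedZ_spring (hħ : 0 < ħ) (hβ : 0 < β) (hM : M.PosDef) (hC : C.PosDef)
    (hm : m.PosDef) (hc : c.PosDef) (g : Matrix ε σ ℝ) {Q : Matrix (σ ⊕ ε) (σ ⊕ ε) ℝ}
    (hQ : Q = posCorrelation ħ β (closedInvMass M⁻¹ m⁻¹) (closedSpring C c g)) (A B : σ) :
    HasDerivAt (fun s : ℝ => Real.log (closedZ ħ β (C + Matrix.single A B s) M⁻¹ c m⁻¹ g))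
      (-(β / 2) * Q.toBlocks₁₁ A B) 0 := by
  have hs : Qᵀ = Q := by
    rw [hQ, transpose_posCorrelation hħ hβ (posDef_closedInvMass hM hm)
      (posDef_closedSpring hC hc g)]
  have h := hasDerivAt_log_partitionFunction_of_expansion hħ hβ (posDef_closedInvMass hM hm)
    (posDef_closedSpring hC hc g) (K := fun _ => closedInvMass M⁻¹ m⁻¹) (K₁ := 0)
    (V := fun s => closedSpring (C + Matrix.single A B s) c g)
    (V₁ := fromBlocks (Matrix.single A B 1) 0 0 0) (V₂ := 0) (θ := fun _ => 0) (t := 0)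
    contDiffAt_const rfl (hasDerivAt_const _ _) (fun s => by simp) (Eventually.of_forall fun s => by
      rw [closedSpring, closedSpring, fromBlocks_smul, fromBlocks_add, single_eq_smul A B s]
      simp only [smul_zero, add_zero]
      congr 1
      abel)
  rw [← hQ, smul_zero, add_zero, Matrix.mul_zero, trace_zero, add_zero, trace_mul_fromBlocks,
    trace_mul_single_one] at h
  simp only [Matrix.mul_zero, trace_zero, add_zero] at h
  have e : Q.toBlocks₁₁ B A = Q.toBlocks₁₁ A B := congrFun₂ hs (Sum.inl A) (Sum.inl B)
  rwa [e] at h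

theorem hasDerivAt_log_closedZ_coupling (hħ : 0 < ħ) (hβ : 0 < β) (hM : M.PosDef) (hC : C.PosDef)
    (hm : m.PosDef) (hc : c.PosDef) (g : Matrix ε σ ℝ) {Q : Matrix (σ ⊕ ε) (σ ⊕ ε) ℝ}
    (hQ : Q = posCorrelation ħ β (closedInvMass M⁻¹ m⁻¹) (closedSpring C c g)) (A : σ) (a : ε) :
    HasDerivAt (fun s : ℝ => Real.log (closedZ ħ β C M⁻¹ c m⁻¹ (g + Matrix.single a A s)))
      (β * (Q.toBlocks₁₂ - Q.toBlocks₁₁ * gᵀ * c⁻¹) A a) 0 := by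
  have hs : Qᵀ = Q := by
    rw [hQ, transpose_posCorrelation hħ hβ (posDef_closedInvMass hM hm)
      (posDef_closedSpring hC hc g)]
  set E : Matrix ε σ ℝ := Matrix.single a A 1 with hE
  have hET : Eᵀ = Matrix.single A a 1 := transpose_single a A 1
  have h := hasDerivAt_log_partitionFunction_of_expansion hħ hβ (posDef_closedInvMass hM hm)
    (posDef_closedSpring hC hc g) (K := fun _ => closedInvMass M⁻¹ m⁻¹) (K₁ := 0)
    (V := fun s => closedSpring C c (g + Matrix.single a A s))
    -- The renormalization is quadratic in `g`, so the expansion is exact with an `s²` term that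
    -- does not affect the derivative.
    (V₁ := fromBlocks (Eᵀ * c⁻¹ * g + gᵀ * c⁻¹ * E) (-Eᵀ) (-E) 0)
    (V₂ := fromBlocks (Eᵀ * c⁻¹ * E) 0 0 0) (θ := fun s => s ^ 2) (t := 0)
    (by fun_prop) (by simp) (by simpa using hasDerivAt_pow 2 (0 : ℝ)) (fun s => by simp)
    (Eventually.of_forall fun s => by
      rw [closedSpring, closedSpring, fromBlocks_smul, fromBlocks_smul, fromBlocks_add,
        fromBlocks_add, single_eq_smul a A s, ← hE]
      congr 1
      · simp only [transpose_add, transpose_smul, Matrix.add_mul, Matrix.mul_add, Matrix.smul_mul,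
          Matrix.mul_smul]
        module
      · rw [transpose_add, transpose_smul]; module
      · module
      · simp)
  have q11 : (Q.toBlocks₁₁)ᵀ = Q.toBlocks₁₁ := by
    ext i j; exact congrFun₂ hs (Sum.inl i) (Sum.inl j)
  have q21 : Q.toBlocks₂₁ = (Q.toBlocks₁₂)ᵀ := by
    ext i j; exact (congrFun₂ hs (Sum.inr i) (Sum.inl j)).symm
  -- Transposition equates the two mixed traces, and the off-diagonal blocks likewise contribute
  -- equally; this doubling turns the prefactor `β/2` into `β`.
  have e1 : (Q.toBlocks₁₁ * (Eᵀ * c⁻¹ * g)).trace = (Q.toBlocks₁₁ * (gᵀ * c⁻¹ * E)).trace := by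
    rw [← trace_transpose, transpose_mul, q11, trace_mul_comm]
    simp only [transpose_mul, transpose_transpose, transpose_nonsing_inv, transpose_of_posDef hc,
      Matrix.mul_assoc]
  have e2 : (Q.toBlocks₁₁ * (gᵀ * c⁻¹ * E)).trace = (Q.toBlocks₁₁ * gᵀ * c⁻¹) A a := by
    rw [← Matrix.mul_assoc, ← Matrix.mul_assoc, hE, trace_mul_single_one]
  rw [← hQ, zero_smul, add_zero, Matrix.mul_zero, trace_zero, add_zero, trace_mul_fromBlocks,
    Matrix.mul_add, trace_add, e1, e2, Matrix.mul_neg, Matrix.mul_neg, trace_neg, trace_neg, hET,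
    hE, trace_mul_single_one, trace_mul_single_one, q21, transpose_apply, Matrix.mul_zero,
    trace_zero] at h
  refine h.congr_deriv ?_
  rw [Matrix.sub_apply]
  ring

theorem hasDerivAt_log_closedZ_reservoirSpring (hħ : 0 < ħ) (hβ : 0 < β) (hM : M.PosDef)
    (hC : C.PosDef) (hm : m.PosDef) (hc : c.PosDef) (g : Matrix ε σ ℝ)
    {Q : Matrix (σ ⊕ ε) (σ ⊕ ε) ℝ}
    (hQ : Q = posCorrelation ħ β (closedInvMass M⁻¹ m⁻¹) (closedSpring C c g)) (a b : ε) :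
    HasDerivAt (fun s : ℝ => Real.log (closedZ ħ β C M⁻¹ (c + Matrix.single a b s) m⁻¹ g))
      (-(β / 2) * (Q.toBlocks₂₂ - c⁻¹ * g * Q.toBlocks₁₁ * gᵀ * c⁻¹) a b) 0 := by
  have hs : Qᵀ = Q := by
    rw [hQ, transpose_posCorrelation hħ hβ (posDef_closedInvMass hM hm)
      (posDef_closedSpring hC hc g)]
  set E : Matrix ε ε ℝ := Matrix.single a b 1 with hE
  have hd : ContDiffAt ℝ 1 (fun s : ℝ => s / (1 + s * c⁻¹ b a)) 0 :=
    contDiffAt_id.div (contDiffAt_const.add (contDiffAt_id.mul contDiffAt_const)) (by simp)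
  have hd' : HasDerivAt (fun s : ℝ => s / (1 + s * c⁻¹ b a)) 1 0 := by
    have := (hasDerivAt_id (0 : ℝ)).div
      (((hasDerivAt_id (0 : ℝ)).mul_const (c⁻¹ b a)).const_add 1) (by simp)
    simpa using! this
  have hne : ∀ᶠ s : ℝ in 𝓝 0, 1 + s * c⁻¹ b a ≠ 0 :=
    ContinuousAt.eventually_ne (by fun_prop) (by simp)
  have h := hasDerivAt_log_partitionFunction_of_expansion hħ hβ (posDef_closedInvMass hM hm)
    (posDef_closedSpring hC hc g) (K := fun _ => closedInvMass M⁻¹ m⁻¹) (K₁ := 0)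
    (V := fun s => closedSpring C (c + Matrix.single a b s) g)
    (V₁ := fromBlocks 0 0 0 E)
    -- Varying `c` also varies `c⁻¹` in the renormalization; this term produces the correction
    -- involving the system position correlations.
    (V₂ := fromBlocks (-(gᵀ * (c⁻¹ * E * c⁻¹) * g)) 0 0 0)
    hd (by simp) hd' (fun s => by simp)
    (hne.mono fun s hs => by
      rw [closedSpring, closedSpring, fromBlocks_smul, fromBlocks_smul, fromBlocks_add,
        fromBlocks_add, inv_add_single (isUnit_det_of_posDef hc) a b hs, single_eq_smul a b s, ← hE]
      congr 1
      · rw [Matrix.mul_sub, Matrix.sub_mul, Matrix.mul_smul, Matrix.smul_mul]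
        module
      · simp
      · simp
      · simp)
  have q11 : (Q.toBlocks₁₁)ᵀ = Q.toBlocks₁₁ := by
    ext i j; exact congrFun₂ hs (Sum.inl i) (Sum.inl j)
  have q22 : (Q.toBlocks₂₂)ᵀ = Q.toBlocks₂₂ := by
    ext i j; exact congrFun₂ hs (Sum.inr i) (Sum.inr j)
  have e1 : (Q.toBlocks₁₁ * (gᵀ * (c⁻¹ * E * c⁻¹) * g)).trace =
      (c⁻¹ * g * Q.toBlocks₁₁ * gᵀ * c⁻¹) b a := by
    rw [← trace_mul_single_one (c⁻¹ * g * Q.toBlocks₁₁ * gᵀ * c⁻¹) a b, ← hE]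
    have : Q.toBlocks₁₁ * (gᵀ * (c⁻¹ * E * c⁻¹) * g) =
        (Q.toBlocks₁₁ * gᵀ * c⁻¹ * E) * (c⁻¹ * g) := by simp only [Matrix.mul_assoc]
    rw [this, trace_mul_comm]
    simp only [Matrix.mul_assoc]
  have e2 : (Q.toBlocks₂₂ - c⁻¹ * g * Q.toBlocks₁₁ * gᵀ * c⁻¹)ᵀ =
      Q.toBlocks₂₂ - c⁻¹ * g * Q.toBlocks₁₁ * gᵀ * c⁻¹ := by
    simp only [transpose_sub, transpose_mul, transpose_transpose, transpose_nonsing_inv,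
      transpose_of_posDef hc, q11, q22, Matrix.mul_assoc]
  rw [← hQ, one_smul, Matrix.mul_zero, trace_zero, add_zero, fromBlocks_add, zero_add, add_zero, hE,
    trace_mul_fromBlocks, Matrix.mul_neg, trace_neg, e1, add_zero (Matrix.single a b (1 : ℝ)), trace_mul_single_one] at h
  refine h.congr_deriv ?_
  rw [← e2, transpose_apply, Matrix.sub_apply]
  simp only [add_zero, Matrix.mul_zero, trace_zero]
  ring

theorem hasDerivAt_log_closedZ_invMass (hħ : 0 < ħ) (hβ : 0 < β) (hM : M.PosDef) (hC : C.PosDef)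
    (hm : m.PosDef) (hc : c.PosDef) (g : Matrix ε σ ℝ) {P : Matrix (σ ⊕ ε) (σ ⊕ ε) ℝ}
    (hP : P = momCorrelation ħ β (closedInvMass M⁻¹ m⁻¹) (closedSpring C c g)) (A B : σ) :
    HasDerivAt (fun s : ℝ => Real.log (closedZ ħ β C (M⁻¹ + Matrix.single A B s) c m⁻¹ g))
      (-(β / 2) * P.toBlocks₁₁ A B) 0 := by
  have hs : Pᵀ = P := by
    rw [hP, transpose_momCorrelation hħ hβ (posDef_closedInvMass hM hm)
      (posDef_closedSpring hC hc g)]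
  have h := hasDerivAt_log_partitionFunction_of_expansion hħ hβ (posDef_closedInvMass hM hm)
    (posDef_closedSpring hC hc g) (K := fun s => closedInvMass (M⁻¹ + Matrix.single A B s) m⁻¹)
    (K₁ := fromBlocks (Matrix.single A B 1) 0 0 0) (V := fun _ => closedSpring C c g)
    (V₁ := 0) (V₂ := 0) (θ := fun _ => 0) (t := 0)
    contDiffAt_const rfl (hasDerivAt_const _ _) (fun s => by
      rw [closedInvMass, closedInvMass, fromBlocks_smul, fromBlocks_add, single_eq_smul A B s]
      simp only [smul_zero, add_zero]) (Eventually.of_forall fun s => by simp)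
  rw [← hP, smul_zero, add_zero, Matrix.mul_zero, trace_zero, zero_add, trace_mul_fromBlocks,
    trace_mul_single_one] at h
  simp only [Matrix.mul_zero, trace_zero, add_zero] at h
  have e : P.toBlocks₁₁ B A = P.toBlocks₁₁ A B := congrFun₂ hs (Sum.inl A) (Sum.inl B)
  rwa [e] at h

theorem hasDerivAt_log_closedZ_reservoirInvMass (hħ : 0 < ħ) (hβ : 0 < β) (hM : M.PosDef)
    (hC : C.PosDef) (hm : m.PosDef) (hc : c.PosDef) (g : Matrix ε σ ℝ)
    {P : Matrix (σ ⊕ ε) (σ ⊕ ε) ℝ}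
    (hP : P = momCorrelation ħ β (closedInvMass M⁻¹ m⁻¹) (closedSpring C c g)) (a b : ε) :
    HasDerivAt (fun s : ℝ => Real.log (closedZ ħ β C M⁻¹ c (m⁻¹ + Matrix.single a b s) g))
      (-(β / 2) * P.toBlocks₂₂ a b) 0 := by
  have hs : Pᵀ = P := by
    rw [hP, transpose_momCorrelation hħ hβ (posDef_closedInvMass hM hm)
      (posDef_closedSpring hC hc g)]
  have h := hasDerivAt_log_partitionFunction_of_expansion hħ hβ (posDef_closedInvMass hM hm)
    (posDef_closedSpring hC hc g) (K := fun s => closedInvMass M⁻¹ (m⁻¹ + Matrix.single a b s))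
    (K₁ := fromBlocks 0 0 0 (Matrix.single a b 1)) (V := fun _ => closedSpring C c g)
    (V₁ := 0) (V₂ := 0) (θ := fun _ => 0) (t := 0)
    contDiffAt_const rfl (hasDerivAt_const _ _) (fun s => by
      rw [closedInvMass, closedInvMass, fromBlocks_smul, fromBlocks_add, single_eq_smul a b s]
      simp only [smul_zero, add_zero]) (Eventually.of_forall fun s => by simp)
  rw [← hP, smul_zero, add_zero, Matrix.mul_zero, trace_zero, zero_add, trace_mul_fromBlocks,
    trace_mul_single_one] at h
  simp only [Matrix.mul_zero, trace_zero, zero_add] at h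
  have e : P.toBlocks₂₂ b a = P.toBlocks₂₂ a b := congrFun₂ hs (Sum.inr a) (Sum.inr b)
  rwa [e] at h

end ClosedPerturbation

end QBM

end

/-! ### Assembly: system and reservoir blocks of the correlation matrices -/

theorem mainTheorem3 {σ ε : Type*} [Fintype σ] [DecidableEq σ] [Fintype ε] [DecidableEq ε]
    (ħ β : ℝ) (hħ : 0 < ħ) (hβ : 0 < β)
    (M C : Matrix σ σ ℝ) (m c : Matrix ε ε ℝ) (g : Matrix ε σ ℝ)
    (hM : M.PosDef) (hC : C.PosDef) (hm : m.PosDef) (hc : c.PosDef) :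
    let ν : ℕ → ℝ := matsubara ħ β
    let G : ℝ → Matrix σ σ ℝ := propHat M C m c g
    let γ : ℝ → Matrix σ σ ℝ := dampingHat m c g
    let f : ℝ → Matrix ε ε ℝ := freePropHat m c
    HasThermalState ħ β (closedInvMass M⁻¹ m⁻¹) (closedSpring C c g) ∧
    HasThermalState ħ β m⁻¹ c ∧
    ∃ (XX PP : Matrix σ σ ℝ) (Xx Pp : Matrix σ ε ℝ) (xx pp xxE ppE : Matrix ε ε ℝ),
      -- the correlation matrices of the closed system and of the free reservoir
      IsClosedCorrelation ħ β M C m c g sysX sysX XX ∧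
      IsClosedCorrelation ħ β M C m c g (sysP ħ) (sysP ħ) PP ∧
      IsClosedCorrelation ħ β M C m c g sysX envX Xx ∧
      IsClosedCorrelation ħ β M C m c g (sysP ħ) (envP ħ) Pp ∧
      IsClosedCorrelation ħ β M C m c g envX envX xx ∧
      IsClosedCorrelation ħ β M C m c g (envP ħ) (envP ħ) pp ∧
      IsFreeCorrelation ħ β m c posOp posOp xxE ∧
      IsFreeCorrelation ħ β m c (momOp ħ) (momOp ħ) ppE ∧
      -- position-momentum correlations vanish
      IsClosedCorrelation ħ β M C m c g sysX (sysP ħ) 0 ∧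
      IsClosedCorrelation ħ β M C m c g sysX (envP ħ) 0 ∧
      IsClosedCorrelation ħ β M C m c g envX (sysP ħ) 0 ∧
      IsClosedCorrelation ħ β M C m c g envX (envP ħ) 0 ∧
      -- system positions
      (Summable (fun r : ℕ => G (ν (r + 1))) ∧
        XX = (1 / β) • G (ν 0) + (2 / β) • ∑' r : ℕ, G (ν (r + 1))) ∧
      -- system momenta
      (Summable (fun r : ℕ => M - ν (r + 1) ^ 2 • (M * G (ν (r + 1)) * M)) ∧
        PP = (1 / β) • (M - ν 0 ^ 2 • (M * G (ν 0) * M)) +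
          (2 / β) • ∑' r : ℕ, (M - ν (r + 1) ^ 2 • (M * G (ν (r + 1)) * M))) ∧
      -- system and reservoir positions, for any coupling matrix
      (Summable (fun r : ℕ => ν (r + 1) ^ 2 • (G (ν (r + 1)) * gᵀ * f (ν (r + 1)) * m * c⁻¹)) ∧
        Xx = XX * gᵀ * c⁻¹ -
          (2 / β) • ∑' r : ℕ, ν (r + 1) ^ 2 • (G (ν (r + 1)) * gᵀ * f (ν (r + 1)) * m * c⁻¹)) ∧
      -- the same in terms of the damping kernel, if the coupling matrix has a (right) inverse
      (∀ ginv : Matrix σ ε ℝ, g * ginv = 1 →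
        Summable (fun r : ℕ => ν (r + 1) • (G (ν (r + 1)) * γ (ν (r + 1)) * ginv)) ∧
        Xx = XX * gᵀ * c⁻¹ -
          (4 / β) • ∑' r : ℕ, ν (r + 1) • (G (ν (r + 1)) * γ (ν (r + 1)) * ginv)) ∧
      -- system and reservoir momenta
      Pp = M * Xx * c - M * XX * gᵀ ∧
      -- reservoir momenta
      (Summable (fun r : ℕ => ν (r + 1) ^ 2 •
          (m * f (ν (r + 1)) * g * G (ν (r + 1)) * gᵀ * f (ν (r + 1)) * m)) ∧
        pp = ppE - (2 / β) • ∑' r : ℕ, ν (r + 1) ^ 2 •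
          (m * f (ν (r + 1)) * g * G (ν (r + 1)) * gᵀ * f (ν (r + 1)) * m)) ∧
      -- reservoir positions
      (Summable (fun r : ℕ => ν (r + 1) ^ 2 •
          (c⁻¹ * m * f (ν (r + 1)) * g * G (ν (r + 1)) * gᵀ * f (ν (r + 1)))) ∧
        Summable (fun r : ℕ => ν (r + 1) ^ 2 •
          (f (ν (r + 1)) * g * G (ν (r + 1)) * gᵀ * f (ν (r + 1)) * m * c⁻¹)) ∧
        Summable (fun r : ℕ => ν (r + 1) ^ 4 •
          (c⁻¹ * m * f (ν (r + 1)) * g * G (ν (r + 1)) * gᵀ * f (ν (r + 1)) * m * c⁻¹)) ∧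
        xx = xxE + c⁻¹ * g * XX * gᵀ * c⁻¹
          - (2 / β) • ∑' r : ℕ, ν (r + 1) ^ 2 •
            (c⁻¹ * m * f (ν (r + 1)) * g * G (ν (r + 1)) * gᵀ * f (ν (r + 1)))
          - (2 / β) • ∑' r : ℕ, ν (r + 1) ^ 2 •
            (f (ν (r + 1)) * g * G (ν (r + 1)) * gᵀ * f (ν (r + 1)) * m * c⁻¹)
          - (2 / β) • ∑' r : ℕ, ν (r + 1) ^ 4 •
            (c⁻¹ * m * f (ν (r + 1)) * g * G (ν (r + 1)) * gᵀ * f (ν (r + 1)) * m * c⁻¹)) ∧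
      -- the correlations as partial derivatives of `log Z_C` in the entries of the model matrices
      (∃ dC : Matrix σ σ ℝ,
        (∀ A B, HasDerivAt (fun s : ℝ => Real.log
          (closedZ ħ β (C + Matrix.single A B s) M⁻¹ c m⁻¹ g)) (dC A B) 0) ∧
        XX = -(2 / β) • dC) ∧
      (∃ dMinv : Matrix σ σ ℝ,
        (∀ A B, HasDerivAt (fun s : ℝ => Real.log
          (closedZ ħ β C (M⁻¹ + Matrix.single A B s) c m⁻¹ g)) (dMinv A B) 0) ∧
        PP = -(2 / β) • dMinv) ∧
      (∃ dgT : Matrix σ ε ℝ,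
        (∀ A a, HasDerivAt (fun s : ℝ => Real.log
          (closedZ ħ β C M⁻¹ c m⁻¹ (g + Matrix.single a A s))) (dgT A a) 0) ∧
        Xx = (1 / β) • dgT + XX * gᵀ * c⁻¹) ∧
      (∃ dc : Matrix ε ε ℝ,
        (∀ a b, HasDerivAt (fun s : ℝ => Real.log
          (closedZ ħ β C M⁻¹ (c + Matrix.single a b s) m⁻¹ g)) (dc a b) 0) ∧
        xx = -(2 / β) • dc + c⁻¹ * g * XX * gᵀ * c⁻¹) ∧
      (∃ dminv : Matrix ε ε ℝ,
        (∀ a b, HasDerivAt (fun s : ℝ => Real.log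
          (closedZ ħ β C M⁻¹ c (m⁻¹ + Matrix.single a b s) g)) (dminv a b) 0) ∧
        pp = -(2 / β) • dminv) := by
  intro ν G γ f
  obtain ⟨hT, hX, hP, hXP⟩ := thermal_correlations hħ hβ (posDef_closedInvMass hM hm)
    (posDef_closedSpring hC hc g)
  obtain ⟨hTE, hXE, hPE, -⟩ := thermal_correlations hħ hβ hm.inv hc
  obtain ⟨Q, hQ⟩ : ∃ Q, Q = posCorrelation ħ β (closedInvMass M⁻¹ m⁻¹) (closedSpring C c g) :=
    ⟨_, rfl⟩
  obtain ⟨P, hP'⟩ : ∃ P, P = momCorrelation ħ β (closedInvMass M⁻¹ m⁻¹) (closedSpring C c g) :=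
    ⟨_, rfl⟩
  obtain ⟨e1, e2, e3, e4, e5, e6, e7⟩ := closed_correlation_formulas hħ hβ hM hC hm hc g
    (ν := fun r => ν (r + 1)) (G := fun r => G (ν (r + 1))) (γ := fun r => γ (ν (r + 1)))
    (f := fun r => f (ν (r + 1))) (fun _ => rfl) (fun _ => rfl) (fun _ => rfl) (fun _ => rfl) hQ hP'
  -- At zero frequency `Ĝ` is `C⁻¹` and the subtraction in the momentum term disappears, which
  -- matches the separate first terms of the Matsubara sums.
  have hν0 : ν 0 = 0 := by simp [ν, matsubara]
  have hG0 : G (ν 0) = C⁻¹ := by rw [hν0]; exact propHat_zero M C m c g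
  have hM0 : M - ν 0 ^ 2 • (M * G (ν 0) * M) = M := by simp [hν0]
  -- The prefactors in the theorem invert the factors `-β/2` and `β` of the computed derivatives.
  have hneg : ∀ x : ℝ, -(2 / β) * (-(β / 2) * x) = x := fun x => by field_simp
  have hone : ∀ x : ℝ, 1 / β * (β * x) = x := fun x => by field_simp
  rw [← hQ] at hX
  rw [← hP'] at hP
  refine ⟨hT, hTE, Q.toBlocks₁₁, P.toBlocks₁₁, Q.toBlocks₁₂, P.toBlocks₁₂, Q.toBlocks₂₂,
    P.toBlocks₂₂, posCorrelation ħ β m⁻¹ c, momCorrelation ħ β m⁻¹ c,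
    fun i j => hX (Sum.inl i) (Sum.inl j), fun i j => hP (Sum.inl i) (Sum.inl j),
    fun i j => hX (Sum.inl i) (Sum.inr j), fun i j => hP (Sum.inl i) (Sum.inr j),
    fun i j => hX (Sum.inr i) (Sum.inr j), fun i j => hP (Sum.inr i) (Sum.inr j),
    hXE, hPE, fun i j => hXP (Sum.inl i) (Sum.inl j), fun i j => hXP (Sum.inl i) (Sum.inr j),
    fun i j => hXP (Sum.inr i) (Sum.inl j), fun i j => hXP (Sum.inr i) (Sum.inr j),
    ⟨e1.1, by rw [hG0]; exact e1.2⟩, ⟨e2.1, by rw [hM0]; exact e2.2⟩, e3, e4, e5, e6, e7,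
    ⟨_, hasDerivAt_log_closedZ_spring hħ hβ hM hC hm hc g hQ, ?_⟩,
    ⟨_, hasDerivAt_log_closedZ_invMass hħ hβ hM hC hm hc g hP', ?_⟩,
    ⟨_, hasDerivAt_log_closedZ_coupling hħ hβ hM hC hm hc g hQ, ?_⟩,
    ⟨_, hasDerivAt_log_closedZ_reservoirSpring hħ hβ hM hC hm hc g hQ, ?_⟩,
    ⟨_, hasDerivAt_log_closedZ_reservoirInvMass hħ hβ hM hC hm hc g hP', ?_⟩⟩
  · ext i j
    exact (hneg _).symm
  · ext i j
    exact (hneg _).symm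
  · rw [← sub_eq_iff_eq_add]
    ext i j
    exact (hone _).symm
  · rw [← sub_eq_iff_eq_add]
    ext i j
    exact (hneg _).symm
  · ext i j
    exact (hneg _).symm
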